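/- Let $A_0,\dots,A_n$ be real symmetric $m\times m$ matrices, let $A(x)=A_0+x_1A_1+\cdots+x_nA_n$, and let $B$ be a real positive definite $m\times m$ matrix. Let $\mathbb{R}\langle\varepsilon\rangle$ be the ordered field of Puiseux series $\sum_{i\ge i_0}a_i\varepsilon^{i/q}$ ($i_0\in\mathbb{Z}$, $q\in\mathbb{N}_{>0}$, $a_i\in\mathbb{R}$) in a positive infinitesimal $\varepsilon$, with the topology given by its order. Such a series is bounded over $\mathbb{R}$ if it has no term with a negative exponent, and then $\lim_\varepsilon$ of it is its constant coefficient; both notions are extended to $\mathbb{R}\langle\varepsilon\rangle^n$ coordinatewise. Put $$\mathscr{S}(A)=\{x\in\mathbb{R}^n : A(x)\succeq 0\},\qquad \mathscr{S}(A+\varepsilon B)=\{x\in\mathbb{R}\langle\varepsilon\rangle^n : A(x)+\varepsilon B\succeq 0\},$$ and identify $\ell=(\ell_1,\dots,\ell_n)$ with the linear form $\ell(x)=\ell_1x_1+\cdots+\ell_nx_n$. Then there is a non-empty Zariski open set $U\subset\mathbb{C}^n$ such that for every $\ell\in U\cap\mathbb{R}^n$ the sets $\ell(\mathscr{S}(A))\subset\mathbb{R}$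 and $\ell(\mathscr{S}(A+\varepsilon B))\subset\mathbb{R}\langle\varepsilon\rangle$ are closed and the following hold. 1. If $x^*\in\mathscr{S}(A)$ and $\ell(x^*)$ lies in the boundary of $\ell(\mathscr{S}(A))$, then there is $x^*_\varepsilon\in\mathscr{S}(A+\varepsilon B)$, bounded over $\mathbb{R}$, such that $\ell(x^*_\varepsilon)$ lies in the boundary of $\ell(\mathscr{S}(A+\varepsilon B))$ and $\lim_\varepsilon x^*_\varepsilon=x^*$. 2. Conversely, if $\mathscr{S}(A)\neq\emptyset$, $x^*_\varepsilon\in\mathscr{S}(A+\varepsilon B)$ and $\ell(x^*_\varepsilon)$ lies in the boundary of $\ell(\mathscr{S}(A+\varepsilon B))$, then $x^*_\varepsilon$ is bounded over $\mathbb{R}$, $\lim_\varepsilon x^*_\varepsilon\in\mathscr{S}(A)$, and $\ell(\lim_\varepsilon x^*_\varepsilon)$ lies in the boundary of $\ell(\mathscr{S}(A))$. -/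

import Mathlib

noncomputable section

open HahnSeries

/-! ### The ordered field of Puiseux series with real coefficients -/

/-- A Hahn series `∑ aᵢ εⁱ` with rational exponents is a Puiseux series if its exponents have a
common denominator. (They are bounded below because the support is well-ordered.) -/
def IsPuiseux (f : HahnSeries ℚ ℝ) : Prop :=
  ∃ q : ℕ, 0 < q ∧ ∀ i : ℚ, f.coeff i ≠ 0 → ∃ k : ℤ, i = k / q

theorem IsPuiseux.add {f g : HahnSeries ℚ ℝ} (hf : IsPuiseux f) (hg : IsPuiseux g) :
    IsPuiseux (f + g) := by
  obtain ⟨p, hp, hf⟩ := hf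
  obtain ⟨q, hq, hg⟩ := hg
  have hp' : (p : ℚ) ≠ 0 := by positivity
  have hq' : (q : ℚ) ≠ 0 := by positivity
  refine ⟨p * q, Nat.mul_pos hp hq, fun i hi => ?_⟩
  by_cases h : f.coeff i = 0
  · have h2 : g.coeff i ≠ 0 := by
      intro h2
      exact hi (by simp [h, h2])
    obtain ⟨k, rfl⟩ := hg i h2
    exact ⟨k * p, by push_cast; field_simp⟩
  · obtain ⟨k, rfl⟩ := hf i h
    exact ⟨k * q, by push_cast; field_simp⟩

theorem IsPuiseux.mul {f g : HahnSeries ℚ ℝ} (hf : IsPuiseux f) (hg : IsPuiseux g) :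
    IsPuiseux (f * g) := by
  obtain ⟨p, hp, hf⟩ := hf
  obtain ⟨q, hq, hg⟩ := hg
  have hp' : (p : ℚ) ≠ 0 := by positivity
  have hq' : (q : ℚ) ≠ 0 := by positivity
  refine ⟨p * q, Nat.mul_pos hp hq, fun i hi => ?_⟩
  obtain ⟨a, ha, b, hb, rfl⟩ := support_mul_subset ((mem_support _ _).2 hi)
  obtain ⟨k, rfl⟩ := hf a ha
  obtain ⟨l, rfl⟩ := hg b hb
  exact ⟨k * q + l * p, by push_cast; field_simp⟩

theorem isPuiseux_single_int (k : ℤ) (r : ℝ) : IsPuiseux (single (k : ℚ) r) := by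
  refine ⟨1, one_pos, fun i hi => ⟨k, ?_⟩⟩
  by_contra h
  exact hi (coeff_single_of_ne (by simpa using h))

theorem IsPuiseux.neg {f : HahnSeries ℚ ℝ} (hf : IsPuiseux f) : IsPuiseux (-f) := by
  obtain ⟨p, hp, hf⟩ := hf
  exact ⟨p, hp, fun i hi => hf i (by simpa using hi)⟩

theorem IsPuiseux.inv {f : HahnSeries ℚ ℝ} (hf : IsPuiseux f) : IsPuiseux f⁻¹ := by
  obtain ⟨p, hp, hf⟩ := hf
  have hp' : (0 : ℚ) < p := by positivity
  let φ : ℤ →+ ℚ :=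
    { toFun := fun k => k / p
      map_zero' := by simp
      map_add' := fun a b => by push_cast; ring }
  have hlt : ∀ a b : ℤ, φ a < φ b ↔ a < b := fun a b => by
    change (a : ℚ) / p < (b : ℚ) / p ↔ a < b
    rw [div_lt_div_iff_of_pos_right hp']
    exact_mod_cast Iff.rfl
  have hle : ∀ a b : ℤ, φ a ≤ φ b ↔ a ≤ b := fun a b => by
    rw [← not_lt, ← not_lt, hlt]
  have hinj : Function.Injective φ := fun a b h =>
    le_antisymm ((hle a b).1 h.le) ((hle b a).1 h.ge)
  let g : HahnSeries ℤ ℝ :=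
    { coeff := fun k => f.coeff (φ k)
      isPWO_support' := by
        rw [Set.isPWO_iff_isWF]
        have h := f.isWF_support
        rw [Set.isWF_iff_no_descending_seq] at h ⊢
        intro u hu hmem
        exact h (fun j => φ (u j)) (fun a b hab => (hlt _ _).2 (hu hab)) (fun j => hmem j) }
  have hfg : embDomainRingHom φ hinj hle g = f := by
    ext i
    by_cases hi : f.coeff i = 0
    · by_cases hr : ∃ k, φ k = i
      · obtain ⟨k, rfl⟩ := hr
        exact embDomain_coeff (f := ⟨⟨φ, hinj⟩, hle _ _⟩) (x := g) (a := k)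
      · rw [hi]
        exact embDomain_of_notMem_range (f := ⟨⟨φ, hinj⟩, hle _ _⟩) (x := g)
          (by rintro ⟨k, hk⟩; exact hr ⟨k, hk⟩)
    · obtain ⟨k, rfl⟩ := hf i hi
      exact embDomain_coeff (f := ⟨⟨φ, hinj⟩, hle _ _⟩) (x := g) (a := k)
  rw [← hfg, ← map_inv₀]
  refine ⟨p, hp, fun i hi => ?_⟩
  by_contra h
  apply hi
  exact embDomain_of_notMem_range (f := ⟨⟨φ, hinj⟩, hle _ _⟩) (x := g⁻¹)
    (by rintro ⟨k, hk⟩; exact h ⟨k, hk.symm⟩)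

/-- The Puiseux series as a subfield of the Hahn series, the latter with the lexicographic order
(the sign of a series is the sign of its coefficient of lowest exponent). -/
def puiseuxSubfield : Subfield (Lex (HahnSeries ℚ ℝ)) where
  carrier := {f | IsPuiseux (ofLex f)}
  mul_mem' := IsPuiseux.mul
  one_mem' := by simpa using isPuiseux_single_int 0 1
  add_mem' := IsPuiseux.add
  zero_mem' := by simpa using isPuiseux_single_int 0 0
  neg_mem' := IsPuiseux.neg
  inv_mem' := fun _ => IsPuiseux.inv

/-- The field `ℝ⟨ε⟩` of Puiseux series in the infinitesimal `ε` with real coefficients. -/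
def Puiseux : Type := puiseuxSubfield

namespace Puiseux

instance : Field Puiseux := inferInstanceAs (Field puiseuxSubfield)

instance : LinearOrder Puiseux := inferInstanceAs (LinearOrder puiseuxSubfield)

instance : IsStrictOrderedRing Puiseux := inferInstanceAs (IsStrictOrderedRing puiseuxSubfield)

/-- The trivial star operation, so that "Hermitian" means "symmetric". -/
instance : StarRing Puiseux := starRingOfComm

instance : TrivialStar Puiseux := ⟨fun _ => rfl⟩

/-- The Euclidean topology of the ordered field `ℝ⟨ε⟩`, generated by open intervals. -/
instance : TopologicalSpace Puiseux := Preorder.topology Puiseux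

instance : OrderTopology Puiseux := ⟨rfl⟩

/-- The coefficient of `εⁱ`. -/
def coeff (z : Puiseux) (i : ℚ) : ℝ := (ofLex z.1).coeff i

/-- The infinitesimal `ε`. -/
def eps : Puiseux := ⟨toLex (single 1 1), show IsPuiseux (single 1 1) by simpa using isPuiseux_single_int 1 1⟩

/-- The inclusion of the real numbers into `ℝ⟨ε⟩` as constant series. -/
def const : ℝ →+* Puiseux :=
  (HahnSeries.C : ℝ →+* HahnSeries ℚ ℝ).codRestrict puiseuxSubfield
    (fun r => by simpa using! isPuiseux_single_int 0 r)

/-- `z` is bounded over `ℝ`: it has no term with a negative exponent. -/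
def IsBounded (z : Puiseux) : Prop := ∀ i : ℚ, i < 0 → z.coeff i = 0

/-- The limit of a bounded series when `ε` tends to `0`: its constant coefficient. It is only
meaningful for `z` with `z.IsBounded`. -/
def limEps (z : Puiseux) : ℝ := z.coeff 0

end Puiseux

/-! ### Spectrahedra, linear forms, Zariski open sets -/

section

variable {R : Type*} [Field R] [PartialOrder R] [StarRing R] {m n : ℕ}

/-- The linear pencil `A₀ + x₁ A₁ + ⋯ + xₙ Aₙ`. -/
def pencil (A₀ : Matrix (Fin m) (Fin m) R) (A : Fin n → Matrix (Fin m) (Fin m) R)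
    (x : Fin n → R) : Matrix (Fin m) (Fin m) R :=
  A₀ + ∑ i, x i • A i

/-- The spectrahedron of all `x` for which `A₀ + x₁ A₁ + ⋯ + xₙ Aₙ` is positive semidefinite. -/
def spectrahedron (A₀ : Matrix (Fin m) (Fin m) R) (A : Fin n → Matrix (Fin m) (Fin m) R) :
    Set (Fin n → R) :=
  {x | (pencil A₀ A x).PosSemidef}

/-- The linear form `ℓ₁ x₁ + ⋯ + ℓₙ xₙ`. -/
def linForm (l : Fin n → R) (x : Fin n → R) : R := ∑ i, l i * x i

end

/-- The spectrahedron of `A + εB` over `ℝ⟨ε⟩`. -/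
def perturbedSpectrahedron {m n : ℕ} (A₀ : Matrix (Fin m) (Fin m) ℝ)
    (A : Fin n → Matrix (Fin m) (Fin m) ℝ) (B : Matrix (Fin m) (Fin m) ℝ) :
    Set (Fin n → Puiseux) :=
  spectrahedron (A₀.map Puiseux.const + Puiseux.eps • B.map Puiseux.const)
    (fun i => (A i).map Puiseux.const)

/-- A linear form with real coefficients, seen over `ℝ⟨ε⟩`. -/
def linFormEps {n : ℕ} (l : Fin n → ℝ) : (Fin n → Puiseux) → Puiseux :=
  linForm (fun i => Puiseux.const (l i))

/-- Zariski open subsets of `ℂⁿ`: complements of zero sets of ideals of polynomials. -/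
def IsZariskiOpen {n : ℕ} (U : Set (Fin n → ℂ)) : Prop :=
  ∃ I : Ideal (MvPolynomial (Fin n) ℂ), U = (MvPolynomial.zeroLocus ℂ I)ᶜ

end

noncomputable section

open HahnSeries

/-! For generic `l`, a minimizer of `l` on S(A) is unique if it exists, and the minimizers on S(A +
tB), for real t > 0, are algebraic functions of t. Their Puiseux expansions at t = 0 minimize `l`
over ℝ⟨ε⟩, and both assertions are read off from limits. Maxima are minima of `-l`.

Algebraicity (`exists_polynomial_minimizer`): if t, x_j and `l` satisfied no common polynomial
relation over all minimizers x, they would become algebraically independent in an ultrapower of ℝ,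
and derivations could be prescribed on them freely. The envelope theorem
(`linForm_derivation_eq_zero`) gives δ(l(x)) = ∑ δ(l_i) x_i whenever δt = 0. Let D move l_j but no
other l_i and not x_j, and let E move only x_j. Then [E, D] kills t and `l`, hence l(x); but D(l(x))
= x_j and E(l(x)) = 0, so [E, D](l(x)) = E(x_j) = 1. With B = 0 the relation forbids a segment of
minimizers (`isGeneric_minimizer_unique`). On the recession cone, uniqueness says that `l` is
negative somewhere or positive on all nonzero vectors (`isGeneric_recession`); in the second case
`l` is coercive and minima exist.

Transfer: by the Newton–Puiseux theorem (`puiseuxField_isAlgClosed`), an algebraic function has a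
Puiseux expansion along a fixed ultrafilter at 0⁺ (`exists_asym_of_evalAlong_eq_zero`); conversely
every Puiseux series expands some function. A point of S(A + εB) is represented only by points of
S(A + (t + t^a)B), with a as large as desired. Mixing in a point of S(A + (t/2)B) with a small
weight repairs this, so lower bounds on the real sets pass to ℝ⟨ε⟩ (`le_linFormEps_of_forall_le`).
Hence the expansion of real minimizers is a minimizer, and coercivity makes minimizers bounded. As
S(A) lies in S(A + εB), the limit of a minimizer minimizes `l` on S(A), and uniqueness identifies
it. Finally, the images under `l` are order-convex, each end being attained or absent, so they are
closed and their boundary points are extreme values. -/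

/-! ### Derivations with prescribed values -/

-- For a formally étale extension, K ⊗ Ω[S/k] ≅ Ω[K/k], so the functional on differentials that
-- represents `d` carries over to K.
open TensorProduct in
theorem exists_derivation_extend {k S K : Type*} [CommRing k] [CommRing S] [CommRing K]
    [Algebra k S] [Algebra k K] [Algebra S K] [IsScalarTower k S K] [Algebra.FormallyEtale S K]
    (d : Derivation k S K) : ∃ δ : Derivation k K K, ∀ s, δ (algebraMap S K s) = d s := by
  let g : K ⊗[S] Ω[S⁄k] →ₗ[K] K := TensorProduct.AlgebraTensorModule.lift
    ((LinearMap.lsmul K (Ω[S⁄k] →ₗ[S] K)).flip d.liftKaehlerDifferential)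
  let e := KaehlerDifferential.tensorKaehlerEquivOfFormallyEtale k S K
  refine ⟨(g.comp e.symm.toLinearMap).compDer (KaehlerDifferential.D k K), fun s => ?_⟩
  change g (e.symm (KaehlerDifferential.D k K (algebraMap S K s))) = d s
  rw [KaehlerDifferential.tensorKaehlerEquivOfFormallyEtale_symm_D_algebraMap]
  simp [g]

-- Enlarge the family to a transcendence basis. Derivations on the polynomial ring it generates are
-- free; passing to the fraction field is a localization, and K over that field is algebraic, hence
-- separable in characteristic 0. Both steps are formally étale, so the derivation extends.
open scoped IntermediateField.algebraAdjoinAdjoin in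
theorem AlgebraicIndependent.exists_derivation {k K ι : Type*} [Field k] [Field K] [CharZero k]
    [Algebra k K] {f : ι → K} (hf : AlgebraicIndependent k f) (c : ι → K) :
    ∃ δ : Derivation k K K, ∀ i, δ (f i) = c i := by
  obtain ⟨s, hs, hb⟩ := exists_isTranscendenceBasis_superset (R := k) (s := Set.range f)
    hf.coe_range
  let v : s → K := (↑)
  let S := Algebra.adjoin k (Set.range v)
  let E := IntermediateField.adjoin k (Set.range v)
  have : Algebra.FormallyEtale S E := .of_isLocalization (nonZeroDivisors _)
  have : Algebra.IsAlgebraic E K := hb.isAlgebraic_field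
  have : Algebra.FormallyEtale E K := Algebra.FormallyEtale.of_isSeparable _ K
  have : Algebra.FormallyEtale S K := .comp _ E _
  let e : MvPolynomial s k ≃ₐ[k] S := hb.1.aevalEquiv
  have hinj : Function.Injective f := hf.injective
  let c' : s → K := fun x => Function.extend f c 0 x
  let _ : Algebra (MvPolynomial s k) K := (MvPolynomial.aeval v).toAlgebra
  have : IsScalarTower k (MvPolynomial s k) K := IsScalarTower.of_algebraMap_eq' (by
    ext; simp [RingHom.algebraMap_toAlgebra])
  let d0 : Derivation k (MvPolynomial s k) K := MvPolynomial.mkDerivation k c'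
  have hsm : ∀ (a : S) (x : K), e.symm a • x = a • x := by
    intro a x
    have : algebraMap S K a = MvPolynomial.aeval v (e.symm a) := by
      have h := hb.1.algebraMap_aevalEquiv (e.symm a)
      rw [← h]
      change _ = algebraMap S K (e (e.symm a))
      rw [AlgEquiv.apply_symm_apply]
    rw [Algebra.smul_def, Algebra.smul_def, this]
    rfl
  let d : Derivation k S K := Derivation.mk' (d0.toLinearMap ∘ₗ e.symm.toLinearMap) (by
    intro a b
    simp [hsm])
  obtain ⟨δ, hδ⟩ := exists_derivation_extend d
  refine ⟨δ, fun i => ?_⟩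
  have hmem : f i ∈ s := hs ⟨i, rfl⟩
  have h1 : f i = algebraMap S K (e (MvPolynomial.X ⟨f i, hmem⟩)) := by
    have h := hb.1.algebraMap_aevalEquiv (MvPolynomial.X ⟨f i, hmem⟩)
    rw [MvPolynomial.aeval_X] at h
    exact h.symm
  rw [h1, hδ]
  change d0 (e.symm (e (MvPolynomial.X ⟨f i, hmem⟩))) = c i
  rw [AlgEquiv.symm_apply_apply, MvPolynomial.mkDerivation_X]
  exact hinj.extend_apply c 0 i

/-! ### Ultrapowers of the real field -/

open Filter in
/-- If no nonzero polynomial vanishes on the image of a family of real functions, then the germs of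
the functions along a suitable ultrafilter are algebraically independent. -/
theorem exists_ultrafilter_algebraicIndependent {T ι : Type*} (f : ι → T → ℝ)
    (hf : ∀ p : MvPolynomial ι ℝ, (∀ s, MvPolynomial.eval (fun i => f i s) p = 0) → p = 0) :
    ∃ 𝒰 : Ultrafilter T, ∀ p : MvPolynomial ι ℝ, p ≠ 0 →
      ∀ᶠ s in (𝒰 : Filter T), MvPolynomial.eval (fun i => f i s) p ≠ 0 := by
  let F : {p : MvPolynomial ι ℝ // p ≠ 0} → Set T :=
    fun p => {s | MvPolynomial.eval (fun i => f i s) p.1 ≠ 0}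
  have hne : NeBot (⨅ p, 𝓟 (F p)) := by
    have : Nonempty {p : MvPolynomial ι ℝ // p ≠ 0} := ⟨⟨1, one_ne_zero⟩⟩
    -- The nonvanishing loci are directed because that of a product is the intersection.
    apply iInf_neBot_of_directed'
    · intro p q
      refine ⟨⟨p.1 * q.1, mul_ne_zero p.2 q.2⟩, ?_, ?_⟩ <;>
      · simp only [F, ge_iff_le, le_principal_iff, mem_principal]
        intro s hs
        simp only [Set.mem_ofPred_eq, map_mul, mul_ne_zero_iff] at hs ⊢
        tauto
    · intro p
      rw [principal_neBot_iff]
      by_contra h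
      rw [Set.not_nonempty_iff_eq_empty, Set.eq_empty_iff_forall_notMem] at h
      exact p.2 (hf p.1 fun s => by simpa [F] using h s)
  refine ⟨Ultrafilter.of (⨅ p, 𝓟 (F p)), fun p hp => ?_⟩
  exact (Ultrafilter.of_le _) (mem_iInf_of_mem ⟨p, hp⟩ (mem_principal_self _))

open Filter in
/-- The ultrapower of the real field along an ultrafilter. -/
def RealGerm {T : Type*} (𝒰 : Ultrafilter T) : Type _ := Germ (𝒰 : Filter T) ℝ

namespace RealGerm

open Filter

variable {T : Type*} {𝒰 : Ultrafilter T}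

instance : Field (RealGerm 𝒰) := inferInstanceAs (Field (Germ (𝒰 : Filter T) ℝ))

instance : LinearOrder (RealGerm 𝒰) := inferInstanceAs (LinearOrder (Germ (𝒰 : Filter T) ℝ))

instance : IsStrictOrderedRing (RealGerm 𝒰) :=
  inferInstanceAs (IsStrictOrderedRing (Germ (𝒰 : Filter T) ℝ))

variable (𝒰) in
/-- The germ of a real function. -/
def mk : (T → ℝ) →+* RealGerm 𝒰 where
  toFun f := (f : Germ (𝒰 : Filter T) ℝ)
  map_one' := rfl
  map_mul' _ _ := rfl
  map_zero' := rfl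
  map_add' _ _ := rfl

theorem mk_surjective : Function.Surjective (mk 𝒰) := Quot.exists_rep

theorem mk_le_mk {f g : T → ℝ} : mk 𝒰 f ≤ mk 𝒰 g ↔ ∀ᶠ s in (𝒰 : Filter T), f s ≤ g s :=
  Germ.coe_le

theorem mk_eq_mk {f g : T → ℝ} : mk 𝒰 f = mk 𝒰 g ↔ ∀ᶠ s in (𝒰 : Filter T), f s = g s :=
  Germ.coe_eq

instance : Algebra ℝ (RealGerm 𝒰) := RingHom.toAlgebra ((mk 𝒰).comp (Pi.constRingHom T ℝ))

end RealGerm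

/-! ### Positive semidefinite pencils over a field -/

open Matrix in
/-- A symmetric matrix with nonnegative quadratic form, over an ordered field. -/
def IsPSD {K : Type*} [Field K] [PartialOrder K] {m : ℕ} (M : Matrix (Fin m) (Fin m) K) : Prop :=
  Mᵀ = M ∧ ∀ v : Fin m → K, 0 ≤ v ⬝ᵥ M *ᵥ v

theorem posSemidef_iff_isPSD {K : Type*} [Field K] [PartialOrder K] [StarRing K] [TrivialStar K]
    {m : ℕ} {M : Matrix (Fin m) (Fin m) K} : M.PosSemidef ↔ IsPSD M := by
  rw [Matrix.posSemidef_iff_dotProduct_mulVec, IsPSD, Matrix.IsHermitian]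
  simp [Matrix.conjTranspose_eq_transpose_of_trivial]

section Field

variable {K : Type*} [Field K] {m n : ℕ}

open Matrix in
theorem dotProduct_pencil_mulVec (A₀ : Matrix (Fin m) (Fin m) K)
    (A : Fin n → Matrix (Fin m) (Fin m) K) (x : Fin n → K) (v : Fin m → K) :
    v ⬝ᵥ pencil A₀ A x *ᵥ v = v ⬝ᵥ A₀ *ᵥ v + ∑ i, x i * (v ⬝ᵥ A i *ᵥ v) := by
  simp [pencil, Matrix.add_mulVec, Matrix.sum_mulVec, dotProduct_sum, Matrix.smul_mulVec]

theorem linForm_add (l x y : Fin n → K) : linForm l (x + y) = linForm l x + linForm l y := by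
  simp [linForm, mul_add, Finset.sum_add_distrib]

theorem linForm_sub (l x y : Fin n → K) : linForm l (x - y) = linForm l x - linForm l y := by
  simp [linForm, mul_sub, Finset.sum_sub_distrib]

theorem linForm_smul (l : Fin n → K) (c : K) (x : Fin n → K) :
    linForm l (c • x) = c * linForm l x := by
  simp [linForm, Finset.mul_sum, mul_left_comm]

theorem linForm_neg (l x : Fin n → K) : linForm (-l) x = -linForm l x := by
  simp [linForm]

theorem pencil_transpose {A₀ : Matrix (Fin m) (Fin m) K} {A : Fin n → Matrix (Fin m) (Fin m) K}
    (h₀ : A₀.transpose = A₀) (h : ∀ i, (A i).transpose = A i) (x : Fin n → K) :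
    (pencil A₀ A x).transpose = pencil A₀ A x := by
  simp [pencil, Matrix.transpose_sum, h₀, h]

theorem dotProduct_mul_mulVec {Y : Matrix (Fin m) (Fin m) K} (hY : Y.transpose = Y)
    (Z : Matrix (Fin m) (Fin m) K) (v : Fin m → K) :
    v ⬝ᵥ (Y * Z).mulVec v = Y.mulVec v ⬝ᵥ Z.mulVec v := by
  rw [← Matrix.mulVec_mulVec, Matrix.dotProduct_mulVec]
  congr 1
  rw [← Matrix.mulVec_transpose, hY]

end Field

/-! ### Derivations applied to matrices and pencils -/

section Derivation

variable {k K : Type*} [CommRing k] [Field K] [Algebra k K] {m n : ℕ} (δ : Derivation k K K)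

theorem Derivation.map_matrix_mul (M N : Matrix (Fin m) (Fin m) K) :
    (M * N).map δ = M.map δ * N + M * N.map δ := by
  ext i j
  simp only [Matrix.map_apply, Matrix.mul_apply, map_sum, Derivation.leibniz, Matrix.add_apply,
    smul_eq_mul, ← Finset.sum_add_distrib]
  exact Finset.sum_congr rfl fun _ _ => by ring

theorem Derivation.map_pencil {A₀ : Matrix (Fin m) (Fin m) K}
    {A : Fin n → Matrix (Fin m) (Fin m) K} (h₀ : A₀.map δ = 0) (h : ∀ i, (A i).map δ = 0)
    (x : Fin n → K) : (pencil A₀ A x).map δ = pencil 0 A (fun i => δ (x i)) := by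
  ext a b
  have h1 : ∀ i, δ (A i a b) = 0 := fun i => _root_.congr_fun (_root_.congr_fun (h i) a) b
  have h0 : δ (A₀ a b) = 0 := _root_.congr_fun (_root_.congr_fun h₀ a) b
  simp [pencil, Matrix.sum_apply, h0, h1, mul_comm]

theorem Derivation.map_linForm (l x : Fin n → K) :
    δ (linForm l x) = linForm (fun i => δ (l i)) x + linForm l (fun i => δ (x i)) := by
  simp only [linForm, map_sum, Derivation.leibniz, smul_eq_mul, ← Finset.sum_add_distrib]
  exact Finset.sum_congr rfl fun _ _ => by ring

end Derivation

/-! ### The envelope theorem over an ordered field -/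

section Ordered

variable {K : Type*} [Field K] [LinearOrder K] [IsStrictOrderedRing K] {m n : ℕ}

theorem dotProduct_self_nonneg' (v : Fin m → K) : 0 ≤ v ⬝ᵥ v :=
  Finset.sum_nonneg fun i _ => mul_self_nonneg (v i)

theorem mulVec_dotProduct_self_le (M : Matrix (Fin m) (Fin m) K) (v : Fin m → K) :
    M.mulVec v ⬝ᵥ M.mulVec v ≤ (∑ i, ∑ j, M i j ^ 2) * (v ⬝ᵥ v) := by
  rw [Finset.sum_mul]
  refine Finset.sum_le_sum fun i _ => ?_
  have h := Finset.sum_mul_sq_le_sq_mul_sq Finset.univ (fun j => M i j) v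
  calc M.mulVec v i * M.mulVec v i = (∑ j, M i j * v j) ^ 2 := by
        rw [sq]; rfl
    _ ≤ _ := h
    _ = _ := by simp [dotProduct, sq]

theorem eq_zero_of_forall_small {b k e : K} (hk : 0 ≤ k) (he : 0 ≤ e)
    (h : ∀ s : K, 4 * k * s ^ 2 ≤ 1 → 0 ≤ s * b + 2 * k * s ^ 2 * e) : b = 0 := by
  by_contra hb
  have hb2 : 0 < b ^ 2 := by positivity
  -- D is chosen so that s = -b/D is admissible (4kb² ≤ D ≤ D²) while the linear term outweighs the
  -- quadratic one (2ke < D).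
  set D : K := 1 + 2 * k * e + 4 * k * b ^ 2 with hD
  have hD1 : 1 ≤ D := by
    have : 0 ≤ 2 * k * e := by positivity
    have : 0 ≤ 4 * k * b ^ 2 := by positivity
    linarith
  have hD0 : 0 < D := by linarith
  have h1 := h (-b / D) (by
    rw [div_pow, neg_sq, ← mul_div_assoc, div_le_one (by positivity)]
    have : 0 ≤ 2 * k * e := by positivity
    nlinarith)
  have h2 : -b / D * b + 2 * k * (-b / D) ^ 2 * e = b ^ 2 * (2 * k * e - D) / D ^ 2 := by
    field_simp
    ring
  rw [h2] at h1
  have h3 : b ^ 2 * (2 * k * e - D) / D ^ 2 < 0 := by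
    apply div_neg_of_neg_of_pos _ (by positivity)
    apply mul_neg_of_pos_of_neg hb2
    have : 0 ≤ 4 * k * b ^ 2 := by positivity
    linarith
  linarith

/-- The envelope theorem: at a minimizer `x` of `l`, the linear form `l` kills the derivative of
`x` along any derivation which kills the data of the spectrahedron. -/
theorem linForm_derivation_eq_zero {k : Type*} [CommRing k] [Algebra k K] (δ : Derivation k K K)
    {A₀ : Matrix (Fin m) (Fin m) K} {A : Fin n → Matrix (Fin m) (Fin m) K}
    (hs₀ : A₀.transpose = A₀) (hs : ∀ i, (A i).transpose = A i)
    (h₀ : A₀.map δ = 0) (h : ∀ i, (A i).map δ = 0) {l x x₀ : Fin n → K}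
    {Y R G : Matrix (Fin m) (Fin m) K} (hY : Y.transpose = Y) (hYX : Y * Y = pencil A₀ A x)
    (hR : R.transpose = R) (hRX : R * R = pencil A₀ A x₀) (hYG : Y * (G * (R * R)) = Y)
    (hG : (G * (R * R)).map δ = 0)
    (hmin : ∀ y, IsPSD (pencil A₀ A y) → linForm l x ≤ linForm l y) :
    linForm l (fun i => δ (x i)) = 0 := by
  set H := Y.map δ with hH
  set N := H * G * R with hN
  set c : K := ∑ i, ∑ j, N i j ^ 2 with hc
  have hc0 : 0 ≤ c := Finset.sum_nonneg fun i _ => Finset.sum_nonneg fun j _ => sq_nonneg _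
  -- Differentiate Y · (G R R) = Y: the second factor has derivative zero, so H = H G R R. Thus H is
  -- controlled by R, which is what makes the correction towards `x₀` effective.
  have hHN : H = N * R := by
    have := congrArg (fun M => M.map δ) hYG
    simp only [Derivation.map_matrix_mul δ Y, hG, mul_zero, add_zero] at this
    rw [← hH] at this
    rw [hN, Matrix.mul_assoc, Matrix.mul_assoc]
    exact this.symm
  have hdX : pencil 0 A (fun i => δ (x i)) = H * Y + Y * H := by
    rw [← Derivation.map_pencil δ h₀ h, ← hYX, Derivation.map_matrix_mul]
  have hHt : H.transpose = H := by
    rw [hH, ← Matrix.transpose_map, hY]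
  have hfeas : IsPSD (pencil A₀ A x₀) := by
    refine ⟨pencil_transpose hs₀ hs _, fun v => ?_⟩
    rw [← hRX, dotProduct_mul_mulVec hR]
    exact dotProduct_self_nonneg' _
  have he := hmin x₀ hfeas
  refine eq_zero_of_forall_small hc0 (sub_nonneg.2 he) fun s hsm => ?_
  -- The test point follows the tangent δx and adds a second-order move towards `x₀`. Its quadratic
  -- form is |Yv|² + 2s⟨Yv, Hv⟩ + 2cs²(|Rv|² - |Yv|²). Since |Hv|² ≤ c|Rv|² and 4cs² ≤ 1, this is at
  -- least ½|Yv + 2sHv|² ≥ 0.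
  have hy := hmin (x + s • (fun i => δ (x i)) + (2 * c * s ^ 2) • (x₀ - x)) ⟨pencil_transpose hs₀ hs _, fun v => ?_⟩
  · rw [linForm_add, linForm_add, linForm_smul, linForm_smul, linForm_sub] at hy
    linarith
  · have e1 : v ⬝ᵥ (pencil A₀ A x).mulVec v = Y.mulVec v ⬝ᵥ Y.mulVec v := by
      rw [← hYX, dotProduct_mul_mulVec hY]
    have e2 : v ⬝ᵥ (pencil A₀ A x₀).mulVec v = R.mulVec v ⬝ᵥ R.mulVec v := by
      rw [← hRX, dotProduct_mul_mulVec hR]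
    have e3 : v ⬝ᵥ (pencil 0 A (fun i => δ (x i))).mulVec v
        = 2 * (Y.mulVec v ⬝ᵥ H.mulVec v) := by
      rw [hdX, Matrix.add_mulVec, dotProduct_add, dotProduct_mul_mulVec hHt,
        dotProduct_mul_mulVec hY, dotProduct_comm (H.mulVec v)]
      ring
    have e4 : H.mulVec v ⬝ᵥ H.mulVec v ≤ c * (R.mulVec v ⬝ᵥ R.mulVec v) := by
      have : H.mulVec v = N.mulVec (R.mulVec v) := by rw [Matrix.mulVec_mulVec, ← hHN]
      rw [this]
      exact mulVec_dotProduct_self_le N _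
    have e5 : 0 ≤ Y.mulVec v ⬝ᵥ Y.mulVec v + 4 * s * (Y.mulVec v ⬝ᵥ H.mulVec v)
        + 4 * s ^ 2 * (H.mulVec v ⬝ᵥ H.mulVec v) := by
      have := dotProduct_self_nonneg' (Y.mulVec v + (2 * s) • H.mulVec v)
      simp only [dotProduct_add, add_dotProduct, dotProduct_smul, smul_dotProduct, smul_eq_mul,
        dotProduct_comm (H.mulVec v) (Y.mulVec v)] at this
      linarith
    have e6 : v ⬝ᵥ (pencil A₀ A (x + s • (fun i => δ (x i))
        + (2 * c * s ^ 2) • (x₀ - x))).mulVec v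
        = v ⬝ᵥ (pencil A₀ A x).mulVec v + s * (v ⬝ᵥ (pencil 0 A (fun i => δ (x i))).mulVec v)
          + 2 * c * s ^ 2 * (v ⬝ᵥ (pencil A₀ A x₀).mulVec v - v ⬝ᵥ (pencil A₀ A x).mulVec v) := by
      simp only [dotProduct_pencil_mulVec, Pi.add_apply, Pi.smul_apply, Pi.sub_apply, smul_eq_mul,
        add_mul, sub_mul, mul_assoc, Finset.sum_add_distrib, Finset.sum_sub_distrib, mul_sub,
        mul_add, ← Finset.mul_sum]
      simp
      ring
    rw [e6, e1, e2, e3]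
    have e7 := dotProduct_self_nonneg' (Y.mulVec v)
    nlinarith [mul_le_mul_of_nonneg_left e4 (sq_nonneg s), mul_le_mul_of_nonneg_right hsm e7]

end Ordered

/-! ### Germs of families of matrices -/

section Germ

open Filter RealGerm

variable {T : Type*} {𝒰 : Ultrafilter T} {m n : ℕ}

/-- The germ of a family of real matrices. -/
def germMat (𝒰 : Ultrafilter T) (F : T → Matrix (Fin m) (Fin m) ℝ) :
    Matrix (Fin m) (Fin m) (RealGerm 𝒰) :=
  Matrix.of fun i j => mk 𝒰 fun s => F s i j

theorem mk_sum {ι : Type*} (u : Finset ι) (f : ι → T → ℝ) :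
    mk 𝒰 (fun s => ∑ i ∈ u, f i s) = ∑ i ∈ u, mk 𝒰 (f i) := by
  rw [← map_sum]
  congr 1
  ext s
  simp

theorem germMat_mul (F G : T → Matrix (Fin m) (Fin m) ℝ) :
    germMat 𝒰 F * germMat 𝒰 G = germMat 𝒰 (fun s => F s * G s) := by
  ext i j
  simp only [germMat, Matrix.mul_apply, Matrix.of_apply, mk_sum]
  rfl

theorem germMat_transpose {F : T → Matrix (Fin m) (Fin m) ℝ} (h : ∀ s, (F s).transpose = F s) :
    (germMat 𝒰 F).transpose = germMat 𝒰 F := by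
  ext i j
  simp only [germMat, Matrix.transpose_apply, Matrix.of_apply]
  congr 1
  ext s
  conv_rhs => rw [← h s]
  rfl

theorem pencil_germMat (F₀ : T → Matrix (Fin m) (Fin m) ℝ)
    (F : Fin n → T → Matrix (Fin m) (Fin m) ℝ) (x : Fin n → T → ℝ) :
    pencil (germMat 𝒰 F₀) (fun i => germMat 𝒰 (F i)) (fun i => mk 𝒰 (x i))
      = germMat 𝒰 (fun s => pencil (F₀ s) (fun i => F i s) (fun i => x i s)) := by
  ext i j
  simp only [germMat, pencil, Matrix.add_apply, Matrix.sum_apply, Matrix.of_apply,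
    Matrix.smul_apply]
  have := mk_sum (𝒰 := 𝒰) Finset.univ (fun k s => x k s * F k s i j)
  change _ = mk 𝒰 (fun s => F₀ s i j) + mk 𝒰 (fun s => ∑ k, x k s * F k s i j)
  rw [this]
  rfl

theorem linForm_mk (l x : Fin n → T → ℝ) :
    linForm (fun i => mk 𝒰 (l i)) (fun i => mk 𝒰 (x i))
      = mk 𝒰 (fun s => linForm (fun i => l i s) (fun i => x i s)) := by
  simp only [linForm, mk_sum]
  rfl

theorem dotProduct_germMat_mulVec (F : T → Matrix (Fin m) (Fin m) ℝ) (v : Fin m → T → ℝ) :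
    (fun i => mk 𝒰 (v i)) ⬝ᵥ (germMat 𝒰 F).mulVec (fun i => mk 𝒰 (v i))
      = mk 𝒰 (fun s => (fun i => v i s) ⬝ᵥ (F s).mulVec (fun i => v i s)) := by
  simp only [dotProduct, Matrix.mulVec, germMat, Matrix.of_apply, mk_sum, Finset.mul_sum]
  rfl

/-- One direction of Łoś's theorem. Along an ultrafilter, failing to be eventually semidefinite
means being eventually not so; the germ of a choice of violating vectors would then violate the
hypothesis. -/
theorem eventually_isPSD_of_germMat {F : T → Matrix (Fin m) (Fin m) ℝ}
    (hs : ∀ s, (F s).transpose = F s) (h : IsPSD (germMat 𝒰 F)) :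
    ∀ᶠ s in (𝒰 : Filter T), IsPSD (F s) := by
  by_contra hne
  rw [← Ultrafilter.eventually_not] at hne
  have hv : ∀ s, ∃ v : Fin m → ℝ, ¬ IsPSD (F s) → v ⬝ᵥ (F s).mulVec v < 0 := by
    intro s
    by_cases hp : IsPSD (F s)
    · exact ⟨0, fun h => absurd hp h⟩
    · have : ¬ ∀ v : Fin m → ℝ, 0 ≤ v ⬝ᵥ (F s).mulVec v := fun h => hp ⟨hs s, h⟩
      push Not at this
      obtain ⟨v, hv⟩ := this
      exact ⟨v, fun _ => hv⟩
  choose v hv using hv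
  have h1 := h.2 (fun i => mk 𝒰 (fun s => v s i))
  rw [dotProduct_germMat_mulVec F (fun i s => v s i)] at h1
  have h2 : ∀ᶠ s in (𝒰 : Filter T), 0 ≤ v s ⬝ᵥ (F s).mulVec (v s) := mk_le_mk.1 h1
  obtain ⟨s, h3, h4⟩ := (h2.and hne).exists
  exact absurd (hv s h4) (not_lt.2 h3)

theorem aeval_mk {ι : Type*} (f : ι → T → ℝ) (p : MvPolynomial ι ℝ) :
    MvPolynomial.aeval (fun i => mk 𝒰 (f i)) p
      = mk 𝒰 (fun s => MvPolynomial.eval (fun i => f i s) p) := by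
  induction p using MvPolynomial.induction_on with
  | C a => simp only [MvPolynomial.aeval_C, MvPolynomial.eval_C]; rfl
  | add p q hp hq => simp only [map_add, hp, hq]; rfl
  | mul_X p i hp => simp only [map_mul, hp, MvPolynomial.aeval_X, MvPolynomial.eval_X]; rfl

theorem algebraicIndependent_mk {ι : Type*} {f : ι → T → ℝ}
    (h : ∀ p : MvPolynomial ι ℝ, p ≠ 0 →
      ∀ᶠ s in (𝒰 : Filter T), MvPolynomial.eval (fun i => f i s) p ≠ 0) :
    AlgebraicIndependent ℝ (fun i => mk 𝒰 (f i)) := by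
  rw [algebraicIndependent_iff]
  intro p hp
  by_contra hne
  rw [aeval_mk, ← map_zero (mk 𝒰), mk_eq_mk] at hp
  obtain ⟨s, h2, h3⟩ := (hp.and (h p hne)).exists
  exact h3 h2

end Germ

/-! ### Real square roots -/

section Sqrt

variable {m : ℕ}

open scoped MatrixOrder in
theorem IsPSD.exists_sqrt {M : Matrix (Fin m) (Fin m) ℝ} (h : IsPSD M) :
    ∃ Y : Matrix (Fin m) (Fin m) ℝ, Y.transpose = Y ∧ Y * Y = M := by
  rw [← posSemidef_iff_isPSD] at h
  refine ⟨CFC.sqrt M, ?_, CFC.sqrt_mul_sqrt_self M h.nonneg⟩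
  have := (Matrix.nonneg_iff_posSemidef.1 (CFC.sqrt_nonneg M)).isHermitian
  rwa [Matrix.IsHermitian, Matrix.conjTranspose_eq_transpose_of_trivial] at this

theorem mul_eq_zero_of_mul_self_mul {Y N : Matrix (Fin m) (Fin m) ℝ} (hY : Y.transpose = Y)
    (h : Y * Y * N = 0) : Y * N = 0 := by
  rw [← Matrix.conjTranspose_mul_self_eq_zero, Matrix.conjTranspose_eq_transpose_of_trivial,
    Matrix.transpose_mul, hY, Matrix.mul_assoc, ← Matrix.mul_assoc Y, h, Matrix.mul_zero]

end Sqrt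

/-! ### Minimizers depend algebraically on the data -/

/-- If the derivative of the value `l(x)` is given by the envelope formula for every derivation
killing `t`, then the coordinates of `x` are algebraic over `t` and the coefficients of `l`. -/
theorem not_algebraicIndependent_of_envelope {k K : Type*} [Field k] [CharZero k] [Field K]
    [Algebra k K] {n : ℕ} {t : K} {l x : Fin n → K} {j : Fin n}
    (henv : ∀ δ : Derivation k K K, δ t = 0 → δ (linForm l x) = linForm (fun i => δ (l i)) x) :
    ¬ AlgebraicIndependent k (Sum.elim ![t, x j] l) := by
  intro hind
  -- Among t, x_j and the l_i, D moves only l_j and E moves only x_j.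
  obtain ⟨D, hD⟩ := hind.exists_derivation (Sum.elim 0 (Pi.single j 1))
  obtain ⟨E, hE⟩ := hind.exists_derivation (Sum.elim ![0, 1] 0)
  have hDt : D t = 0 := hD (Sum.inl 0)
  have hEt : E t = 0 := hE (Sum.inl 0)
  have hDl : ∀ i, D (l i) = Pi.single (M := fun _ => K) j 1 i := fun i => hD (Sum.inr i)
  have hEl : ∀ i, E (l i) = 0 := fun i => hE (Sum.inr i)
  have hEx : E (x j) = 1 := hE (Sum.inl 1)
  have hDσ : D (linForm l x) = x j := by
    rw [henv D hDt]
    simp [hDl, linForm, Pi.single_apply]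
  have hEσ : E (linForm l x) = 0 := by
    rw [henv E hEt]
    simp [hEl, linForm]
  -- The commutator kills t and every l_i, so the envelope formula predicts 0 for l(x); computed
  -- directly, it is E(x_j) - D(0) = 1.
  have hC := henv ⁅E, D⁆ (by rw [Derivation.commutator_apply, hDt, hEt, map_zero, map_zero, sub_zero])
  rw [Derivation.commutator_apply, hDσ, hEσ, hEx, map_zero, sub_zero] at hC
  have : ∀ i, ⁅E, D⁆ (l i) = 0 := by
    intro i
    rw [Derivation.commutator_apply, hDl, hEl, map_zero, sub_zero, Pi.single_apply]
    split_ifs <;> simp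
  simp [this, linForm] at hC

open Filter RealGerm in
/-- Each coordinate of a minimizer of a linear form `l` over the members of a family of spectrahedra
is algebraic over the coefficients of `l` and the parameter of the family. -/
theorem exists_polynomial_minimizer {m n : ℕ} {A₀ B P : Matrix (Fin m) (Fin m) ℝ}
    {A : Fin n → Matrix (Fin m) (Fin m) ℝ} (hA₀ : A₀.transpose = A₀) (hB : B.transpose = B)
    (hA : ∀ i, (A i).transpose = A i)
    (hP : ∀ t : ℝ, 0 < t → ∀ x, IsPSD (pencil (A₀ + t • B) A x) →
      pencil (A₀ + t • B) A x * P = pencil (A₀ + t • B) A x ∧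
      ∃ (x₀ : Fin n → ℝ) (G : Matrix (Fin m) (Fin m) ℝ),
        IsPSD (pencil (A₀ + t • B) A x₀) ∧ G * pencil (A₀ + t • B) A x₀ = P) (j : Fin n) :
    ∃ p : MvPolynomial (Fin 2 ⊕ Fin n) ℝ, p ≠ 0 ∧ ∀ (t : ℝ) (l x : Fin n → ℝ), 0 < t →
      IsPSD (pencil (A₀ + t • B) A x) →
      (∀ y, IsPSD (pencil (A₀ + t • B) A y) → linForm l x ≤ linForm l y) →
      MvPolynomial.eval (Sum.elim ![t, x j] l) p = 0 := by
  -- All triples (t, l, x) with x a minimizer form the index set; t, `l` and x become functions on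
  -- it, and their germs a universal minimizer.
  let T := {s : ℝ × (Fin n → ℝ) × (Fin n → ℝ) // 0 < s.1 ∧
    IsPSD (pencil (A₀ + s.1 • B) A s.2.2) ∧
    ∀ y, IsPSD (pencil (A₀ + s.1 • B) A y) → linForm s.2.1 s.2.2 ≤ linForm s.2.1 y}
  let t : T → ℝ := fun s => s.1.1
  let l : Fin n → T → ℝ := fun i s => s.1.2.1 i
  let x : Fin n → T → ℝ := fun i s => s.1.2.2 i
  let f : Fin 2 ⊕ Fin n → T → ℝ := Sum.elim ![t, x j] l
  by_contra hcon
  push Not at hcon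
  obtain ⟨𝒰, h𝒰⟩ := exists_ultrafilter_algebraicIndependent f (by
    intro p hp
    by_contra hp0
    obtain ⟨t', l', x', h1, h2, h3, h4⟩ := hcon p hp0
    apply h4
    rw [← hp ⟨(t', l', x'), h1, h2, h3⟩]
    congr 2
    ext i
    rcases i with i | i
    · fin_cases i <;> rfl
    · rfl)
  have hind := algebraicIndependent_mk h𝒰
  choose x₀ G hx₀ hG using fun s : T => (hP s.1.1 s.2.1 s.1.2.2 s.2.2.1).2
  choose Y hY hYX using fun s : T => s.2.2.1.exists_sqrt
  choose R hR hRX using fun s : T => (hx₀ s).exists_sqrt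
  -- This is the relation to be differentiated: P does not depend on s, so its germ is killed by
  -- every real derivation, whereas `x₀`, `G` and `R` may vary with s.
  have hYP : ∀ s, Y s * P = Y s := by
    intro s
    have h1 := (hP s.1.1 s.2.1 s.1.2.2 s.2.2.1).1
    have h2 : Y s * Y s * (P - 1) = 0 := by
      rw [hYX, Matrix.mul_sub, h1, Matrix.mul_one, sub_self]
    have h3 := mul_eq_zero_of_mul_self_mul (hY s) h2
    rwa [Matrix.mul_sub, Matrix.mul_one, sub_eq_zero] at h3
  let A₀' := germMat 𝒰 (fun s => A₀ + t s • B)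
  let A' : Fin n → Matrix (Fin m) (Fin m) (RealGerm 𝒰) :=
    fun i => germMat 𝒰 (fun _ => A i)
  let lK : Fin n → (RealGerm 𝒰) := fun i => mk 𝒰 (l i)
  let xK : Fin n → (RealGerm 𝒰) := fun i => mk 𝒰 (x i)
  have hconst : ∀ (δ : Derivation ℝ (RealGerm 𝒰) (RealGerm 𝒰)) (M : Matrix (Fin m) (Fin m) ℝ),
      (germMat 𝒰 (fun _ => M)).map δ = 0 := by
    intro δ M
    ext a b
    exact δ.map_algebraMap (M a b)
  have hst : ∀ s, (A₀ + t s • B).transpose = A₀ + t s • B := fun s => by simp [hA₀, hB]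
  have henv : ∀ δ : Derivation ℝ (RealGerm 𝒰) (RealGerm 𝒰), δ (mk 𝒰 t) = 0 →
      δ (linForm lK xK) = linForm (fun i => δ (lK i)) xK := by
    intro δ hδ
    rw [Derivation.map_linForm]
    have hA₀' : A₀'.map δ = 0 := by
      ext a b
      change δ (algebraMap ℝ (RealGerm 𝒰) (A₀ a b) + (mk 𝒰 t) * algebraMap ℝ (RealGerm 𝒰) (B a b)) = 0
      rw [map_add, Derivation.leibniz, Derivation.map_algebraMap, Derivation.map_algebraMap, hδ]
      simp
    have hGR : germMat 𝒰 G * (germMat 𝒰 R * germMat 𝒰 R) = germMat 𝒰 (fun _ => P) := by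
      rw [germMat_mul, germMat_mul]
      congr 1
      ext1 s
      rw [hRX, hG]
    have := linForm_derivation_eq_zero δ (A₀ := A₀') (A := A') (l := lK) (x := xK)
      (x₀ := fun i => mk 𝒰 fun s => x₀ s i) (Y := germMat 𝒰 Y) (R := germMat 𝒰 R)
      (G := germMat 𝒰 G) (germMat_transpose hst) (fun i => germMat_transpose fun _ => hA i)
      hA₀' (fun i => hconst δ _) (germMat_transpose hY)
      (by
        rw [germMat_mul, funext hYX]
        exact (pencil_germMat _ _ x).symm) (germMat_transpose hR)
      (by
        rw [germMat_mul, funext hRX]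
        exact (pencil_germMat _ _ (fun i s => x₀ s i)).symm)
      (by
        rw [hGR, germMat_mul, funext hYP])
      (by rw [hGR, hconst])
      (by
        intro y hy
        -- A competitor in the ultrapower is represented by real vectors that are eventually
        -- feasible, where real minimality applies.
        choose y' hy' using fun i => mk_surjective (y i)
        obtain rfl : (fun i => mk 𝒰 (y' i)) = y := funext hy'
        rw [pencil_germMat] at hy
        rw [linForm_mk, linForm_mk, mk_le_mk]
        filter_upwards [eventually_isPSD_of_germMat
          (fun s => pencil_transpose (hst s) (fun i => hA i) _) hy] with s hs
        exact s.2.2.2 _ hs)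
    rw [this, add_zero]
  have hfe : (fun i => mk 𝒰 (f i)) = Sum.elim ![mk 𝒰 t, xK j] lK := by
    ext i
    rcases i with i | i
    · fin_cases i <;> rfl
    · rfl
  rw [hfe] at hind
  exact not_algebraicIndependent_of_envelope henv hind

/-! ### Generic linear forms -/

/-- A property of linear forms is generic if it holds off the zero set of a nonzero polynomial. -/
def IsGeneric {n : ℕ} (P : (Fin n → ℝ) → Prop) : Prop :=
  ∃ g : MvPolynomial (Fin n) ℝ, g ≠ 0 ∧ ∀ l, MvPolynomial.eval l g ≠ 0 → P l

namespace IsGeneric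

variable {n : ℕ} {P Q : (Fin n → ℝ) → Prop}

theorem mono (hP : IsGeneric P) (h : ∀ l, P l → Q l) : IsGeneric Q :=
  let ⟨g, hg, hgP⟩ := hP
  ⟨g, hg, fun l hl => h l (hgP l hl)⟩

theorem and (hP : IsGeneric P) (hQ : IsGeneric Q) : IsGeneric fun l => P l ∧ Q l := by
  obtain ⟨g, hg, hgP⟩ := hP
  obtain ⟨h, hh, hhQ⟩ := hQ
  refine ⟨g * h, mul_ne_zero hg hh, fun l hl => ?_⟩
  rw [map_mul, mul_ne_zero_iff] at hl
  exact ⟨hgP l hl.1, hhQ l hl.2⟩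

theorem forall_fin {k : ℕ} {P : Fin k → (Fin n → ℝ) → Prop} (h : ∀ i, IsGeneric (P i)) :
    IsGeneric fun l => ∀ i, P i l := by
  choose g hg hgP using h
  refine ⟨∏ i, g i, Finset.prod_ne_zero_iff.2 fun i _ => hg i, fun l hl i => hgP i l ?_⟩
  rw [map_prod, Finset.prod_ne_zero_iff] at hl
  exact hl i (Finset.mem_univ i)

theorem neg (hP : IsGeneric P) : IsGeneric fun l => P (-l) := by
  obtain ⟨g, hg, hgP⟩ := hP
  have key : ∀ l, MvPolynomial.eval l (MvPolynomial.aeval (fun i => -MvPolynomial.X i) g)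
      = MvPolynomial.eval (-l) g := by
    clear hg hgP
    intro l
    induction g using MvPolynomial.induction_on with
    | C a => simp
    | add p q hp hq => simp only [map_add, hp, hq]
    | mul_X p i hp => simp only [map_mul, hp, MvPolynomial.aeval_X, map_neg, MvPolynomial.eval_X,
        Pi.neg_apply]
  refine ⟨MvPolynomial.aeval (fun i => -MvPolynomial.X i) g, fun h0 => hg ?_, fun l hl => ?_⟩
  · apply MvPolynomial.funext
    intro l
    have := key (-l)
    rw [h0, map_zero, neg_neg] at this
    rw [← this, map_zero]
  · exact hgP _ (by rwa [key] at hl)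

theorem exists_isZariskiOpen (hP : IsGeneric P) : ∃ U : Set (Fin n → ℂ), IsZariskiOpen U ∧
    U.Nonempty ∧ ∀ l : Fin n → ℝ, (fun i => (l i : ℂ)) ∈ U → P l := by
  obtain ⟨g, hg, hgP⟩ := hP
  have hmap : ∀ l : Fin n → ℝ, MvPolynomial.eval (fun i => (l i : ℂ))
      (MvPolynomial.map Complex.ofRealHom g) = (MvPolynomial.eval l g : ℂ) := by
    intro l
    rw [MvPolynomial.eval_map]
    exact (MvPolynomial.eval₂_comp Complex.ofRealHom l g).symm
  refine ⟨(MvPolynomial.zeroLocus ℂ (Ideal.span {MvPolynomial.map Complex.ofRealHom g}))ᶜ,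
    ⟨_, rfl⟩, ?_, fun l hl => hgP l fun h0 => hl ?_⟩
  · have : ∃ l, MvPolynomial.eval l g ≠ 0 := by
      by_contra h
      push Not at h
      exact hg (MvPolynomial.funext fun l => by rw [h, map_zero])
    obtain ⟨l, hl⟩ := this
    refine ⟨fun i => (l i : ℂ), fun h => hl ?_⟩
    have := h _ (Ideal.subset_span rfl)
    rw [MvPolynomial.aeval_eq_eval, hmap] at this
    exact_mod_cast this
  · rw [MvPolynomial.zeroLocus_span]
    rintro _ rfl
    rw [MvPolynomial.aeval_eq_eval, hmap, h0, Complex.ofReal_zero]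

end IsGeneric

/-- Read the relation as a polynomial in (t, x_j) with coefficients in ℝ[l]; it stays nonzero after
specializing `l` off the zeros of one nonzero coefficient. -/
theorem isGeneric_minimizer_algebraic {m n : ℕ} {A₀ B P : Matrix (Fin m) (Fin m) ℝ}
    {A : Fin n → Matrix (Fin m) (Fin m) ℝ} (hA₀ : A₀.transpose = A₀) (hB : B.transpose = B)
    (hA : ∀ i, (A i).transpose = A i)
    (hP : ∀ t : ℝ, 0 < t → ∀ x, IsPSD (pencil (A₀ + t • B) A x) →
      pencil (A₀ + t • B) A x * P = pencil (A₀ + t • B) A x ∧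
      ∃ (x₀ : Fin n → ℝ) (G : Matrix (Fin m) (Fin m) ℝ),
        IsPSD (pencil (A₀ + t • B) A x₀) ∧ G * pencil (A₀ + t • B) A x₀ = P) :
    IsGeneric fun l => ∀ j, ∃ q : MvPolynomial (Fin 2) ℝ, q ≠ 0 ∧ ∀ (t : ℝ) (x : Fin n → ℝ),
      0 < t → IsPSD (pencil (A₀ + t • B) A x) →
      (∀ y, IsPSD (pencil (A₀ + t • B) A y) → linForm l x ≤ linForm l y) →
      MvPolynomial.eval ![t, x j] q = 0 := by
  apply IsGeneric.forall_fin
  intro j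
  obtain ⟨p, hp, hpv⟩ := exists_polynomial_minimizer hA₀ hB hA hP j
  let e := MvPolynomial.sumAlgEquiv ℝ (Fin 2) (Fin n)
  have he : e p ≠ 0 := by simpa using hp
  obtain ⟨d, hd⟩ := MvPolynomial.ne_zero_iff.1 he
  refine ⟨MvPolynomial.coeff d (e p), hd, fun l hl => ⟨MvPolynomial.map (MvPolynomial.eval l) (e p),
    ?_, fun t x ht hx hmin => ?_⟩⟩
  · rw [MvPolynomial.ne_zero_iff]
    exact ⟨d, by rwa [MvPolynomial.coeff_map]⟩
  · rw [← hpv t l x ht hx hmin]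
    have : ∀ (v : Fin 2 → ℝ) (p : MvPolynomial (Fin 2 ⊕ Fin n) ℝ), MvPolynomial.eval v
        (MvPolynomial.map (MvPolynomial.eval l) (e p)) = MvPolynomial.eval (Sum.elim v l) p := by
      intro v p
      induction p using MvPolynomial.induction_on with
      | C a => simp [e]
      | add p q hp hq => simp only [map_add, hp, hq]
      | mul_X p i hp =>
        rw [map_mul, map_mul, map_mul, map_mul, hp]
        rcases i with i | i <;> simp [e]
    exact this _ p

/-! ### Kernels of members of a spectrahedron -/

section Kernel

variable {m n : ℕ}

theorem IsPSD.mulVec_eq_zero {M : Matrix (Fin m) (Fin m) ℝ} (h : IsPSD M) {v : Fin m → ℝ}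
    (hv : v ⬝ᵥ M.mulVec v = 0) : M.mulVec v = 0 := by
  obtain ⟨Y, hY, rfl⟩ := h.exists_sqrt
  rw [dotProduct_mul_mulVec hY, dotProduct_self_eq_zero] at hv
  rw [← Matrix.mulVec_mulVec, hv, Matrix.mulVec_zero]

theorem pencil_convex {K : Type*} [Field K] (A₀ : Matrix (Fin m) (Fin m) K)
    (A : Fin n → Matrix (Fin m) (Fin m) K) {a b : K} (hab : a + b = 1) (x y : Fin n → K) :
    pencil A₀ A (a • x + b • y) = a • pencil A₀ A x + b • pencil A₀ A y := by
  simp only [pencil, Pi.add_apply, Pi.smul_apply, smul_add, Finset.smul_sum, add_smul,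
    Finset.sum_add_distrib, smul_smul, smul_eq_mul]
  have : A₀ = a • A₀ + b • A₀ := by rw [← add_smul, hab, one_smul]
  nth_rw 1 [this]
  abel

theorem IsPSD.add {K : Type*} [Field K] [PartialOrder K] [IsOrderedAddMonoid K]
    {M N : Matrix (Fin m) (Fin m) K} (hM : IsPSD M) (hN : IsPSD N) : IsPSD (M + N) :=
  ⟨by rw [Matrix.transpose_add, hM.1, hN.1], fun v => by
    rw [Matrix.add_mulVec, dotProduct_add]
    exact add_nonneg (hM.2 v) (hN.2 v)⟩

theorem IsPSD.smul {K : Type*} [Field K] [PartialOrder K] [IsOrderedRing K]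
    {M : Matrix (Fin m) (Fin m) K} (hM : IsPSD M) {c : K} (hc : 0 ≤ c) : IsPSD (c • M) :=
  ⟨by rw [Matrix.transpose_smul, hM.1], fun v => by
    rw [Matrix.smul_mulVec, dotProduct_smul]
    exact mul_nonneg hc (hM.2 v)⟩

theorem isPSD_pencil_convex {K : Type*} [Field K] [PartialOrder K] [IsOrderedRing K]
    {A₀ : Matrix (Fin m) (Fin m) K} {A : Fin n → Matrix (Fin m) (Fin m) K} {x y : Fin n → K}
    (hx : IsPSD (pencil A₀ A x)) (hy : IsPSD (pencil A₀ A y)) {a b : K} (ha : 0 ≤ a) (hb : 0 ≤ b)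
    (hab : a + b = 1) : IsPSD (pencil A₀ A (a • x + b • y)) := by
  rw [pencil_convex A₀ A hab]
  exact (hx.smul ha).add (hy.smul hb)

/-- A member of a spectrahedron of maximal rank has the smallest kernel. -/
theorem exists_ker_minimal {A₀ : Matrix (Fin m) (Fin m) ℝ} {A : Fin n → Matrix (Fin m) (Fin m) ℝ}
    (hne : ∃ x, IsPSD (pencil A₀ A x)) : ∃ x₀, IsPSD (pencil A₀ A x₀) ∧
      ∀ x, IsPSD (pencil A₀ A x) → ∀ v, (pencil A₀ A x₀).mulVec v = 0 →
        (pencil A₀ A x).mulVec v = 0 := by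
  let S := {x // IsPSD (pencil A₀ A x)}
  have : Nonempty S := let ⟨x, hx⟩ := hne; ⟨⟨x, hx⟩⟩
  let k : S → ℕ := fun x => Module.finrank ℝ (LinearMap.ker (pencil A₀ A x.1).mulVecLin)
  obtain ⟨x₀, hx₀⟩ : ∃ x₀ : S, ∀ x, k x₀ ≤ k x :=
    ⟨Function.argmin k, fun x => Function.argmin_le k x⟩
  refine ⟨x₀.1, x₀.2, fun x hx v hv => ?_⟩
  -- At a midpoint the kernel is the intersection of the two kernels, so minimality of the dimension
  -- forces it to equal that of `x₀`.
  let z : S := ⟨(1 / 2 : ℝ) • x + (1 / 2 : ℝ) • x₀.1,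
    isPSD_pencil_convex hx x₀.2 (by norm_num) (by norm_num) (by norm_num)⟩
  have hz : pencil A₀ A z.1 = (1 / 2 : ℝ) • pencil A₀ A x + (1 / 2 : ℝ) • pencil A₀ A x₀.1 :=
    pencil_convex A₀ A (by norm_num) _ _
  have hker : ∀ w, (pencil A₀ A z.1).mulVec w = 0 →
      (pencil A₀ A x).mulVec w = 0 ∧ (pencil A₀ A x₀.1).mulVec w = 0 := by
    intro w hw
    have h0 : w ⬝ᵥ (pencil A₀ A z.1).mulVec w = 0 := by rw [hw, dotProduct_zero]
    rw [hz, Matrix.add_mulVec, Matrix.smul_mulVec, Matrix.smul_mulVec, dotProduct_add,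
      dotProduct_smul, dotProduct_smul, smul_eq_mul, smul_eq_mul] at h0
    have h1 := hx.2 w
    have h2 := x₀.2.2 w
    exact ⟨hx.mulVec_eq_zero (by linarith), x₀.2.mulVec_eq_zero (by linarith)⟩
  have heq := Submodule.eq_of_le_of_finrank_le (S₁ := LinearMap.ker (pencil A₀ A z.1).mulVecLin)
    (S₂ := LinearMap.ker (pencil A₀ A x₀.1).mulVecLin)
    (fun w hw => by
      rw [LinearMap.mem_ker, Matrix.mulVecLin_apply] at hw ⊢
      exact (hker w hw).2) (hx₀ z)
  have hv' : v ∈ LinearMap.ker (pencil A₀ A z.1).mulVecLin := by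
    rw [heq, LinearMap.mem_ker, Matrix.mulVecLin_apply]
    exact hv
  rw [LinearMap.mem_ker, Matrix.mulVecLin_apply] at hv'
  exact (hker v hv').1

/-- A generalized inverse: split the map onto its range and extend the section to the whole space.
-/
theorem Matrix.exists_mul_mul_self {K : Type*} [Field K] (M : Matrix (Fin m) (Fin m) K) :
    ∃ G : Matrix (Fin m) (Fin m) K, M * (G * M) = M := by
  let f := Matrix.toLin' M
  obtain ⟨s, hs⟩ := f.rangeRestrict.exists_rightInverse_of_surjective f.range_rangeRestrict
  obtain ⟨g, hg⟩ := LinearMap.exists_extend s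
  refine ⟨LinearMap.toMatrix' g, ?_⟩
  apply Matrix.toLin'.injective
  rw [Matrix.toLin'_mul, Matrix.toLin'_mul, Matrix.toLin'_toMatrix']
  refine LinearMap.ext fun v => ?_
  have h1 : g (f v) = s (f.rangeRestrict v) := LinearMap.congr_fun hg (f.rangeRestrict v)
  have h2 : f.rangeRestrict (s (f.rangeRestrict v)) = f.rangeRestrict v := LinearMap.congr_fun hs _
  change f (g (f v)) = f v
  rw [h1]
  exact congrArg Subtype.val h2

end Kernel

/-! ### Uniqueness of minimizers and recession directions -/

/-- Take B = 0, so that t is a dummy parameter. Two minimizers differing in coordinate j span a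
segment of minimizers, and the algebraic relation between t and x_j would vanish on a product of two
infinite sets. The constant matrix P comes from a member of minimal kernel, so no interior point is
needed. -/
theorem isGeneric_minimizer_unique {m n : ℕ} {A₀ : Matrix (Fin m) (Fin m) ℝ}
    {A : Fin n → Matrix (Fin m) (Fin m) ℝ} (hA₀ : A₀.transpose = A₀)
    (hA : ∀ i, (A i).transpose = A i) :
    IsGeneric fun l => ∀ x y, IsPSD (pencil A₀ A x) → IsPSD (pencil A₀ A y) →
      (∀ z, IsPSD (pencil A₀ A z) → linForm l x ≤ linForm l z) →
      (∀ z, IsPSD (pencil A₀ A z) → linForm l y ≤ linForm l z) → x = y := by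
  by_cases hne : ∃ x, IsPSD (pencil A₀ A x)
  swap
  · exact ⟨1, one_ne_zero, fun l _ x y hx => (hne ⟨x, hx⟩).elim⟩
  obtain ⟨x₀, hx₀, hker⟩ := exists_ker_minimal hne
  obtain ⟨G, hG⟩ := (pencil A₀ A x₀).exists_mul_mul_self
  have hP : ∀ x, IsPSD (pencil A₀ A x) →
      pencil A₀ A x * (G * pencil A₀ A x₀) = pencil A₀ A x := by
    intro x hx
    -- The columns of G X₀ - 1 lie in ker X₀, hence in the kernel of every member.
    have h0 : pencil A₀ A x₀ * (G * pencil A₀ A x₀ - 1) = 0 := by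
      rw [Matrix.mul_sub, hG, Matrix.mul_one, sub_self]
    have h1 : pencil A₀ A x * (G * pencil A₀ A x₀ - 1) = 0 := by
      apply Matrix.ext_of_mulVec_single
      intro i
      rw [Matrix.zero_mulVec, ← Matrix.mulVec_mulVec]
      apply hker x hx
      rw [Matrix.mulVec_mulVec, h0, Matrix.zero_mulVec]
    rwa [Matrix.mul_sub, Matrix.mul_one, sub_eq_zero] at h1
  refine (isGeneric_minimizer_algebraic (B := 0) (P := G * pencil A₀ A x₀) hA₀
    Matrix.transpose_zero hA (fun t _ x hx => ?_)).mono fun l hl x y hx hy hxm hym => ?_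
  · simp only [smul_zero, add_zero] at hx ⊢
    exact ⟨hP x hx, x₀, G, hx₀, rfl⟩
  by_contra hxy
  obtain ⟨j, hj⟩ := Function.ne_iff.1 hxy
  obtain ⟨q, hq, hqv⟩ := hl j
  simp only [smul_zero, add_zero] at hqv
  apply hq
  let s : Fin 2 → Set ℝ := ![Set.Ioi 0, (fun a : ℝ => x j + a * (y j - x j)) '' Set.Icc 0 1]
  have hs : ∀ i, (s i).Infinite := by
    intro i
    fin_cases i
    · exact Set.Ioi_infinite 0
    · refine Set.Infinite.image ?_ (Set.Icc_infinite one_pos)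
      intro a _ b _ hab
      have : y j - x j ≠ 0 := sub_ne_zero.2 (Ne.symm hj)
      simpa [this] using hab
  apply MvPolynomial.funext_set s hs
  intro v hv
  have hv0 : 0 < v 0 := hv 0 trivial
  obtain ⟨a, ⟨ha0, ha1⟩, hav⟩ := hv 1 trivial
  have hlin : linForm l ((1 - a) • x + a • y) = linForm l x := by
    rw [linForm_add, linForm_smul, linForm_smul, le_antisymm (hym x hx) (hxm y hy)]
    ring
  have := hqv (v 0) ((1 - a) • x + a • y) hv0
    (isPSD_pencil_convex hx hy (by linarith) ha0 (by ring))
    (fun z hz => by rw [hlin]; exact hxm z hz)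
  have hvq : v = ![v 0, ((1 - a) • x + a • y) j] := by
    refine List.ofFn_inj.1 ?_
    simp only [List.ofFn_succ, List.ofFn_zero, Matrix.cons_val_zero, Fin.succ_zero_eq_one,
      Matrix.cons_val_one, List.cons.injEq, true_and, and_true]
    rw [← hav]
    simp only [Pi.add_apply, Pi.smul_apply, smul_eq_mul]
    ring
  rw [map_zero, hvq, this]

/-- If `l` is nonnegative on the recession cone, 0 is a minimizer there, and uniqueness excludes any
nonzero d with l(d) = 0. -/
theorem isGeneric_recession {m n : ℕ} {A : Fin n → Matrix (Fin m) (Fin m) ℝ}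
    (hA : ∀ i, (A i).transpose = A i) :
    IsGeneric fun l => (∃ d, IsPSD (pencil 0 A d) ∧ linForm l d < 0) ∨
      ∀ d, IsPSD (pencil 0 A d) → d ≠ 0 → 0 < linForm l d := by
  refine (isGeneric_minimizer_unique (A₀ := 0) Matrix.transpose_zero hA).mono fun l hl => ?_
  by_contra hcon
  push Not at hcon
  obtain ⟨h1, d, hd, hd0, hld⟩ := hcon
  have hld0 : linForm l d = 0 := le_antisymm hld (h1 d hd)
  have hz : linForm l 0 = 0 := by simp [linForm]
  exact hd0 (hl d 0 hd (by simp [pencil, IsPSD]) (fun z hz => by rw [hld0]; exact h1 z hz)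
    (fun z hz' => by rw [hz]; exact h1 z hz'))

/-! ### Factorization of polynomials over power series -/

section Hensel

open PowerSeries IsLocalRing

variable {k : Type*} [Field k]

instance powerSeries_isAdicComplete : IsAdicComplete (maximalIdeal k⟦X⟧) k⟦X⟧ := by
  rw [PowerSeries.maximalIdeal_eq_span_X]
  infer_instance

theorem PowerSeries.mem_maximalIdeal_iff {f : k⟦X⟧} :
    f ∈ maximalIdeal k⟦X⟧ ↔ constantCoeff f = 0 := by
  rw [PowerSeries.maximalIdeal_eq_span_X, Ideal.mem_span_singleton, PowerSeries.X_dvd_iff]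

/-- A monic polynomial over `k⟦X⟧` vanishing modulo `(X, Y)` has a monic factor whose degree is the
order in `Y` of its reduction modulo `X`. -/
theorem exists_monic_dvd_of_coeff {p : Polynomial k⟦X⟧} (h0 : constantCoeff (p.coeff 0) = 0)
    {i : ℕ} (hi : constantCoeff (p.coeff i) ≠ 0) :
    ∃ f : Polynomial k⟦X⟧, f.Monic ∧ f ∣ p ∧ 0 < f.natDegree ∧ f.natDegree ≤ i := by
  set g : PowerSeries k⟦X⟧ := (p : PowerSeries k⟦X⟧) with hg
  have hres : ∀ j, coeff j (g.map (residue k⟦X⟧)) = 0 ↔ constantCoeff (p.coeff j) = 0 := by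
    intro j
    rw [PowerSeries.coeff_map, IsLocalRing.residue_eq_zero_iff, hg, Polynomial.coeff_coe,
      PowerSeries.mem_maximalIdeal_iff]
  have hne : g.map (residue k⟦X⟧) ≠ 0 := by
    intro h
    apply hi
    rw [← hres, h, map_zero]
  -- Weierstrass preparation, with p regarded as a power series in Y over k⟦X⟧.
  obtain ⟨f, h, H⟩ := exists_isWeierstrassFactorization hne
  have hdeg : f.natDegree = (g.map (residue k⟦X⟧)).order.toNat :=
    H.natDegree_eq_toNat_order_map_of_ne_top (Ideal.IsPrime.ne_top inferInstance)
  have hfin : (g.map (residue k⟦X⟧)).order ≠ ⊤ := by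
    rwa [Ne, PowerSeries.order_eq_top]
  have hfm : f.Monic := H.isDistinguishedAt.monic
  refine ⟨f, hfm, ?_, ?_, ?_⟩
  · have hdiv : IsWeierstrassDivision (0 : PowerSeries k⟦X⟧) (f : PowerSeries k⟦X⟧)
        (((p /ₘ f : Polynomial k⟦X⟧) : PowerSeries k⟦X⟧) - h) (p %ₘ f) := by
      constructor
      · have h1 : (((f : PowerSeries k⟦X⟧).map (Ideal.Quotient.mk (maximalIdeal k⟦X⟧))).order).toNat
            = f.natDegree :=
          (congrArg ENat.toNat (H.isDistinguishedAt.coe_natDegree_eq_order_map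
            (f : PowerSeries k⟦X⟧) 1 (by
              rw [constantCoeff_one, ← Ideal.ne_top_iff_one]
              exact Ideal.IsPrime.ne_top inferInstance) (by simp))).symm
        rw [h1, ← Polynomial.degree_eq_natDegree hfm.ne_zero]
        exact Polynomial.degree_modByMonic_lt p hfm
      · have h2 := congrArg (fun q : Polynomial k⟦X⟧ => (q : PowerSeries k⟦X⟧))
          (Polynomial.modByMonic_add_div p f)
        simp only [Polynomial.coe_add, Polynomial.coe_mul] at h2
        have h3 : (p : PowerSeries k⟦X⟧) = f * h := H.eq_mul
        rw [h3] at h2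
        rw [mul_sub, ← h2]
        ring
    have hf0 : (f : PowerSeries k⟦X⟧).map (residue k⟦X⟧) ≠ 0 := by
      rw [← Polynomial.polynomial_map_coe]
      exact_mod_cast (hfm.map (residue k⟦X⟧)).ne_zero
    have := (hdiv.eq_zero hf0).2
    rwa [Polynomial.modByMonic_eq_zero_iff_dvd hfm] at this
  · rw [hdeg, pos_iff_ne_zero, Ne, ENat.toNat_eq_zero, not_or]
    refine ⟨fun h => ?_, hfin⟩
    have := PowerSeries.coeff_order hne
    rw [h] at this
    exact this ((hres 0).2 h0)
  · rw [hdeg]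
    apply ENat.toNat_le_of_le_natCast
    apply PowerSeries.order_le
    rwa [Ne, hres]

theorem Polynomial.comp_X_add_C_comp_X_sub_C {R : Type*} [CommRing R] (p : Polynomial R) (c : R) :
    (p.comp (.X + .C c)).comp (.X - .C c) = p := by
  rw [Polynomial.comp_assoc]
  simp

/-- Any root c serves. Otherwise p = (X - c)^(n+1), and the vanishing coefficient -(n+1)c gives c =
0 in characteristic 0, so p = X^(n+1), contrary to `hi`. -/
theorem exists_root_not_pow [IsAlgClosed k] [CharZero k] {p : Polynomial k} (hp : p.Monic)
    {n : ℕ} (hn : p.natDegree = n + 1) (h1 : p.coeff n = 0) {i : ℕ} (hin : i ≤ n)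
    (hi : p.coeff i ≠ 0) :
    ∃ c, (p.comp (.X + .C c)).coeff 0 = 0 ∧ ∃ j ≤ n, (p.comp (.X + .C c)).coeff j ≠ 0 := by
  obtain ⟨c, hc⟩ := IsAlgClosed.exists_root p (by
    rw [Polynomial.degree_eq_natDegree hp.ne_zero, hn]
    exact_mod_cast Nat.succ_ne_zero n)
  refine ⟨c, ?_, ?_⟩
  · rw [Polynomial.coeff_zero_eq_eval_zero, Polynomial.eval_comp]
    simpa using hc
  by_contra hcon
  push Not at hcon
  have hsm : (p.comp (.X + .C c)).Monic := hp.comp_X_add_C c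
  have hsn : (p.comp (.X + .C c)).natDegree = n + 1 := by
    rw [Polynomial.natDegree_comp, hn, Polynomial.natDegree_X_add_C, mul_one]
  have hX : p.comp (.X + .C c) = .X ^ (n + 1) := by
    ext j
    rw [Polynomial.coeff_X_pow]
    split_ifs with hj
    · rw [hj, ← hsn]
      exact hsm
    · rcases lt_or_gt_of_ne hj with h | h
      · exact hcon j (by omega)
      · exact Polynomial.coeff_eq_zero_of_natDegree_lt (by omega)
  have hpow : p = (.X - .C c) ^ (n + 1) := by
    rw [← p.comp_X_add_C_comp_X_sub_C c, hX]
    simp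
  have hc0 : c = 0 := by
    have h2 := Polynomial.coeff_X_add_C_pow (-c) (n + 1) n
    rw [Polynomial.C_neg, ← sub_eq_add_neg, ← hpow, h1, Nat.succ_sub (le_refl n), Nat.sub_self,
      pow_one, Nat.choose_succ_self_right] at h2
    have h3 : ((n + 1 : ℕ) : k) ≠ 0 := Nat.cast_ne_zero.2 (Nat.succ_ne_zero n)
    simpa using (mul_eq_zero.1 h2.symm).resolve_right h3
  apply hi
  rw [hpow, hc0, Polynomial.C_0, sub_zero, Polynomial.coeff_X_pow, if_neg (by omega)]

/-- A monic polynomial over `k⟦X⟧`, whose reduction modulo `X` is not a power of `Y` although its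
second coefficient vanishes, is reducible. -/
theorem exists_monic_proper_dvd [IsAlgClosed k] [CharZero k] {p : Polynomial k⟦X⟧} (hp : p.Monic)
    {n : ℕ} (hn : p.natDegree = n + 1) (h1 : constantCoeff (p.coeff n) = 0) {i : ℕ} (hin : i ≤ n)
    (hi : constantCoeff (p.coeff i) ≠ 0) :
    ∃ f : Polynomial k⟦X⟧, f.Monic ∧ f ∣ p ∧ 0 < f.natDegree ∧ f.natDegree ≤ n := by
  obtain ⟨c, hc0, j, hjn, hj⟩ := exists_root_not_pow (hp.map (constantCoeff (R := k)))
    (by rw [hp.natDegree_map, hn]) (by rwa [Polynomial.coeff_map]) hin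
    (by rwa [Polynomial.coeff_map])
  have hcoeff : ∀ j, constantCoeff ((p.comp (.X + .C (C c))).coeff j)
      = ((p.map (constantCoeff (R := k))).comp (.X + .C c)).coeff j := by
    intro j
    rw [← Polynomial.coeff_map, Polynomial.map_comp]
    simp
  rw [← hcoeff] at hc0 hj
  obtain ⟨f, hfm, ⟨g, hfg⟩, hf0, hfj⟩ := exists_monic_dvd_of_coeff hc0 hj
  have hdeg : (f.comp (.X - .C (C c))).natDegree = f.natDegree := by
    rw [Polynomial.natDegree_comp, Polynomial.natDegree_X_sub_C, mul_one]
  have hdvd : f.comp (.X - .C (C c)) ∣ p := by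
    refine Dvd.intro (g.comp (.X - .C (C c))) ?_
    rw [← Polynomial.mul_comp, ← hfg, Polynomial.comp_X_add_C_comp_X_sub_C]
  have hmon : (f.comp (.X - .C (C c))).Monic := hfm.comp_X_sub_C (C c)
  exact ⟨_, hmon, hdvd, by rwa [hdeg], by rw [hdeg]; exact hfj.trans hjn⟩

end Hensel

/-! ### Puiseux series as ramified Laurent series -/

section Ramify

variable (k : Type*) [Field k]

/-- The substitution `X ↦ ε^(1/q)` of Laurent series into Puiseux series. -/
def ramify (q : ℕ+) : HahnSeries ℤ k →+* HahnSeries ℚ k :=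
  embDomainRingHom
    { toFun := fun a : ℤ => (a : ℚ) / q
      map_zero' := by simp
      map_add' := fun a b => by push_cast; ring }
    (fun a b h => by
      have hq : (q : ℚ) ≠ 0 := by positivity
      simpa [div_left_inj' hq] using h)
    (fun a b => by
      have hq : (0 : ℚ) < q := by positivity
      change (a : ℚ) / q ≤ (b : ℚ) / q ↔ a ≤ b
      rw [div_le_div_iff_of_pos_right hq]
      exact_mod_cast Iff.rfl)

variable {k}

theorem coeff_ramify (q : ℕ+) (g : HahnSeries ℤ k) (a : ℤ) :
    (ramify k q g).coeff ((a : ℚ) / q) = g.coeff a :=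
  embDomain_coeff

theorem coeff_ramify_of_forall_ne (q : ℕ+) (g : HahnSeries ℤ k) {i : ℚ}
    (h : ∀ a : ℤ, i ≠ (a : ℚ) / q) : (ramify k q g).coeff i = 0 :=
  embDomain_of_notMem_range (by rintro ⟨a, rfl⟩; exact h a rfl)

theorem mem_range_ramify_iff (q : ℕ+) (f : HahnSeries ℚ k) :
    f ∈ (ramify k q).range ↔ ∀ i, f.coeff i ≠ 0 → ∃ a : ℤ, i = (a : ℚ) / q := by
  have hq : (0 : ℚ) < q := by positivity
  constructor
  · rintro ⟨g, rfl⟩ i hi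
    by_contra h
    push Not at h
    exact hi (coeff_ramify_of_forall_ne q g h)
  · intro h
    refine ⟨{ coeff := fun a => f.coeff ((a : ℚ) / q), isPWO_support' := ?_ }, ?_⟩
    · rw [Set.isPWO_iff_isWF]
      have hw := f.isWF_support
      rw [Set.isWF_iff_no_descending_seq] at hw ⊢
      intro u hu hmem
      refine hw (fun j => (u j : ℚ) / q) (fun a b hab => ?_) (fun j => hmem j)
      exact div_lt_div_of_pos_right (by exact_mod_cast hu hab) hq
    · ext i
      by_cases hi : ∃ a : ℤ, i = (a : ℚ) / q
      · obtain ⟨a, rfl⟩ := hi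
        exact coeff_ramify q _ a
      · have : f.coeff i = 0 := by
          by_contra h0
          exact hi (h i h0)
        push Not at hi
        rw [this, coeff_ramify_of_forall_ne q _ hi]

theorem range_ramify_le_of_dvd {q r : ℕ+} (h : q ∣ r) : (ramify k q).range ≤ (ramify k r).range := by
  intro f hf
  rw [mem_range_ramify_iff] at hf ⊢
  obtain ⟨s, rfl⟩ := h
  intro i hi
  obtain ⟨a, rfl⟩ := hf i hi
  have hq : (q : ℚ) ≠ 0 := by positivity
  have hs : (s : ℚ) ≠ 0 := by positivity
  exact ⟨a * s, by push_cast; field_simp⟩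

variable (k) in
/-- The field of Puiseux series over `k`. -/
def puiseuxField : Subfield (HahnSeries ℚ k) where
  carrier := {f | ∃ q, f ∈ (ramify k q).range}
  mul_mem' := by
    rintro f g ⟨q, hf⟩ ⟨r, hg⟩
    exact ⟨q * r, mul_mem (range_ramify_le_of_dvd (dvd_mul_right q r) hf)
      (range_ramify_le_of_dvd (dvd_mul_left r q) hg)⟩
  one_mem' := ⟨1, one_mem _⟩
  add_mem' := by
    rintro f g ⟨q, hf⟩ ⟨r, hg⟩
    exact ⟨q * r, add_mem (range_ramify_le_of_dvd (dvd_mul_right q r) hf)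
      (range_ramify_le_of_dvd (dvd_mul_left r q) hg)⟩
  zero_mem' := ⟨1, zero_mem _⟩
  neg_mem' := by
    rintro f ⟨q, hf⟩
    exact ⟨q, neg_mem hf⟩
  inv_mem' := by
    rintro _ ⟨q, g, rfl⟩
    exact ⟨q, g⁻¹, map_inv₀ _ _⟩

theorem single_mem_puiseuxField (a : ℚ) (c : k) : single a c ∈ puiseuxField k := by
  refine ⟨⟨a.den, a.den_pos⟩, (mem_range_ramify_iff _ _).2 fun i hi => ⟨a.num, ?_⟩⟩
  have : i = a := by
    by_contra h
    exact hi (coeff_single_of_ne h)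
  rw [this]
  exact (Rat.num_div_den a).symm

theorem exists_common_ramify {ι : Type*} (s : Finset ι) (f : ι → HahnSeries ℚ k)
    (hf : ∀ i ∈ s, f i ∈ puiseuxField k) : ∃ q, ∀ i ∈ s, f i ∈ (ramify k q).range := by
  classical
  induction s using Finset.induction_on with
  | empty => exact ⟨1, by simp⟩
  | insert a s ha ih =>
    obtain ⟨q, hq⟩ := ih fun i hi => hf i (Finset.mem_insert_of_mem hi)
    obtain ⟨r, hr⟩ := hf a (Finset.mem_insert_self a s)
    refine ⟨q * r, fun i hi => ?_⟩
    rcases Finset.mem_insert.1 hi with rfl | hi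
    · exact range_ramify_le_of_dvd (dvd_mul_left r q) hr
    · exact range_ramify_le_of_dvd (dvd_mul_right q r) (hq i hi)

variable (k) in
/-- The substitution `X ↦ ε^(1/q)` of power series into Puiseux series. -/
def ramifyPower (q : ℕ+) : PowerSeries k →+* puiseuxField k :=
  ((ramify k q).comp (ofPowerSeries ℤ k)).codRestrict (puiseuxField k) fun _ => ⟨q, _, rfl⟩

theorem coeff_zero_ramifyPower (q : ℕ+) (f : PowerSeries k) :
    (ramifyPower k q f : HahnSeries ℚ k).coeff 0 = PowerSeries.constantCoeff f := by
  change (ramify k q (ofPowerSeries ℤ k f)).coeff 0 = _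
  have := coeff_ramify q (ofPowerSeries ℤ k f) 0
  rw [Int.cast_zero, zero_div] at this
  rw [this]
  have := ofPowerSeries_apply_coeff (Γ := ℤ) f 0
  rw [Nat.cast_zero] at this
  rw [this, PowerSeries.coeff_zero_eq_constantCoeff]

theorem mem_range_ramifyPower {q : ℕ+} {f : puiseuxField k} (hf : f.1 ∈ (ramify k q).range)
    (h0 : ∀ i < 0, f.1.coeff i = 0) : f ∈ (ramifyPower k q).range := by
  obtain ⟨g, hg⟩ := hf
  have hq : (0 : ℚ) < q := by positivity
  have hgn : ∀ a < 0, g.coeff a = 0 := by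
    intro a ha
    rw [← coeff_ramify q, hg]
    exact h0 _ (div_neg_of_neg_of_pos (by exact_mod_cast ha) hq)
  refine ⟨PowerSeries.mk fun n => g.coeff n, Subtype.ext ?_⟩
  rw [← hg]
  change ramify k q _ = _
  congr 1
  ext a
  rcases lt_or_ge a 0 with ha | ha
  · rw [hgn a ha]
    rw [ofPowerSeries_apply]
    apply embDomain_of_notMem_range
    rintro ⟨n, hn⟩
    have : (n : ℤ) = a := hn
    omega
  · obtain ⟨n, rfl⟩ := Int.eq_ofNat_of_zero_le ha
    exact (ofPowerSeries_apply_coeff _ n).trans (by simp)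

end Ramify

/-! ### The Newton–Puiseux theorem -/

section AlgClosed

open Polynomial

variable {k : Type*} [Field k]

theorem coeff_mul_single_neg (f : HahnSeries ℚ k) (b i : ℚ) :
    (f * single (-b) 1).coeff i = f.coeff (i + b) := by
  have := coeff_mul_single_add (r := (1 : k)) (x := f) (a := i + b) (b := -b)
  rwa [add_neg_cancel_right, mul_one] at this

/-- Scaling the roots by a power of `ε` makes a polynomial integral and nonzero modulo `ε`. -/
theorem exists_scaling (c : ℕ → HahnSeries ℚ k) (n : ℕ) (hne : ∃ i ≤ n, c i ≠ 0) : ∃ a : ℚ,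
    (∀ i ≤ n, ∀ j < 0, (c i).coeff (j + (n + 1 - i : ℕ) * a) = 0) ∧
      ∃ i ≤ n, (c i).coeff ((n + 1 - i : ℕ) * a) ≠ 0 := by
  classical
  let s := (Finset.range (n + 1)).filter fun i => c i ≠ 0
  have hs : s.Nonempty := by
    obtain ⟨i, hi, hc⟩ := hne
    exact ⟨i, by simp only [s, Finset.mem_filter, Finset.mem_range]; exact ⟨by omega, hc⟩⟩
  -- The Newton polygon slope: the least ord(c_i)/(n + 1 - i), attained at i₀.
  obtain ⟨i₀, hi₀, hmin⟩ := s.exists_min_image (fun i => (c i).order / (n + 1 - i : ℕ)) hs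
  simp only [s, Finset.mem_filter, Finset.mem_range] at hi₀ hmin
  have hpos : ∀ i ≤ n, (0 : ℚ) < (n + 1 - i : ℕ) := fun i hi => by
    have : 0 < n + 1 - i := by omega
    exact_mod_cast this
  refine ⟨(c i₀).order / (n + 1 - i₀ : ℕ), fun i hi j hj => ?_, i₀, by omega, ?_⟩
  · by_cases h0 : c i = 0
    · rw [h0, HahnSeries.coeff_zero]
    apply coeff_eq_zero_of_lt_order
    have h1 := hmin i ⟨by omega, h0⟩
    rw [le_div_iff₀ (hpos i hi)] at h1
    linarith
  · rw [mul_div_cancel₀ _ (hpos i₀ (by omega)).ne']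
    exact coeff_order_eq_zero.not.2 hi₀.2

theorem coeff_taylor_penultimate {K : Type*} [Field K] [CharZero K] {p : K[X]} (hp : p.Monic)
    {n : ℕ} (hn : p.natDegree = n + 1) :
    (taylor (-(p.coeff n / (n + 1))) p).coeff n = 0 := by
  have hd : (hasseDeriv n p).natDegree < 2 := by
    have := natDegree_hasseDeriv_le p n
    omega
  have hc : p.coeff (n + 1) = 1 := by
    rw [← hn]
    exact hp
  have h3 : (n + 1 : K) ≠ 0 := by exact_mod_cast Nat.succ_ne_zero n
  rw [taylor_coeff, eval_eq_sum_range' hd, Finset.sum_range_succ, Finset.sum_range_one,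
    hasseDeriv_coeff, hasseDeriv_coeff, zero_add, add_comm 1 n, hc, Nat.choose_self,
    Nat.choose_succ_self_right]
  push_cast
  field_simp
  ring

instance [CharZero k] : CharZero (puiseuxField k) :=
  charZero_of_injective_ringHom (f := (HahnSeries.C : k →+* HahnSeries ℚ k).codRestrict
    (puiseuxField k) fun r => single_mem_puiseuxField 0 r) (RingHom.injective _)

/-- The finitely many coefficients share one ramification index q, so p descends along X ↦ ε^(1/q)
to k⟦X⟧, where it factors. -/
theorem exists_monic_proper_dvd_of_integral [IsAlgClosed k] [CharZero k] {p : (puiseuxField k)[X]}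
    (hp : p.Monic) {n : ℕ} (hn : p.natDegree = n + 1)
    (hint : ∀ i, ∀ j < 0, (p.coeff i : HahnSeries ℚ k).coeff j = 0)
    (h1 : (p.coeff n : HahnSeries ℚ k).coeff 0 = 0) {i : ℕ} (hin : i ≤ n)
    (hi : (p.coeff i : HahnSeries ℚ k).coeff 0 ≠ 0) :
    ∃ f : (puiseuxField k)[X], f.Monic ∧ f ∣ p ∧ 0 < f.natDegree ∧ f.natDegree ≤ n := by
  obtain ⟨q, hq⟩ := exists_common_ramify p.support (fun i => (p.coeff i : HahnSeries ℚ k))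
    fun i _ => (p.coeff i).2
  have hlift : p ∈ lifts (ramifyPower k q) := by
    rw [lifts_iff_coeff_lifts]
    intro i
    by_cases hi : i ∈ p.support
    · exact mem_range_ramifyPower (hq i hi) (hint i)
    · exact ⟨0, by rw [map_zero, notMem_support_iff.1 hi]⟩
  obtain ⟨p₃, hp₃, hn₃, hp₃m⟩ := lifts_and_natDegree_eq_and_monic hlift hp
  have hcc : ∀ i, PowerSeries.constantCoeff (p₃.coeff i)
      = (p.coeff i : HahnSeries ℚ k).coeff 0 := by
    intro i
    rw [← coeff_zero_ramifyPower q, ← coeff_map, hp₃]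
  obtain ⟨f, hfm, hfp, hf0, hfn⟩ := exists_monic_proper_dvd hp₃m (hn₃.trans hn)
    (by rw [hcc, h1]) hin (by rwa [hcc])
  refine ⟨f.map (ramifyPower k q), hfm.map _, ?_, by rwa [hfm.natDegree_map],
    by rwa [hfm.natDegree_map]⟩
  rw [← hp₃]
  exact map_dvd (mapRingHom (ramifyPower k q)) hfp

/-- Induction on the degree: translate to kill the second coefficient, rescale the roots to be
integral and nontrivial modulo ε, then split off a monic factor of smaller positive degree. -/
theorem exists_root_of_monic [IsAlgClosed k] [CharZero k] (n : ℕ) : ∀ p : (puiseuxField k)[X],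
    p.Monic → p.natDegree = n + 1 → ∃ y, p.eval y = 0 := by
  induction n using Nat.strong_induction_on with
  | _ n ih =>
  intro p hp hn
  set b := -(p.coeff n / (n + 1)) with hb
  set p₁ := taylor b p with hp₁
  suffices h : ∃ y, p₁.eval y = 0 by
    obtain ⟨y, hy⟩ := h
    exact ⟨y + b, by rwa [hp₁, taylor_eval] at hy⟩
  have hp₁m : p₁.Monic := by
    rw [hp₁, taylor_apply]
    exact hp.comp_X_add_C b
  have hn₁ : p₁.natDegree = n + 1 := by rw [hp₁, natDegree_taylor, hn]
  have hc₁ : p₁.coeff n = 0 := coeff_taylor_penultimate hp hn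
  by_cases hz : ∀ i ≤ n, p₁.coeff i = 0
  · refine ⟨0, ?_⟩
    rw [← coeff_zero_eq_eval_zero]
    exact hz 0 (Nat.zero_le n)
  push Not at hz
  obtain ⟨a, ha, i₀, hi₀, ha₀⟩ := exists_scaling (fun i => (p₁.coeff i : HahnSeries ℚ k)) n (by
    obtain ⟨i, hi, h⟩ := hz
    exact ⟨i, hi, fun h0 => h (Subtype.ext h0)⟩)
  let s : puiseuxField k := ⟨single (-a) 1, single_mem_puiseuxField _ _⟩
  have hs0 : s ≠ 0 := fun h => by
    have := congrArg Subtype.val h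
    exact one_ne_zero (single_eq_zero_iff.1 this)
  set p₂ := scaleRoots p₁ s with hp₂
  suffices h : ∃ y, p₂.eval y = 0 by
    obtain ⟨y, hy⟩ := h
    refine ⟨y / s, ?_⟩
    have := scaleRoots_eval_mul p₁ (y / s) s
    rw [mul_div_cancel₀ _ hs0, ← hp₂, hy] at this
    exact (mul_eq_zero.1 this.symm).resolve_left (pow_ne_zero _ hs0)
  have hp₂m : p₂.Monic := (monic_scaleRoots_iff s).2 hp₁m
  have hn₂ : p₂.natDegree = n + 1 := by rw [hp₂, natDegree_scaleRoots, hn₁]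
  have hcoeff : ∀ i j, (p₂.coeff i : HahnSeries ℚ k).coeff j
      = (p₁.coeff i : HahnSeries ℚ k).coeff (j + (n + 1 - i : ℕ) * a) := by
    intro i j
    rw [hp₂, coeff_scaleRoots, hn₁]
    change ((p₁.coeff i : HahnSeries ℚ k) * (single (-a) 1) ^ (n + 1 - i)).coeff j = _
    rw [single_pow, one_pow, smul_neg, coeff_mul_single_neg, nsmul_eq_mul]
  have hint : ∀ i, ∀ j < 0, (p₂.coeff i : HahnSeries ℚ k).coeff j = 0 := by
    intro i j hj
    rcases lt_trichotomy i (n + 1) with h | h | h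
    · rw [hcoeff]
      exact ha i (by omega) j hj
    · have : p₂.coeff i = 1 := by rw [h, ← hn₂]; exact hp₂m
      rw [this]
      change (1 : HahnSeries ℚ k).coeff j = 0
      rw [HahnSeries.coeff_one, if_neg hj.ne]
    · rw [coeff_eq_zero_of_natDegree_lt (by omega)]
      rfl
  obtain ⟨f, hfm, hfp, hf0, hfn⟩ := exists_monic_proper_dvd_of_integral hp₂m hn₂ hint
    (by rw [hcoeff, hc₁, ZeroMemClass.coe_zero, HahnSeries.coeff_zero]) hi₀
    (by rw [hcoeff, zero_add]; exact ha₀)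
  obtain ⟨y, hy⟩ := ih (f.natDegree - 1) (by omega) f hfm (by omega)
  exact ⟨y, eval_eq_zero_of_dvd_of_eval_eq_zero hfp hy⟩

/-- The **Newton–Puiseux theorem**. -/
instance puiseuxField_isAlgClosed [IsAlgClosed k] [CharZero k] : IsAlgClosed (puiseuxField k) :=
  .of_exists_root _ fun p hp hirr =>
    exists_root_of_monic (p.natDegree - 1) p hp (by have := hirr.natDegree_pos; omega)

end AlgClosed

/-! ### Asymptotic expansions along an ultrafilter -/

section Asymptotic

open Filter Topology Asymptotics

/-- An ultrafilter of neighbourhoods of `0` on the positive half line. -/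
def nearZero : Ultrafilter ℝ := Ultrafilter.of (𝓝[>] 0)

theorem nearZero_le : (nearZero : Filter ℝ) ≤ 𝓝[>] 0 := Ultrafilter.of_le _

theorem eventually_nearZero_pos : ∀ᶠ t : ℝ in nearZero, 0 < t :=
  nearZero_le self_mem_nhdsWithin

/-- The power `t ^ a`, written so that it is multiplicative in `a` for every real `t`. -/
def expPow (a : ℚ) (t : ℝ) : ℝ := Real.exp (a * Real.log t)

theorem expPow_pos (a : ℚ) (t : ℝ) : 0 < expPow a t := Real.exp_pos _

theorem expPow_add (a b : ℚ) (t : ℝ) : expPow (a + b) t = expPow a t * expPow b t := by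
  rw [expPow, expPow, expPow, ← Real.exp_add]
  push_cast
  ring_nf

theorem expPow_zero (t : ℝ) : expPow 0 t = 1 := by simp [expPow]

theorem expPow_one {t : ℝ} (ht : 0 < t) : expPow 1 t = t := by simp [expPow, Real.exp_log ht]

theorem expPow_mul_neg (a : ℚ) (t : ℝ) : expPow a t * expPow (-a) t = 1 := by
  rw [← expPow_add, add_neg_cancel, expPow_zero]

theorem tendsto_expPow {a : ℚ} (ha : 0 < a) : Tendsto (expPow a) nearZero (𝓝 0) := by
  refine Real.tendsto_exp_atBot.comp ?_
  have h1 := Real.tendsto_log_nhdsGT_zero.mono_left nearZero_le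
  exact h1.const_mul_atBot (by exact_mod_cast ha)

theorem expPow_isBigO {a b : ℚ} (hab : a ≤ b) : expPow b =O[nearZero] expPow a := by
  have h : Tendsto (fun t => expPow (b - a) t) nearZero (𝓝 (if b = a then 1 else 0)) := by
    split_ifs with h
    · subst h
      simp only [sub_self, expPow_zero]
      exact tendsto_const_nhds
    · exact tendsto_expPow (sub_pos.2 (lt_of_le_of_ne hab (Ne.symm h)))
  have h2 := (isBigO_refl (expPow a) nearZero).mul (h.isBigO_one ℝ)
  refine h2.congr (fun t => ?_) fun t => mul_one _
  rw [← expPow_add, add_sub_cancel]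

theorem expPow_mul_isBigO {𝕜 : Type*} [RCLike 𝕜] {f g : ℝ → 𝕜} {a b : ℚ}
    (hf : f =O[nearZero] expPow a) (hg : g =O[nearZero] expPow b) :
    (fun t => f t * g t) =O[nearZero] expPow (a + b) :=
  (hf.mul hg).congr_right fun t => (expPow_add a b t).symm

/-- The reason for an ultrafilter rather than `𝓝[>] 0`: any two functions are comparable along it.
-/
theorem isBigO_of_not_isBigO {E F : Type*} [NormedAddCommGroup E] [NormedAddCommGroup F]
    {f : ℝ → E} {g : ℝ → F} (h : ¬ f =O[nearZero] g) :
    g =O[nearZero] f := by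
  rw [isBigO_iff] at h
  push Not at h
  have := h 1
  refine IsBigO.of_bound 1 ?_
  filter_upwards [this] with t ht
  linarith

variable {𝕜 : Type*} [RCLike 𝕜]

/-- The function `t ↦ ∑ p a * t ^ a` and the Hahn series `∑ p a * ε ^ a`. -/
def evalPair : AddMonoidAlgebra 𝕜 ℚ →+* (ℝ → 𝕜) × HahnSeries ℚ 𝕜 :=
  AddMonoidAlgebra.liftNCRingHom ((Pi.constRingHom ℝ 𝕜).prod HahnSeries.C)
    { toFun := fun a => (fun t => (expPow a.toAdd t : 𝕜), single a.toAdd 1)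
      map_one' := by
        refine Prod.ext ?_ rfl
        funext t
        simp [expPow_zero]
      map_mul' := fun a b => by
        refine Prod.ext ?_ ?_
        · funext t
          simp [expPow_add]
        · simp }
    fun _ _ => Commute.all _ _

theorem evalPair_eq_sum (p : AddMonoidAlgebra 𝕜 ℚ) :
    evalPair p = ∑ a ∈ p.coeff.support,
      ((fun t => p.coeff a * (expPow a t : 𝕜), single a (p.coeff a)) :
        (ℝ → 𝕜) × HahnSeries ℚ 𝕜) := by
  change p.coeff.sum (fun a b => ((fun t => b * (expPow a t : 𝕜), HahnSeries.C b * single a 1) :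
    (ℝ → 𝕜) × HahnSeries ℚ 𝕜)) = _
  rw [Finsupp.sum]
  refine Finset.sum_congr rfl fun a _ => Prod.ext rfl ?_
  change HahnSeries.C (p.coeff a) * single a 1 = _
  rw [HahnSeries.C_apply, single_mul_single, zero_add, mul_one]

theorem evalPair_fst (p : AddMonoidAlgebra 𝕜 ℚ) (t : ℝ) :
    (evalPair p).1 t = ∑ a ∈ p.coeff.support, p.coeff a * (expPow a t : 𝕜) := by
  rw [evalPair_eq_sum, Prod.fst_sum, Finset.sum_apply]

theorem coeff_evalPair_snd (p : AddMonoidAlgebra 𝕜 ℚ) (i : ℚ) :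
    (evalPair p).2.coeff i = p.coeff i := by
  classical
  rw [evalPair_eq_sum, Prod.snd_sum, HahnSeries.coeff_sum, Finset.sum_eq_single i]
  · exact coeff_single_same i _
  · intro b _ hb
    exact coeff_single_of_ne hb.symm
  · intro h
    exact (coeff_single_same i _).trans (Finsupp.notMem_support_iff.1 h)

theorem evalPair_single (a : ℚ) (c : 𝕜) :
    evalPair (AddMonoidAlgebra.single a c) = (fun t => c * (expPow a t : 𝕜), single a c) := by
  refine Prod.ext ?_ ?_
  · funext t
    by_cases hc : c = 0
    · simp [hc]
    · rw [evalPair_fst, AddMonoidAlgebra.coeff_single, Finsupp.support_single _ hc]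
      simp
  · ext i
    rw [coeff_evalPair_snd, AddMonoidAlgebra.coeff_single, HahnSeries.coeff_single,
      Finsupp.single_apply]
    simp only [eq_comm]

theorem tendsto_evalPair (p : AddMonoidAlgebra 𝕜 ℚ) (a : ℚ) (hp : ∀ i < a, p.coeff i = 0) :
    Tendsto (fun t => (evalPair p).1 t * (expPow (-a) t : 𝕜)) nearZero (𝓝 (p.coeff a)) := by
  classical
  have h : ∀ i ∈ p.coeff.support, Tendsto (fun t => p.coeff i * (expPow (i - a) t : 𝕜)) nearZero
      (𝓝 (if i = a then p.coeff i else 0)) := by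
    intro i hi
    have hai : a ≤ i := by
      by_contra h
      exact Finsupp.mem_support_iff.1 hi (hp i (not_le.1 h))
    split_ifs with hia
    · subst hia
      simp only [sub_self, expPow_zero, RCLike.ofReal_one, mul_one]
      exact tendsto_const_nhds
    · have h1 := tendsto_expPow (sub_pos.2 (lt_of_le_of_ne hai (Ne.symm hia)))
      have h2 := (RCLike.continuous_ofReal (K := 𝕜)).continuousAt.tendsto.comp h1
      rw [RCLike.ofReal_zero] at h2
      simpa using h2.const_mul (p.coeff i)
  have h2 := tendsto_finsetSum _ h
  rw [Finset.sum_ite_eq'] at h2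
  have h3 : (if a ∈ p.coeff.support then p.coeff a else 0) = p.coeff a := by
    split_ifs with h
    · rfl
    · exact (Finsupp.notMem_support_iff.1 h).symm
  rw [h3] at h2
  refine h2.congr fun t => ?_
  rw [evalPair_fst, Finset.sum_mul]
  refine Finset.sum_congr rfl fun i _ => ?_
  rw [sub_eq_add_neg, expPow_add]
  push_cast
  ring

theorem isBigO_expPow_of_tendsto {h : ℝ → 𝕜} {a : ℚ} {c : 𝕜}
    (hc : Tendsto (fun t => h t * (expPow (-a) t : 𝕜)) nearZero (𝓝 c)) :
    h =O[nearZero] expPow a := by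
  have h1 := (hc.isBigO_one ℝ).norm_left.mul (isBigO_refl (expPow a) nearZero)
  have h2 : (fun t => h t * (expPow (-a) t : 𝕜) * (expPow a t : 𝕜)) =O[nearZero]
      fun t => (1 : ℝ) * expPow a t := by
    refine IsBigO.trans ?_ h1
    refine IsBigO.of_bound 1 (Eventually.of_forall fun t => ?_)
    rw [norm_mul, norm_mul, norm_mul, ← norm_mul, norm_norm, norm_mul, RCLike.norm_ofReal,
      RCLike.norm_ofReal, Real.norm_eq_abs, one_mul]
  refine h2.congr (fun t => ?_) fun t => one_mul _
  rw [mul_assoc, mul_comm (expPow (-a) t : 𝕜), ← RCLike.ofReal_mul, expPow_mul_neg]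
  simp

/-- `y` is the asymptotic expansion of `h` along `nearZero`. -/
def Asym (h : ℝ → 𝕜) (y : HahnSeries ℚ 𝕜) : Prop :=
  ∀ N : ℚ, ∃ p : AddMonoidAlgebra 𝕜 ℚ,
    (fun t => h t - (evalPair p).1 t) =O[nearZero] expPow N ∧
      ∀ i < N, y.coeff i = p.coeff i

theorem Asym.tendsto {h : ℝ → 𝕜} {y : HahnSeries ℚ 𝕜} (H : Asym h y) {a : ℚ}
    (ha : ∀ i < a, y.coeff i = 0) :
    Tendsto (fun t => h t * (expPow (-a) t : 𝕜)) nearZero (𝓝 (y.coeff a)) := by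
  obtain ⟨p, hp, hyp⟩ := H (a + 1)
  have h1 := tendsto_evalPair p a fun i hi => by rw [← hyp i (by linarith), ha i hi]
  rw [← hyp a (by linarith)] at h1
  have h2 : Tendsto (fun t => (h t - (evalPair p).1 t) * (expPow (-a) t : 𝕜)) nearZero (𝓝 0) := by
    have h3 : (fun t => ((expPow (-a) t : ℝ) : 𝕜)) =O[nearZero] expPow (-a) :=
      IsBigO.of_bound 1 (Eventually.of_forall fun t => by simp)
    have h4 := expPow_mul_isBigO hp h3
    rw [add_neg_cancel_comm] at h4
    exact h4.trans_tendsto (tendsto_expPow one_pos)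
  have h5 := h2.add h1
  rw [zero_add] at h5
  exact h5.congr fun t => by ring

theorem Asym.isBigO {h : ℝ → 𝕜} {y : HahnSeries ℚ 𝕜} (H : Asym h y) {a : ℚ}
    (ha : ∀ i < a, y.coeff i = 0) : h =O[nearZero] expPow a :=
  isBigO_expPow_of_tendsto (H.tendsto ha)

theorem asym_evalPair (p : AddMonoidAlgebra 𝕜 ℚ) : Asym (evalPair p).1 (evalPair p).2 :=
  fun N => ⟨p, by simpa using isBigO_zero _ _, fun i _ => coeff_evalPair_snd p i⟩

theorem asym_zero_right_iff {h : ℝ → 𝕜} : Asym h 0 ↔ ∀ a, h =O[nearZero] expPow a := by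
  refine ⟨fun H a => H.isBigO fun _ _ => rfl, fun H N => ⟨0, ?_, fun i _ => by simp⟩⟩
  simpa using H N

theorem Asym.congr {h h' : ℝ → 𝕜} {y : HahnSeries ℚ 𝕜} (H : Asym h y)
    (hh : ∀ᶠ t in nearZero, h t = h' t) : Asym h' y := by
  intro N
  obtain ⟨p, hp, hy⟩ := H N
  refine ⟨p, hp.congr' ?_ EventuallyEq.rfl, hy⟩
  filter_upwards [hh] with t ht
  rw [ht]

theorem HahnSeries.coeff_mul_eq_zero {f g : HahnSeries ℚ 𝕜} {a b : ℚ}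
    (hf : ∀ i < a, f.coeff i = 0) (hg : ∀ i < b, g.coeff i = 0) :
    ∀ i < a + b, (f * g).coeff i = 0 := by
  intro i hi
  rw [HahnSeries.coeff_mul]
  refine Finset.sum_eq_zero fun ij hij => ?_
  have h := (Finset.mem_antidiagonal.1 hij).2.2
  by_cases h1 : ij.1 < a
  · rw [hf _ h1, zero_mul]
  · rw [hg ij.2 (by linarith), mul_zero]

theorem Asym.mul {h h' : ℝ → 𝕜} {y y' : HahnSeries ℚ 𝕜} (H : Asym h y) (H' : Asym h' y') :
    Asym (h * h') (y * y') := by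
  have low : ∀ y : HahnSeries ℚ 𝕜, ∀ i < y.order, y.coeff i = 0 :=
    fun y i hi => coeff_eq_zero_of_lt_order hi
  intro N
  set a := y.order with ha
  set b := y'.order with hb
  -- The error in h is multiplied by a function of order b and the error in h' by one of order a.
  -- The maximum with a ensures that p has no exponents below a.
  obtain ⟨p, hp, hyp⟩ := H (max a (N - b))
  obtain ⟨q, hq, hyq⟩ := H' (max b (N - a))
  have hpa : ∀ i < a, p.coeff i = 0 := fun i hi => by
    rw [← hyp i (hi.trans_le (le_max_left _ _)), low y i hi]
  refine ⟨p * q, ?_, fun i hi => ?_⟩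
  · have h1 := expPow_mul_isBigO hp (H'.isBigO (low y'))
    have h2 := expPow_mul_isBigO (isBigO_expPow_of_tendsto (tendsto_evalPair p a hpa)) hq
    have h3 := (h1.trans (expPow_isBigO (a := N) (by have := le_max_right a (N - b); linarith))).add
      (h2.trans (expPow_isBigO (a := N) (by have := le_max_right b (N - a); linarith)))
    refine h3.congr_left fun t => ?_
    rw [map_mul]
    simp only [Prod.fst_mul, Pi.mul_apply]
    ring
  · rw [← coeff_evalPair_snd, map_mul, Prod.snd_mul, ← sub_eq_zero, ← coeff_sub]
    have h1 : y * y' - (evalPair p).2 * (evalPair q).2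
        = (y - (evalPair p).2) * y' + (evalPair p).2 * (y' - (evalPair q).2) := by ring
    rw [h1, coeff_add, HahnSeries.coeff_mul_eq_zero (a := N - b) (b := b) _ (low y') i (by linarith),
      HahnSeries.coeff_mul_eq_zero (a := a) (b := N - a) _ _ i (by linarith), add_zero]
    · intro j hj
      rw [coeff_evalPair_snd, hpa j hj]
    · intro j hj
      rw [coeff_sub, coeff_evalPair_snd, hyq j (hj.trans_le (le_max_right _ _)), sub_self]
    · intro j hj
      rw [coeff_sub, coeff_evalPair_snd, hyp j (hj.trans_le (le_max_right _ _)), sub_self]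

variable (𝕜) in
/-- The ring of functions with an asymptotic expansion, together with the expansion. -/
def asymRing : Subring ((ℝ → 𝕜) × HahnSeries ℚ 𝕜) where
  carrier := {x | Asym x.1 x.2}
  mul_mem' := Asym.mul
  one_mem' := by simpa using asym_evalPair (1 : AddMonoidAlgebra 𝕜 ℚ)
  zero_mem' := by simpa using asym_evalPair (0 : AddMonoidAlgebra 𝕜 ℚ)
  add_mem' := by
    intro x y hx hy N
    obtain ⟨p, hp, hxp⟩ := hx N
    obtain ⟨q, hq, hyq⟩ := hy N
    refine ⟨p + q, (hp.add hq).congr_left fun t => ?_, fun i hi => ?_⟩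
    · rw [map_add]
      simp only [Prod.fst_add, Pi.add_apply]
      ring
    · simp [hxp i hi, hyq i hi]
  neg_mem' := by
    intro x hx N
    obtain ⟨p, hp, hxp⟩ := hx N
    refine ⟨-p, hp.neg_left.congr_left fun t => ?_, fun i hi => ?_⟩
    · rw [map_neg]
      simp only [Prod.fst_neg, Pi.neg_apply]
      ring
    · simp [hxp i hi]

theorem mem_asymRing {x : (ℝ → 𝕜) × HahnSeries ℚ 𝕜} : x ∈ asymRing 𝕜 ↔ Asym x.1 x.2 := Iff.rfl

end Asymptotic

/-! ### Realizing series, and expanding algebraic functions -/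

section Asymptotic

open Filter Topology Asymptotics

variable {𝕜 : Type*} [RCLike 𝕜]

theorem expPow_isLittleO {a b : ℚ} (hab : a < b) : expPow b =o[nearZero] expPow a := by
  have h := (isBigO_refl (expPow a) nearZero).mul_isLittleO
    ((isLittleO_one_iff ℝ).2 (tendsto_expPow (sub_pos.2 hab)))
  refine h.congr (fun t => ?_) fun t => mul_one _
  rw [← expPow_add, add_sub_cancel]

theorem eventually_norm_evalPair_sub_le {p q : AddMonoidAlgebra 𝕜 ℚ} {a b : ℚ} (hab : a < b)
    (hpq : ∀ i < b, p.coeff i = q.coeff i) :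
    ∀ᶠ t in nearZero, ‖(evalPair p).1 t - (evalPair q).1 t‖ ≤ expPow a t := by
  have h1 := isBigO_expPow_of_tendsto (tendsto_evalPair (p - q) b fun i hi => by simp [hpq i hi])
  have h2 := (h1.trans_isLittleO (expPow_isLittleO hab)).bound one_pos
  filter_upwards [h2] with t ht
  rw [one_mul, Real.norm_of_nonneg (expPow_pos _ _).le, map_sub] at ht
  exact ht

/-- Every Puiseux-like series is the expansion of a function. -/
theorem exists_asym {y : HahnSeries ℚ 𝕜}
    (hy : ∀ N : ℚ, ∃ p : AddMonoidAlgebra 𝕜 ℚ, ∀ i < N, y.coeff i = p.coeff i) :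
    ∃ h : ℝ → 𝕜, Asym h y := by
  classical
  choose P hP using fun n : ℕ => hy n
  -- A Borel-type diagonal argument: on U n the truncations up to n agree to the expected precision.
  -- At t the truncation of largest index n ≤ ⌈1/t⌉ with t ∈ U n is used; t n < 1 puts n within the
  -- search range.
  let U : ℕ → Set ℝ := fun n => {t | (0 < t ∧ t * n < 1) ∧ ∀ i ∈ Finset.range (n + 1),
    ∀ j ∈ Finset.range (n + 1), i ≤ j →
      ‖(evalPair (P j)).1 t - (evalPair (P i)).1 t‖ ≤ expPow (i - 1) t}
  have hU : ∀ n, ∀ᶠ t in nearZero, t ∈ U n := by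
    intro n
    have h0 : Tendsto (fun t : ℝ => t * n) nearZero (𝓝 (0 * n)) :=
      ((tendsto_id.mono_right nhdsWithin_le_nhds).mono_left nearZero_le).mul_const _
    rw [zero_mul] at h0
    refine (eventually_nearZero_pos.and (h0.eventually_lt_const one_pos)).and ?_
    rw [eventually_all_finset]
    intro i _
    rw [eventually_all_finset]
    intro j _
    by_cases hij : i ≤ j
    · have h1 := eventually_norm_evalPair_sub_le (p := P j) (q := P i) (a := i - 1) (b := i)
        (by linarith) fun k hk => by
          rw [← hP i k hk, ← hP j k (hk.trans_le (by exact_mod_cast hij))]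
      filter_upwards [h1] with t ht _ using ht
    · exact Eventually.of_forall fun t h => absurd h hij
  let b : ℝ → ℕ := fun t => Nat.findGreatest (fun n => t ∈ U n) ⌈1 / t⌉₊
  refine ⟨fun t => (evalPair (P (b t))).1 t, fun N => ?_⟩
  obtain ⟨n, hn⟩ := exists_nat_ge (N + 1)
  refine ⟨P n, ?_, fun i hi => hP n i (by linarith)⟩
  refine IsBigO.trans (IsBigO.of_bound 1 ?_)
    (expPow_isBigO (a := N) (b := (n : ℚ) - 1) (by linarith))
  filter_upwards [hU n] with t ht
  have hle : n ≤ ⌈1 / t⌉₊ := by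
    have h1 : (n : ℝ) ≤ 1 / t := by
      rw [le_div_iff₀ ht.1.1, mul_comm]
      exact ht.1.2.le
    exact_mod_cast h1.trans (Nat.le_ceil _)
  have h1 : n ≤ b t := Nat.le_findGreatest hle ht
  have h2 : t ∈ U (b t) := Nat.findGreatest_spec (P := fun n => t ∈ U n) hle ht
  have h3 := h2.2 n (Finset.mem_range.2 (by omega)) (b t) (Finset.mem_range.2 (by omega)) h1
  rwa [one_mul, Real.norm_of_nonneg (expPow_pos _ _).le]

theorem exists_truncation {y : HahnSeries ℚ 𝕜} (hy : y ∈ puiseuxField 𝕜) (N : ℚ) :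
    ∃ p : AddMonoidAlgebra 𝕜 ℚ, ∀ i < N, y.coeff i = p.coeff i := by
  classical
  obtain ⟨q, hq⟩ := hy
  rw [mem_range_ramify_iff] at hq
  have hq0 : (0 : ℚ) < q := by positivity
  refine ⟨.ofCoeff (Finsupp.onFinset
    ((Finset.Icc ⌊y.order * q⌋ ⌈N * q⌉).image fun a : ℤ => (a : ℚ) / q)
    (fun i => if i < N then y.coeff i else 0) fun i hi => ?_), fun i hi => ?_⟩
  · have hiN : i < N := by
      by_contra h
      exact hi (if_neg h)
    rw [if_pos hiN] at hi
    obtain ⟨a, rfl⟩ := hq i hi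
    have h1 : y.order ≤ a / q := order_le_of_coeff_ne_zero hi
    rw [le_div_iff₀ hq0] at h1
    rw [div_lt_iff₀ hq0] at hiN
    refine Finset.mem_image_of_mem _ (Finset.mem_Icc.2 ⟨?_, ?_⟩)
    · exact_mod_cast (Int.floor_le _).trans h1
    · exact_mod_cast hiN.le.trans (Int.le_ceil _)
  · simp [hi]

theorem exists_asym_of_mem_puiseuxField {y : HahnSeries ℚ 𝕜} (hy : y ∈ puiseuxField 𝕜) :
    ∃ h : ℝ → 𝕜, Asym h y := exists_asym (exists_truncation hy)

theorem Asym.eq_of_asym {h : ℝ → 𝕜} {y z : HahnSeries ℚ 𝕜} (H : Asym h y) (H' : Asym h z) :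
    y = z := by
  rw [← sub_eq_zero]
  have h1 : Asym (h - h) (y - z) := (asymRing 𝕜).sub_mem (x := (h, y)) (y := (h, z)) H H'
  rw [sub_self] at h1
  have h2 := h1.tendsto (a := (y - z).order) fun i hi => coeff_eq_zero_of_lt_order hi
  simp only [Pi.zero_apply, zero_mul] at h2
  exact coeff_order_eq_zero.1 (tendsto_nhds_unique h2 tendsto_const_nhds)

theorem Asym.add {h h' : ℝ → 𝕜} {y y' : HahnSeries ℚ 𝕜} (H : Asym h y) (H' : Asym h' y') :
    Asym (h + h') (y + y') := (asymRing 𝕜).add_mem (x := (h, y)) (y := (h', y')) H H'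

theorem Asym.sub {h h' : ℝ → 𝕜} {y y' : HahnSeries ℚ 𝕜} (H : Asym h y) (H' : Asym h' y') :
    Asym (h - h') (y - y') := (asymRing 𝕜).sub_mem (x := (h, y)) (y := (h', y')) H H'

theorem Asym.sum {ι : Type*} {s : Finset ι} {h : ι → ℝ → 𝕜} {y : ι → HahnSeries ℚ 𝕜}
    (H : ∀ i ∈ s, Asym (h i) (y i)) : Asym (∑ i ∈ s, h i) (∑ i ∈ s, y i) := by
  have := (asymRing 𝕜).sum_mem (f := fun i => (h i, y i)) H
  rwa [mem_asymRing, Prod.fst_sum, Prod.snd_sum] at this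

theorem Asym.mul_right_zero {h f : ℝ → 𝕜} (H : Asym h 0) {a : ℚ} (hf : f =O[nearZero] expPow a) :
    Asym (h * f) 0 := by
  rw [asym_zero_right_iff] at H ⊢
  intro b
  have := expPow_mul_isBigO (H (b - a)) hf
  rwa [sub_add_cancel] at this

theorem isBigO_expPow_pow {f : ℝ → 𝕜} {a : ℚ} (hf : f =O[nearZero] expPow a) (n : ℕ) :
    (f ^ n) =O[nearZero] expPow (n * a) := by
  induction n with
  | zero =>
    refine IsBigO.of_bound 1 (Eventually.of_forall fun t => ?_)
    simp [expPow_zero]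
  | succ n ih =>
    have := expPow_mul_isBigO ih hf
    rw [show ((n + 1 : ℕ) : ℚ) * a = n * a + a by push_cast; ring, pow_succ]
    exact this

theorem not_isBigO_expPow_add_one (a : ℚ) : ¬ expPow a =O[nearZero] expPow (a + 1) := by
  intro h
  have h1 : Tendsto (fun t => expPow a t * expPow (-a) t) nearZero (𝓝 0) := by
    have := (expPow_mul_isBigO (𝕜 := ℝ) h (isBigO_refl (expPow (-a)) nearZero))
    rw [add_neg_cancel_comm] at this
    exact this.trans_tendsto (tendsto_expPow one_pos)
  simp only [expPow_mul_neg] at h1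
  exact one_ne_zero (tendsto_nhds_unique tendsto_const_nhds h1)

/-- Functions smaller than every power behave like a prime ideal: by comparability, two functions
outside it dominate powers of t, and so does their product. -/
theorem asym_mul_zero {f g : ℝ → 𝕜} (h : Asym (f * g) 0) : Asym f 0 ∨ Asym g 0 := by
  rw [asym_zero_right_iff] at h
  rw [asym_zero_right_iff, asym_zero_right_iff]
  by_contra hcon
  push Not at hcon
  obtain ⟨⟨a, ha⟩, b, hb⟩ := hcon
  have h1 := (isBigO_of_not_isBigO ha).mul (isBigO_of_not_isBigO hb)
  have h2 := h1.trans (h (a + b + 1))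
  refine not_isBigO_expPow_add_one (a + b) (h2.congr_left fun t => (expPow_add a b t).symm)

theorem asym_multiset_prod_zero {α : Type*} {s : Multiset α} {f : α → ℝ → 𝕜}
    (h : Asym (s.map f).prod 0) : ∃ a, Asym (f a) 0 := by
  induction s using Multiset.induction_on with
  | empty =>
    exfalso
    rw [Multiset.map_zero, Multiset.prod_zero, asym_zero_right_iff] at h
    refine not_isBigO_expPow_add_one 0 (IsBigO.trans ?_ (h (0 + 1)))
    refine IsBigO.of_bound 1 (Eventually.of_forall fun t => ?_)
    simp [expPow_zero]
  | cons a s ih =>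
    rw [Multiset.map_cons, Multiset.prod_cons] at h
    exact (asym_mul_zero h).elim (fun h => ⟨a, h⟩) ih

theorem evalPair_snd_injective :
    Function.Injective fun p : AddMonoidAlgebra 𝕜 ℚ => (evalPair p).2 := by
  intro p q h
  ext i
  have := congrArg (fun f : HahnSeries ℚ 𝕜 => f.coeff i) h
  simpa only [coeff_evalPair_snd] using this

theorem eq_zero_of_asym_evalPair {p : AddMonoidAlgebra 𝕜 ℚ} (h : Asym (evalPair p).1 0) :
    p = 0 := by
  ext i
  have h1 := coeff_evalPair_snd p i
  rw [(asym_evalPair p).eq_of_asym h, HahnSeries.coeff_zero] at h1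
  rw [← h1, AddMonoidAlgebra.coeff_zero, Finsupp.zero_apply]

open Polynomial

/-- The evaluation of a polynomial in `Y` with coefficients in the ring of finite sums of powers
of `t` at `Y = h t`. -/
def evalAlong (h : ℝ → 𝕜) : (AddMonoidAlgebra 𝕜 ℚ)[X] →+* (ℝ → 𝕜) :=
  eval₂RingHom ((RingHom.fst _ _).comp evalPair) h

/-- Otherwise h dominates every power, so 1/h is smaller than every power. Dividing F(h) = 0 by
h^deg F makes the leading coefficient smaller than every power, hence zero. -/
theorem isBigO_of_evalAlong_eq_zero {F : (AddMonoidAlgebra 𝕜 ℚ)[X]} (hF : F ≠ 0) {h : ℝ → 𝕜}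
    (hroot : ∀ᶠ t in nearZero, evalAlong h F t = 0) : ∃ a, h =O[nearZero] expPow a := by
  by_contra hcon
  push Not at hcon
  have hbig : ∀ a, expPow a =O[nearZero] h := fun a => isBigO_of_not_isBigO (hcon a)
  have hh0 : ∀ᶠ t in nearZero, h t ≠ 0 := by
    obtain ⟨C, hC⟩ := (hbig 0).bound
    filter_upwards [hC] with t ht h0
    rw [h0, norm_zero, mul_zero, Real.norm_of_nonneg (expPow_pos _ _).le] at ht
    exact absurd (expPow_pos 0 t) (not_lt.2 ht)
  have hinv : Asym h⁻¹ 0 := by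
    rw [asym_zero_right_iff]
    intro a
    refine IsBigO.trans (IsBigO.inv_rev (hbig (-a)) (Eventually.of_forall fun t h0 =>
      absurd h0 (expPow_pos _ _).ne')) (IsBigO.of_bound 1 (Eventually.of_forall fun t => ?_))
    rw [eq_inv_of_mul_eq_one_right (expPow_mul_neg a t), inv_inv, one_mul]
  have hlow : ∀ f : AddMonoidAlgebra 𝕜 ℚ, ∃ b, (evalPair f).1 =O[nearZero] expPow b := fun f =>
    ⟨_, (asym_evalPair f).isBigO fun i hi => coeff_eq_zero_of_lt_order hi⟩
  have hpow : ∀ m, 0 < m → Asym (h⁻¹ ^ m) 0 := by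
    intro m hm
    obtain ⟨k, rfl⟩ := Nat.exists_eq_succ_of_ne_zero hm.ne'
    rw [pow_succ']
    exact hinv.mul_right_zero (isBigO_expPow_pow (asym_zero_right_iff.1 hinv 0) k)
  have hsum : Asym (∑ j ∈ Finset.range F.natDegree,
      h⁻¹ ^ (F.natDegree - j) * (evalPair (F.coeff j)).1) (∑ j ∈ Finset.range F.natDegree, 0) :=
    Asym.sum fun j hj => by
      obtain ⟨b, hb⟩ := hlow (F.coeff j)
      exact (hpow _ (by have := Finset.mem_range.1 hj; omega)).mul_right_zero hb
  rw [Finset.sum_const_zero] at hsum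
  have hlead : Asym (-(evalPair F.leadingCoeff).1) 0 := by
    refine hsum.congr ?_
    filter_upwards [hroot, hh0] with t ht h0
    rw [evalAlong, coe_eval₂RingHom, eval₂_eq_sum_range, Finset.sum_apply,
      Finset.sum_range_succ] at ht
    simp only [Pi.mul_apply, Pi.pow_apply, RingHom.comp_apply, RingHom.coe_fst] at ht
    rw [Finset.sum_apply, Pi.neg_apply, eq_neg_iff_add_eq_zero]
    simp only [Pi.mul_apply, Pi.pow_apply, Pi.inv_apply]
    have h1 := congrArg (fun z => (h t)⁻¹ ^ F.natDegree * z) ht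
    simp only [mul_zero, mul_add, Finset.mul_sum] at h1
    rw [← h1]
    congr 1
    · refine Finset.sum_congr rfl fun j hj => ?_
      have hj : j ≤ F.natDegree := (Finset.mem_range.1 hj).le
      have h2 : (h t)⁻¹ ^ j * h t ^ j = 1 := by
        rw [← mul_pow, inv_mul_cancel₀ h0, one_pow]
      have h3 : (h t)⁻¹ ^ F.natDegree = (h t)⁻¹ ^ (F.natDegree - j) * (h t)⁻¹ ^ j := by
        rw [← _root_.pow_add, Nat.sub_add_cancel hj]
      rw [h3, mul_assoc, mul_left_comm ((h t)⁻¹ ^ j), h2, mul_one]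
    · rw [Polynomial.leadingCoeff, mul_left_comm, ← mul_pow, inv_mul_cancel₀ h0, one_pow, mul_one]
  have h1 : Asym ((evalPair F.leadingCoeff).1) 0 := by
    rw [asym_zero_right_iff] at hlead ⊢
    intro a
    simpa using (hlead a).neg_left
  exact hF (Polynomial.leadingCoeff_eq_zero.1 (eq_zero_of_asym_evalPair h1))

theorem evalPair_snd_mem_puiseuxField (p : AddMonoidAlgebra 𝕜 ℚ) :
    (evalPair p).2 ∈ puiseuxField 𝕜 := by
  rw [evalPair_eq_sum, Prod.snd_sum]
  exact sum_mem fun a _ => single_mem_puiseuxField a _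

/-- A function satisfying a polynomial equation over the ring of finite sums of powers of `t` has a
Puiseux expansion. -/
theorem exists_asym_of_evalAlong_eq_zero [IsAlgClosed 𝕜] {F : (AddMonoidAlgebra 𝕜 ℚ)[X]}
    (hF : F ≠ 0) {h : ℝ → 𝕜} (hroot : ∀ᶠ t in nearZero, evalAlong h F t = 0) :
    ∃ y ∈ puiseuxField 𝕜, Asym h y := by
  obtain ⟨a, ha⟩ := isBigO_of_evalAlong_eq_zero hF hroot
  let φ : AddMonoidAlgebra 𝕜 ℚ →+* asymRing 𝕜 := evalPair.codRestrict _ asym_evalPair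
  let ι : AddMonoidAlgebra 𝕜 ℚ →+* puiseuxField 𝕜 :=
    ((RingHom.snd _ _).comp evalPair).codRestrict _ evalPair_snd_mem_puiseuxField
  let π₁ : asymRing 𝕜 →+* (ℝ → 𝕜) := (RingHom.fst _ _).comp (asymRing 𝕜).subtype
  let π₂ : asymRing 𝕜 →+* HahnSeries ℚ 𝕜 := (RingHom.snd _ _).comp (asymRing 𝕜).subtype
  have hιinj : Function.Injective ι := fun p q h => evalPair_snd_injective (congrArg Subtype.val h)
  have hγ : ∀ y : puiseuxField 𝕜, ∃ g : asymRing 𝕜, π₂ g = y := fun y => by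
    obtain ⟨h, hh⟩ := exists_asym_of_mem_puiseuxField y.2
    exact ⟨⟨(h, y), hh⟩, rfl⟩
  choose γ hγ using hγ
  -- F splits over the Puiseux field. Lifting its roots y to functions g_y gives G = lead · ∏ (Y -
  -- g_y), whose coefficients differ from those of F by functions smaller than every power. As h has
  -- power growth, G(h) is equally small, hence so is some factor h - g_y, and y expands h.
  set s := (F.map ι).roots
  let G : (asymRing 𝕜)[X]   := Polynomial.C (φ F.leadingCoeff) * (s.map fun y => X - Polynomial.C (γ y)).prod
  have hG : G.map π₂ = (F.map φ).map π₂ := by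
    have h1 : (F.map φ).map π₂ = (F.map ι).map (puiseuxField 𝕜).subtype := by
      rw [Polynomial.map_map, Polynomial.map_map]
      rfl
    rw [h1, (IsAlgClosed.splits (F.map ι)).eq_prod_roots, leadingCoeff_map_of_injective hιinj]
    simp only [G, Polynomial.map_mul, Polynomial.map_C, Polynomial.map_multiset_prod,
      Multiset.map_map]
    congr 2
    refine Multiset.map_congr rfl fun y _ => ?_
    simp [hγ]
  have hD : ∀ j, Asym (((F.map φ - G).map π₁).coeff j) 0 := by
    intro j
    have h1 := ((F.map φ - G).coeff j).2
    have h2 : π₂ ((F.map φ - G).coeff j) = 0 := by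
      rw [← coeff_map, Polynomial.map_sub, hG, sub_self, Polynomial.coeff_zero]
    rw [mem_asymRing] at h1
    change ((F.map φ - G).coeff j).1.2 = 0 at h2
    rw [h2] at h1
    rw [coeff_map]
    exact h1
  have hE : Asym (((F.map φ - G).map π₁).eval h) 0 := by
    rw [eval_eq_sum_range]
    have := Asym.sum (s := Finset.range (((F.map φ - G).map π₁).natDegree + 1)) fun j _ =>
      (hD j).mul_right_zero (isBigO_expPow_pow ha j)
    rwa [Finset.sum_const_zero] at this
  have hF' : ((F.map φ).map π₁).eval h = evalAlong h F := by
    rw [Polynomial.map_map, eval_map]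
    rfl
  rw [Polynomial.map_sub, eval_sub, hF'] at hE
  have hG0 : Asym (-(G.map π₁).eval h) 0 := by
    refine hE.congr ?_
    filter_upwards [hroot] with t ht
    simp [ht]
  have hG1 : Asym ((G.map π₁).eval h) 0 := by
    rw [asym_zero_right_iff] at hG0 ⊢
    intro a
    simpa using (hG0 a).neg_left
  have hG2 : (G.map π₁).eval h
      = (evalPair F.leadingCoeff).1 * (s.map fun y => h - π₁ (γ y)).prod := by
    simp only [G, Polynomial.map_mul, Polynomial.map_C, Polynomial.map_multiset_prod,
      Multiset.map_map, eval_mul, Polynomial.eval_C, eval_multiset_prod]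
    congr 2
    refine Multiset.map_congr rfl fun y _ => ?_
    simp
  rw [hG2] at hG1
  rcases asym_mul_zero hG1 with h1 | h1
  · exact absurd (Polynomial.leadingCoeff_eq_zero.1 (eq_zero_of_asym_evalPair h1)) hF
  · obtain ⟨y, h0⟩ := asym_multiset_prod_zero h1
    have h3 : Asym (π₁ (γ y)) (π₂ (γ y)) := (γ y).2
    rw [hγ] at h3
    refine ⟨y, y.2, ?_⟩
    have h4 := h0.add h3
    rwa [sub_add_cancel, zero_add] at h4

end Asymptotic

/-! ### Real algebraic functions -/

section RealExpansion

open Filter Topology Asymptotics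

theorem re_evalPair (p : AddMonoidAlgebra ℂ ℚ) (t : ℝ) :
    ((evalPair p).1 t).re
      = (evalPair (𝕜 := ℝ) (.ofCoeff (p.coeff.mapRange Complex.re Complex.zero_re))).1 t := by
  rw [evalPair_fst, evalPair_fst, Complex.re_sum]
  symm
  refine (Finset.sum_subset (fun a ha => ?_) fun a _ ha => ?_).trans
    (Finset.sum_congr rfl fun a _ => ?_)
  · rw [Finsupp.mem_support_iff] at ha ⊢
    intro h
    apply ha
    rw [Finsupp.mapRange_apply, h, Complex.zero_re]
  · rw [Finsupp.notMem_support_iff.1 ha, zero_mul]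
  · rw [Finsupp.mapRange_apply]
    exact (Complex.re_mul_ofReal _ _).symm

theorem Asym.re {h : ℝ → ℝ} {y : HahnSeries ℚ ℂ} (H : Asym (fun t => (h t : ℂ)) y) :
    Asym h (y.map Complex.reAddGroupHom) := by
  intro N
  obtain ⟨p, hp, hy⟩ := H N
  refine ⟨.ofCoeff (p.coeff.mapRange Complex.re Complex.zero_re), ?_, fun i hi => ?_⟩
  · refine IsBigO.trans (IsBigO.of_bound 1 (Eventually.of_forall fun t => ?_)) hp
    rw [← re_evalPair, one_mul]
    refine le_trans (le_of_eq ?_) (Complex.abs_re_le_norm _)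
    rw [Complex.sub_re, Complex.ofReal_re, Real.norm_eq_abs]
  · change (y.coeff i).re = _
    rw [hy i hi]
    rfl

theorem map_re_mem_puiseuxField {y : HahnSeries ℚ ℂ} (hy : y ∈ puiseuxField ℂ) :
    y.map Complex.reAddGroupHom ∈ puiseuxField ℝ := by
  obtain ⟨q, hq⟩ := hy
  refine ⟨q, ?_⟩
  rw [mem_range_ramify_iff] at hq ⊢
  intro i hi
  refine hq i fun h => hi ?_
  change (y.coeff i).re = 0
  rw [h, Complex.zero_re]

theorem evalAlong_apply {𝕜 : Type*} [RCLike 𝕜] (h : ℝ → 𝕜) (t : ℝ) :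
    ((Pi.evalRingHom (fun _ : ℝ => 𝕜) t).comp (evalAlong h)).comp Polynomial.C
      = (Pi.evalRingHom (fun _ : ℝ => 𝕜) t).comp ((RingHom.fst _ _).comp evalPair) := by
  refine RingHom.ext fun p => ?_
  simp [evalAlong]

/-- A polynomial in `t` and `Y` as a polynomial in `Y` over the ring of sums of powers of `t`. -/
def toPolynomial : MvPolynomial (Fin 2) ℝ →+* Polynomial (AddMonoidAlgebra ℂ ℚ) :=
  MvPolynomial.eval₂Hom
    (Polynomial.C.comp (AddMonoidAlgebra.singleZeroRingHom.comp Complex.ofRealHom))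
    ![Polynomial.C (AddMonoidAlgebra.single 1 1), Polynomial.X]

theorem evalAlong_toPolynomial (h : ℝ → ℝ) (q : MvPolynomial (Fin 2) ℝ) {t : ℝ} (ht : 0 < t) :
    evalAlong (fun t => (h t : ℂ)) (toPolynomial q) t = (MvPolynomial.eval ![t, h t] q : ℂ) := by
  have key : ((Pi.evalRingHom (fun _ : ℝ => ℂ) t).comp (evalAlong fun t => (h t : ℂ))).comp
      toPolynomial = Complex.ofRealHom.comp (MvPolynomial.eval ![t, h t]) := by
    refine MvPolynomial.ringHom_ext (fun r => ?_) fun i => ?_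
    · have := congrArg (fun f => f (AddMonoidAlgebra.single (0 : ℚ) (r : ℂ)))
        (evalAlong_apply (fun t => (h t : ℂ)) t)
      simp only [RingHom.comp_apply, Pi.evalRingHom_apply, RingHom.coe_fst, evalPair_single] at this
      simp only [RingHom.comp_apply, Pi.evalRingHom_apply, toPolynomial, MvPolynomial.eval₂Hom_C,
        MvPolynomial.eval_C]
      refine this.trans ?_
      simp [expPow_zero]
    · fin_cases i
      · have := congrArg (fun f => f (AddMonoidAlgebra.single (1 : ℚ) (1 : ℂ)))
          (evalAlong_apply (fun t => (h t : ℂ)) t)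
        simp only [RingHom.comp_apply, Pi.evalRingHom_apply, RingHom.coe_fst, evalPair_single]
          at this
        simp only [RingHom.comp_apply, Pi.evalRingHom_apply, toPolynomial, MvPolynomial.eval₂Hom_X',
          MvPolynomial.eval_X]
        refine this.trans ?_
        simp [expPow_one ht]
      · simp [toPolynomial, evalAlong]
  exact congrArg (fun f => f q) key

theorem toPolynomial_ne_zero {q : MvPolynomial (Fin 2) ℝ} (hq : q ≠ 0) : toPolynomial q ≠ 0 := by
  intro h0
  apply hq
  refine MvPolynomial.funext_set (fun _ : Fin 2 => Set.Ioi (0 : ℝ)) (fun _ => Set.Ioi_infinite 0)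
    fun x hx => ?_
  have h1 := evalAlong_toPolynomial (fun _ => x 1) q (t := x 0) (hx 0 (Set.mem_univ _))
  rw [h0, map_zero, Pi.zero_apply] at h1
  have h2 : ![x 0, x 1] = x := by
    ext i
    fin_cases i <;> rfl
  rw [h2] at h1
  rw [map_zero]
  exact_mod_cast h1.symm

/-- The roots are found over ℂ; real parts of an expansion of a real function expand the same
function. -/
theorem exists_asym_of_mvPolynomial {q : MvPolynomial (Fin 2) ℝ} (hq : q ≠ 0) {h : ℝ → ℝ}
    (hroot : ∀ᶠ t in nearZero, MvPolynomial.eval ![t, h t] q = 0) :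
    ∃ y ∈ puiseuxField ℝ, Asym h y := by
  obtain ⟨y, hy, hhy⟩ := exists_asym_of_evalAlong_eq_zero (toPolynomial_ne_zero hq)
    (h := fun t => (h t : ℂ)) (by
      filter_upwards [hroot, eventually_nearZero_pos] with t ht ht0
      rw [evalAlong_toPolynomial h q ht0, ht, Complex.ofReal_zero])
  exact ⟨_, map_re_mem_puiseuxField hy, hhy.re⟩

end RealExpansion

/-! ### Order and boundedness of Puiseux series through expansions -/

namespace Puiseux

open Filter Topology Asymptotics

/-- The underlying Hahn series of a Puiseux series. -/
def toHahn : Puiseux →+* HahnSeries ℚ ℝ where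
  toFun z := ofLex z.1
  map_one' := rfl
  map_mul' _ _ := rfl
  map_zero' := rfl
  map_add' _ _ := rfl

theorem isPuiseux_iff {f : HahnSeries ℚ ℝ} : IsPuiseux f ↔ f ∈ puiseuxField ℝ := by
  constructor
  · rintro ⟨q, hq, h⟩
    exact ⟨⟨q, hq⟩, (mem_range_ramify_iff _ _).2 h⟩
  · rintro ⟨q, h⟩
    exact ⟨q, q.pos, (mem_range_ramify_iff _ _).1 h⟩

theorem toHahn_mem (z : Puiseux) : toHahn z ∈ puiseuxField ℝ := isPuiseux_iff.1 z.2

theorem exists_toHahn_eq {f : HahnSeries ℚ ℝ} (hf : f ∈ puiseuxField ℝ) : ∃ z, toHahn z = f :=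
  ⟨⟨toLex f, isPuiseux_iff.2 hf⟩, rfl⟩

theorem coeff_toHahn (z : Puiseux) (i : ℚ) : (toHahn z).coeff i = z.coeff i := rfl

theorem coeff_neg (z : Puiseux) (i : ℚ) : (-z).coeff i = -z.coeff i := rfl

theorem pos_iff {z : Puiseux} : 0 < z ↔ ∃ i, (∀ j < i, z.coeff j = 0) ∧ 0 < z.coeff i := by
  change (0 : Lex (HahnSeries ℚ ℝ)) < z.1 ↔ _
  rw [HahnSeries.lt_iff]
  constructor
  · rintro ⟨i, h, h'⟩
    exact ⟨i, fun j hj => (h j hj).symm, h'⟩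
  · rintro ⟨i, h, h'⟩
    exact ⟨i, fun j hj => (h j hj).symm, h'⟩

/-- `z` is the asymptotic expansion of the function `h`. -/
def Expands (h : ℝ → ℝ) (z : Puiseux) : Prop := Asym h (toHahn z)

theorem exists_expands (z : Puiseux) : ∃ h, Expands h z :=
  exists_asym_of_mem_puiseuxField (toHahn_mem z)

namespace Expands

variable {h h' : ℝ → ℝ} {z z' : Puiseux}

theorem add (H : Expands h z) (H' : Expands h' z') : Expands (h + h') (z + z') := Asym.add H H'

theorem sub (H : Expands h z) (H' : Expands h' z') : Expands (h - h') (z - z') := Asym.sub H H'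

theorem mul (H : Expands h z) (H' : Expands h' z') : Expands (h * h') (z * z') := Asym.mul H H'

theorem sum {ι : Type*} {s : Finset ι} {h : ι → ℝ → ℝ} {z : ι → Puiseux}
    (H : ∀ i ∈ s, Expands (h i) (z i)) : Expands (∑ i ∈ s, h i) (∑ i ∈ s, z i) := by
  rw [Expands, map_sum]
  exact Asym.sum H

theorem tendsto (H : Expands h z) {a : ℚ} (ha : ∀ i < a, z.coeff i = 0) :
    Tendsto (fun t => h t * expPow (-a) t) nearZero (𝓝 (z.coeff a)) := by
  rw [← coeff_toHahn]
  exact Asym.tendsto H ha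

theorem exists_isBigO (H : Expands h z) : ∃ a, h =O[nearZero] expPow a :=
  ⟨_, Asym.isBigO H fun _ hi => coeff_eq_zero_of_lt_order hi⟩

theorem const (r : ℝ) : Expands (fun _ => r) (Puiseux.const r) := by
  have := asym_evalPair (AddMonoidAlgebra.single (0 : ℚ) r)
  rw [evalPair_single] at this
  simp only [expPow_zero, RCLike.ofReal_one, mul_one] at this
  exact this

theorem eps : Expands (fun t => t) eps := by
  have := asym_evalPair (AddMonoidAlgebra.single (1 : ℚ) (1 : ℝ))
  rw [evalPair_single] at this
  refine Asym.congr this ?_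
  filter_upwards [eventually_nearZero_pos] with t ht
  rw [expPow_one ht, one_mul]
  rfl

theorem eventually_pos (H : Expands h z) (hz : 0 < z) : ∀ᶠ t in nearZero, 0 < h t := by
  obtain ⟨i, hi, hpos⟩ := pos_iff.1 hz
  filter_upwards [(H.tendsto hi).eventually_const_lt hpos] with t ht
  exact pos_of_mul_pos_left ht (expPow_pos _ _).le

/-- A series is nonnegative if its function is, up to errors of arbitrarily high order. -/
theorem nonneg_of_eventually (H : Expands h z)
    (hg : ∀ a, ∃ g, g =O[nearZero] expPow a ∧ ∀ᶠ t in nearZero, 0 ≤ h t + g t) : 0 ≤ z := by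
  by_contra hz
  obtain ⟨i, hi, hpos⟩ := pos_iff.1 (neg_pos.2 (not_le.1 hz))
  rw [coeff_neg] at hpos
  have h1 := H.tendsto (a := i) fun j hj => by simpa [coeff_neg] using hi j hj
  obtain ⟨g, hg, hgh⟩ := hg (i + 1)
  have h2 := expPow_mul_isBigO (𝕜 := ℝ) hg (isBigO_refl (expPow (-i)) nearZero)
  rw [add_neg_cancel_comm] at h2
  have h3 := h1.add (h2.trans_tendsto (tendsto_expPow one_pos))
  rw [add_zero] at h3
  have h4 : 0 ≤ z.coeff i := by
    refine ge_of_tendsto h3 ?_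
    filter_upwards [hgh] with t ht
    rw [← add_mul]
    exact mul_nonneg ht (expPow_pos _ _).le
  linarith

theorem nonneg (H : Expands h z) (hh : ∀ᶠ t in nearZero, 0 ≤ h t) : 0 ≤ z :=
  H.nonneg_of_eventually fun _ => ⟨0, isBigO_zero _ _, by simpa using hh⟩

theorem tendsto_limEps (H : Expands h z) (hz : z.IsBounded) :
    Tendsto h nearZero (𝓝 z.limEps) := by
  have := H.tendsto hz
  simp only [neg_zero, expPow_zero, mul_one] at this
  exact this

end Expands

theorem exists_expands_nonneg {z : Puiseux} (hz : 0 ≤ z) : ∃ h, Expands h z ∧ ∀ t, 0 ≤ h t := by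
  rcases hz.eq_or_lt with rfl | hz
  · exact ⟨fun _ => 0, by simpa using Expands.const 0, fun _ => le_rfl⟩
  · obtain ⟨h, hh⟩ := exists_expands z
    refine ⟨fun t => max (h t) 0, Asym.congr hh ?_, fun t => le_max_right _ _⟩
    filter_upwards [hh.eventually_pos hz] with t ht
    rw [max_eq_left ht.le]

theorem const_le_const {a b : ℝ} (h : a ≤ b) : const a ≤ const b := by
  rw [← sub_nonneg, ← map_sub]
  exact (Expands.const _).nonneg (Eventually.of_forall fun _ => sub_nonneg.2 h)

theorem const_lt_const {a b : ℝ} (h : a < b) : const a < const b :=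
  lt_of_le_of_ne (const_le_const h.le) fun h0 => h.ne (const.injective h0)

/-- If the order of z were negative, h(t) t^(-ord z) would tend to the nonzero leading coefficient,
yet h is eventually bounded and so the product tends to 0. -/
theorem isBounded_of_abs_le {z : Puiseux} {C : ℝ} (h1 : z ≤ const C) (h2 : -const C ≤ z) :
    z.IsBounded := by
  intro i hi
  by_contra hne
  have hord : (toHahn z).order < 0 := (order_le_of_coeff_ne_zero hne).trans_lt hi
  have hne' : z.coeff (toHahn z).order ≠ 0 := fun h0 => by
    have h3 : toHahn z = 0 := coeff_order_eq_zero.1 h0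
    apply hne
    rw [← coeff_toHahn, h3]
    rfl
  obtain ⟨h, hh⟩ := exists_expands z
  have hlim := hh.tendsto (a := (toHahn z).order) fun j hj => coeff_eq_zero_of_lt_order hj
  have hup : ∀ᶠ t in nearZero, h t ≤ C + 1 := by
    have h3 : 0 < const (C + 1) - z := sub_pos.2 (h1.trans_lt (const_lt_const (by linarith)))
    filter_upwards [((Expands.const (C + 1)).sub hh).eventually_pos h3] with t ht
    exact (sub_pos.1 ht).le
  have hlo : ∀ᶠ t in nearZero, -(C + 1) ≤ h t := by
    have h3 : 0 < z - const (-(C + 1)) := by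
      refine sub_pos.2 (lt_of_lt_of_le (const_lt_const ?_) ((map_neg const C).trans_le h2))
      linarith
    filter_upwards [(hh.sub (Expands.const (-(C + 1)))).eventually_pos h3] with t ht
    exact (sub_pos.1 ht).le
  have hO : h =O[nearZero] fun _ => (1 : ℝ) := by
    refine IsBigO.of_bound (C + 1) ?_
    filter_upwards [hup, hlo] with t h3 h4
    rw [norm_one, mul_one]
    exact abs_le.2 ⟨h4, h3⟩
  have h5 := (hO.mul (isBigO_refl (expPow (-(toHahn z).order)) nearZero)).trans_tendsto
    (by simpa using tendsto_expPow (a := -(toHahn z).order) (by linarith))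
  exact hne' (tendsto_nhds_unique hlim h5)

end Puiseux

/-! ### Transfer between S(A + tB) and S(A + εB) -/

section Transfer

open Filter Topology Asymptotics

variable {m n : ℕ}

theorem dotProduct_mulVec_eq_sum {K : Type*} [Field K] (M : Matrix (Fin m) (Fin m) K)
    (v : Fin m → K) :
    v ⬝ᵥ M.mulVec v = ∑ i, v i * ∑ j, M i j * v j := rfl

section Diagonal

variable {K : Type*} [Field K] [LinearOrder K] [IsStrictOrderedRing K]

/-- An orthogonal basis for the form diagonalizes it without square roots. The resulting data can be
lifted entry by entry to functions while preserving semidefiniteness. -/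
theorem IsPSD.exists_diagonal {M : Matrix (Fin m) (Fin m) K} (hM : IsPSD M) :
    ∃ (k : ℕ) (P : Fin k → Fin m → K) (d : Fin k → K), (∀ a, 0 ≤ d a) ∧
      ∀ i j, M i j = ∑ a, d a * (P a i * P a j) := by
  have : Invertible (2 : K) := invertibleOfNonzero two_ne_zero
  let B := Matrix.toBilin' M
  have hB : ∀ x y, B x y = x ⬝ᵥ M.mulVec y := Matrix.toBilin'_apply' M
  have hsymm : B.IsSymm := ⟨fun x y => by
    rw [hB, hB, Matrix.dotProduct_mulVec, ← Matrix.mulVec_transpose, hM.1,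
      dotProduct_comm]⟩
  obtain ⟨v, hv⟩ := LinearMap.BilinForm.exists_orthogonal_basis
    (LinearMap.BilinForm.isSymm_iff.1 hsymm)
  refine ⟨_, fun a i => v.repr (Pi.single i 1) a, fun a => B (v a) (v a), fun a => ?_,
    fun i j => ?_⟩
  · exact (hM.2 (v a)).trans_eq (hB _ _).symm
  · have h1 : M i j = B (Pi.single i 1) (Pi.single j 1) := by
      rw [hB, single_one_dotProduct, Matrix.mulVec_single_one]
      rfl
    rw [h1]
    conv_lhs => rw [← v.sum_repr (Pi.single i 1), ← v.sum_repr (Pi.single j 1)]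
    simp only [map_sum, LinearMap.sum_apply, map_smul, LinearMap.smul_apply, smul_eq_mul]
    refine Finset.sum_congr rfl fun a _ => ?_
    rw [Finset.sum_eq_single a]
    · ring
    · intro b _ hb
      have : B (v b) (v a) = 0 := hv hb
      rw [this, mul_zero]
    · simp

theorem isPSD_sum_diagonal {k : ℕ} (P : Fin k → Fin m → K) {d : Fin k → K} (hd : ∀ a, 0 ≤ d a) :
    IsPSD (Matrix.of fun i j => ∑ a, d a * (P a i * P a j)) := by
  constructor
  · ext i j
    simp only [Matrix.transpose_apply, Matrix.of_apply]
    exact Finset.sum_congr rfl fun a _ => by rw [mul_comm (P a j)]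
  · intro v
    have h : v ⬝ᵥ (Matrix.of fun i j => ∑ a, d a * (P a i * P a j)).mulVec v
        = ∑ a, d a * ((∑ i, P a i * v i) * ∑ i, P a i * v i) := by
      rw [dotProduct_mulVec_eq_sum]
      simp only [Matrix.of_apply, Finset.sum_mul, Finset.mul_sum]
      conv_rhs => rw [Finset.sum_comm]; enter [2, x]; rw [Finset.sum_comm]
      refine Finset.sum_congr rfl fun i _ => Finset.sum_congr rfl fun j _ =>
        Finset.sum_congr rfl fun a _ => by ring
    rw [h]
    exact Finset.sum_nonneg fun a _ => mul_nonneg (hd a) (mul_self_nonneg _)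

theorem neg_mul_le_dotProduct_mulVec {E : Matrix (Fin m) (Fin m) K} {η : K} (hη : 0 < η)
    (hE : ∑ i, ∑ j, E i j ^ 2 ≤ η ^ 2) (v : Fin m → K) : -(η * (v ⬝ᵥ v)) ≤ v ⬝ᵥ E.mulVec v := by
  have h1 := (mulVec_dotProduct_self_le E v).trans
    (mul_le_mul_of_nonneg_right hE (dotProduct_self_nonneg' v))
  have h2 := dotProduct_self_nonneg' (E.mulVec v + η • v)
  simp only [add_dotProduct, dotProduct_add, smul_dotProduct, dotProduct_smul, smul_eq_mul] at h2
  rw [dotProduct_comm (E.mulVec v) v] at h2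
  have h3 : 0 ≤ η * (2 * (η * (v ⬝ᵥ v) + v ⬝ᵥ E.mulVec v)) := by linarith
  have h4 := nonneg_of_mul_nonneg_right h3 hη
  linarith

end Diagonal

/-- With Y² = B one has v = (B⁻¹Y)(Yv), so |v|² ≤ C|Yv|² = C vᵀBv. -/
theorem Matrix.PosDef.exists_mul_dotProduct_le {B : Matrix (Fin m) (Fin m) ℝ} (hB : B.PosDef) :
    ∃ b : ℝ, 0 < b ∧ ∀ v, b * (v ⬝ᵥ v) ≤ v ⬝ᵥ B.mulVec v := by
  obtain ⟨Y, hY, hYB⟩ := (posSemidef_iff_isPSD.1 hB.posSemidef).exists_sqrt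
  have hu : IsUnit B.det := hB.det_pos.ne'.isUnit
  have hY1 : B⁻¹ * Y * Y = 1 := by rw [mul_assoc, hYB, Matrix.nonsing_inv_mul B hu]
  set C := ∑ i, ∑ j, (B⁻¹ * Y) i j ^ 2
  have hC : 0 ≤ C := Finset.sum_nonneg fun i _ => Finset.sum_nonneg fun j _ => sq_nonneg _
  refine ⟨1 / (C + 1), by positivity, fun v => ?_⟩
  have h1 := mulVec_dotProduct_self_le (B⁻¹ * Y) (Y.mulVec v)
  rw [Matrix.mulVec_mulVec, hY1, Matrix.one_mulVec, ← dotProduct_mul_mulVec hY, hYB] at h1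
  have h2 : 0 ≤ v ⬝ᵥ B.mulVec v := (posSemidef_iff_isPSD.1 hB.posSemidef).2 v
  rw [div_mul_eq_mul_div, one_mul, div_le_iff₀ (by positivity)]
  change v ⬝ᵥ v ≤ C * _ at h1
  linarith

open Puiseux

/-- A positive semidefinite matrix of Puiseux series is, up to errors of arbitrarily high order,
the expansion of positive semidefinite matrices. -/
theorem eventually_isPSD_add_expPow_smul {M : ℝ → Matrix (Fin m) (Fin m) ℝ}
    {N : Matrix (Fin m) (Fin m) Puiseux} (hM : ∀ t, (M t).transpose = M t)
    (hMN : ∀ i j, Expands (fun t => M t i j) (N i j)) (hN : IsPSD N)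
    {B : Matrix (Fin m) (Fin m) ℝ} (hB : B.PosDef) (a : ℚ) :
    ∀ᶠ t in nearZero, IsPSD (M t + expPow a t • B) := by
  obtain ⟨b, hb, hbB⟩ := hB.exists_mul_dotProduct_le
  obtain ⟨k, P, d, hd, hNd⟩ := hN.exists_diagonal
  choose p hp using fun a i => exists_expands (P a i)
  choose e he he0 using fun a => exists_expands_nonneg (hd a)
  -- L(t) is semidefinite by construction and expands N as well, so M - L is smaller than every
  -- power and t^a B absorbs it.
  let L : ℝ → Matrix (Fin m) (Fin m) ℝ := fun t =>
    Matrix.of fun i j => ∑ a, e a t * (p a i t * p a j t)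
  have hL : ∀ t, IsPSD (L t) := fun t =>
    isPSD_sum_diagonal (fun a i => p a i t) fun a => he0 a t
  have hE : ∀ i j, Expands (fun t => (M t - L t) i j) 0 := by
    intro i j
    have h1 : Expands (∑ a, e a * (p a i * p a j)) (∑ a, d a * (P a i * P a j)) :=
      Expands.sum fun a _ => (he a).mul ((hp a i).mul (hp a j))
    have h2 := (hMN i j).sub h1
    rw [← hNd, sub_self] at h2
    convert h2 using 1
    funext t
    simp [L]
  have hS : Expands (∑ i, ∑ j, (fun t => (M t - L t) i j) * fun t => (M t - L t) i j) 0 := by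
    have := Expands.sum (s := (Finset.univ : Finset (Fin m))) fun i _ =>
      Expands.sum (s := (Finset.univ : Finset (Fin m))) fun j _ => (hE i j).mul (hE i j)
    simpa using this
  have hO := (asym_zero_right_iff.1 (by simpa [Expands] using hS) (2 * a + 1)).trans_isLittleO
    (expPow_isLittleO (a := 2 * a) (by linarith))
  filter_upwards [hO.bound (show 0 < b ^ 2 by positivity)] with t ht
  have hη : ∑ i, ∑ j, (M t - L t) i j ^ 2 ≤ (b * expPow a t) ^ 2 := by
    rw [Real.norm_of_nonneg (expPow_pos _ _).le, two_mul, expPow_add] at ht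
    refine le_trans (le_of_eq ?_) ((le_abs_self _).trans (ht.trans (le_of_eq ?_)))
    · simp only [Finset.sum_apply, Pi.mul_apply, sq, Matrix.sub_apply]
    · ring
  have hBt : B.transpose = B := (posSemidef_iff_isPSD.1 hB.posSemidef).1
  refine ⟨by rw [Matrix.transpose_add, Matrix.transpose_smul, hM, hBt], fun v => ?_⟩
  have h1 := neg_mul_le_dotProduct_mulVec (mul_pos hb (expPow_pos a t)) hη v
  have h2 := (hL t).2 v
  have h3 : 0 ≤ expPow a t * (v ⬝ᵥ B.mulVec v - b * (v ⬝ᵥ v)) :=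
    mul_nonneg (expPow_pos a t).le (sub_nonneg.2 (hbB v))
  rw [Matrix.sub_mulVec, dotProduct_sub] at h1
  rw [Matrix.add_mulVec, dotProduct_add, Matrix.smul_mulVec, dotProduct_smul, smul_eq_mul]
  linarith

theorem isPSD_of_expands {M : ℝ → Matrix (Fin m) (Fin m) ℝ}
    {N : Matrix (Fin m) (Fin m) Puiseux} (hMN : ∀ i j, Expands (fun t => M t i j) (N i j))
    (hN : N.transpose = N) (hM : ∀ᶠ t in nearZero, IsPSD (M t)) : IsPSD N := by
  refine ⟨hN, fun v => ?_⟩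
  choose w hw using fun i => exists_expands (v i)
  have h : Expands (∑ i, w i * ∑ j, (fun t => M t i j) * w j) (v ⬝ᵥ N.mulVec v) :=
    Expands.sum fun i _ => (hw i).mul (Expands.sum fun j _ => (hMN i j).mul (hw j))
  refine h.nonneg ?_
  filter_upwards [hM] with t ht
  have := ht.2 fun i => w i t
  rw [dotProduct_mulVec_eq_sum] at this
  simpa using this

variable {A₀ B : Matrix (Fin m) (Fin m) ℝ} {A : Fin n → Matrix (Fin m) (Fin m) ℝ}

theorem mem_perturbedSpectrahedron {y : Fin n → Puiseux} : y ∈ perturbedSpectrahedron A₀ A B ↔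
    IsPSD (pencil (A₀.map Puiseux.const + Puiseux.eps • B.map Puiseux.const)
      (fun i => (A i).map Puiseux.const) y) := posSemidef_iff_isPSD

theorem mem_spectrahedron_iff {x : Fin n → ℝ} :
    x ∈ spectrahedron A₀ A ↔ IsPSD (pencil A₀ A x) := posSemidef_iff_isPSD

theorem expands_pencil {y : Fin n → Puiseux} {x : ℝ → Fin n → ℝ}
    (hxy : ∀ k, Expands (fun t => x t k) (y k)) (i j : Fin m) :
    Expands (fun t => pencil (A₀ + t • B) A (x t) i j)
      (pencil (A₀.map Puiseux.const + Puiseux.eps • B.map Puiseux.const)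
        (fun i => (A i).map Puiseux.const) y i j) := by
  have h := ((Expands.const (A₀ i j)).add (Expands.eps.mul (Expands.const (B i j)))).add
    (Expands.sum (s := Finset.univ) fun k _ => (hxy k).mul (Expands.const (A k i j)))
  have h1 : pencil (A₀.map Puiseux.const + Puiseux.eps • B.map Puiseux.const)
      (fun i => (A i).map Puiseux.const) y i j = Puiseux.const (A₀ i j) +
        Puiseux.eps * Puiseux.const (B i j) + ∑ k, y k * Puiseux.const (A k i j) := by
    simp [pencil, Matrix.sum_apply]
  rw [h1]
  convert h using 1
  funext t
  simp [pencil, Matrix.sum_apply]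

theorem pencil_map_transpose (hA₀ : A₀.transpose = A₀) (hB : B.transpose = B)
    (hA : ∀ i, (A i).transpose = A i) (y : Fin n → Puiseux) :
    (pencil (A₀.map Puiseux.const + Puiseux.eps • B.map Puiseux.const)
      (fun i => (A i).map Puiseux.const) y).transpose =
    pencil (A₀.map Puiseux.const + Puiseux.eps • B.map Puiseux.const)
      (fun i => (A i).map Puiseux.const) y := by
  apply pencil_transpose
  · rw [Matrix.transpose_add, Matrix.transpose_smul, ← Matrix.transpose_map,
      ← Matrix.transpose_map, hA₀, hB]
  · intro i
    rw [← Matrix.transpose_map, hA]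

theorem mem_perturbedSpectrahedron_of_expands (hA₀ : A₀.transpose = A₀) (hB : B.transpose = B)
    (hA : ∀ i, (A i).transpose = A i) {y : Fin n → Puiseux} {x : ℝ → Fin n → ℝ}
    (hxy : ∀ k, Expands (fun t => x t k) (y k))
    (hx : ∀ᶠ t in nearZero, IsPSD (pencil (A₀ + t • B) A (x t))) :
    y ∈ perturbedSpectrahedron A₀ A B :=
  mem_perturbedSpectrahedron.2 (isPSD_of_expands (expands_pencil hxy)
    (pencil_map_transpose hA₀ hB hA y) hx)

theorem eventually_isPSD_of_mem_perturbedSpectrahedron (hA₀ : A₀.transpose = A₀) (hB : B.PosDef)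
    (hA : ∀ i, (A i).transpose = A i) {y : Fin n → Puiseux} {x : ℝ → Fin n → ℝ}
    (hxy : ∀ k, Expands (fun t => x t k) (y k)) (hy : y ∈ perturbedSpectrahedron A₀ A B) (a : ℚ) :
    ∀ᶠ t in nearZero, IsPSD (pencil (A₀ + (t + expPow a t) • B) A (x t)) := by
  have hBt : B.transpose = B := (posSemidef_iff_isPSD.1 hB.posSemidef).1
  have h := eventually_isPSD_add_expPow_smul
    (M := fun t => pencil (A₀ + t • B) A (x t)) (fun t => pencil_transpose
      (by rw [Matrix.transpose_add, Matrix.transpose_smul, hA₀, hBt]) hA _) (expands_pencil hxy)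
    (mem_perturbedSpectrahedron.1 hy) hB a
  filter_upwards [h] with t ht
  convert ht using 1
  simp only [pencil, add_smul]
  abel

theorem expands_linForm (l : Fin n → ℝ) {y : Fin n → Puiseux} {x : ℝ → Fin n → ℝ}
    (hxy : ∀ k, Expands (fun t => x t k) (y k)) :
    Expands (fun t => linForm l (x t)) (linFormEps l y) := by
  have := Expands.sum (s := Finset.univ) fun k _ => (Expands.const (l k)).mul (hxy k)
  have h : (fun t => linForm l (x t)) = ∑ k, (fun _ => l k) * fun t => x t k := by
    funext t
    simp [linForm]
  rw [h]
  exact this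

/-- A lower bound for a linear form on the spectrahedra of `A + tB` holds on that of `A + εB`. -/
theorem le_linFormEps_of_forall_le (hA₀ : A₀.transpose = A₀) (hB : B.PosDef)
    (hA : ∀ i, (A i).transpose = A i) {s : ℝ → Fin n → ℝ} {c : ℚ}
    (hs : ∀ k, (fun t => s t k) =O[nearZero] expPow c)
    (hsB : ∀ᶠ t in nearZero, IsPSD (pencil (A₀ + (t / 2) • B) A (s t)))
    {l : Fin n → ℝ} {φ : ℝ → ℝ} {z : Puiseux} (hφ : Expands φ z)
    (hl : ∀ᶠ t in nearZero, ∀ x, IsPSD (pencil (A₀ + t • B) A x) → φ t ≤ linForm l x)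
    {y : Fin n → Puiseux} (hy : y ∈ perturbedSpectrahedron A₀ A B) : z ≤ linFormEps l y := by
  choose x hx using fun k => exists_expands (y k)
  have hBpsd := posSemidef_iff_isPSD.1 hB.posSemidef
  have hly := expands_linForm l (x := fun t k => x k t) hx
  rw [← sub_nonneg]
  refine (hly.sub hφ).nonneg_of_eventually fun a => ?_
  obtain ⟨d, hd⟩ := hly.exists_isBigO
  have hls : (fun t => linForm l (s t)) =O[nearZero] expPow c :=
    by
    refine (IsBigO.sum (s := Finset.univ) fun k _ => (hs k).const_mul_left (l k)).congr_left
      fun t => ?_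
    simp [linForm]
  -- Large enough that the perturbation t^b (l(s) - l(x)) is O(t^a); b ≥ 1 makes the weight t^b tend
  -- to 0.
  set b : ℚ := max 1 (max (a - c) (a - d)) with hb
  have hθ : (fun t => expPow b t) =O[nearZero] expPow b := isBigO_refl _ _
  refine ⟨fun t => expPow b t * (linForm l (s t) - linForm l fun k => x k t), ?_, ?_⟩
  · have h1 := (expPow_mul_isBigO (𝕜 := ℝ) hθ hls).trans (expPow_isBigO (a := a) (by
      have := (le_max_left (a - c) (a - d)).trans (le_max_right 1 _)
      linarith))
    have h2 := (expPow_mul_isBigO (𝕜 := ℝ) hθ hd).trans (expPow_isBigO (a := a) (by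
      have := (le_max_right (a - c) (a - d)).trans (le_max_right 1 _)
      linarith))
    exact (h1.sub h2).congr_left fun t => by ring
  · have hsmall : ∀ᶠ t in nearZero, expPow b t < 1 / 4 :=
      (tendsto_expPow (lt_of_lt_of_le one_pos (le_max_left _ _))).eventually_lt_const (by norm_num)
    filter_upwards [hl, hsB, eventually_nearZero_pos, hsmall,
      eventually_isPSD_of_mem_perturbedSpectrahedron hA₀ hB hA hx hy (2 * b + 1)] with t ht hst ht0 hbt
      hyt
    set θ := expPow b t with hθt
    have hθ0 : 0 < θ := expPow_pos b t
    have he : expPow (2 * b + 1) t = θ * θ * t := by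
      rw [expPow_add, two_mul, expPow_add, expPow_one ht0]
    -- With θ = t^b, the lifted point lies in S(A + (t + θ²t)B). Mixing in s(t) with weight θ gains
    -- θt/2 in the parameter and loses (1 - θ)θ²t, which is less because θ < 1/4.
    have hconv : IsPSD (pencil (A₀ + t • B) A ((1 - θ) • (fun k => x k t) + θ • s t)) := by
      have h1 := ((hyt.smul (sub_nonneg.2 (show θ ≤ 1 by linarith))).add (hst.smul hθ0.le)).add
        (hBpsd.smul (show 0 ≤ t * θ * (1 / 2 - (1 - θ) * θ) from
          mul_nonneg (mul_nonneg ht0.le hθ0.le) (by nlinarith)))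
      convert h1 using 1
      rw [pencil_convex _ _ (by ring), he]
      simp only [pencil]
      module
    have h2 := ht _ hconv
    rw [linForm_add, linForm_smul, linForm_smul] at h2
    simp only [Pi.sub_apply]
    linarith

end Transfer

/-! ### Existence and expansion of minimizers -/

section Minimizers

open Filter Topology Asymptotics Puiseux

variable {m n : ℕ} {A₀ B : Matrix (Fin m) (Fin m) ℝ} {A : Fin n → Matrix (Fin m) (Fin m) ℝ}
  {l : Fin n → ℝ}

theorem isClosed_setOf_isPSD : IsClosed {M : Matrix (Fin m) (Fin m) ℝ | IsPSD M} := by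
  have h : {M : Matrix (Fin m) (Fin m) ℝ | IsPSD M}
      = {M | M.transpose = M} ∩ ⋂ v : Fin m → ℝ, {M | 0 ≤ v ⬝ᵥ M.mulVec v} := by
    ext M
    simp [IsPSD]
  rw [h]
  refine (isClosed_eq (by fun_prop) continuous_id).inter (isClosed_iInter fun v => ?_)
  exact isClosed_le continuous_const (by fun_prop)

theorem continuous_pencil_smul (M : Matrix (Fin m) (Fin m) ℝ)
    (A : Fin n → Matrix (Fin m) (Fin m) ℝ) :
    Continuous fun p : ℝ × (Fin n → ℝ) => pencil (p.1 • M) A p.2 := by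
  unfold pencil
  fun_prop

theorem continuous_linForm (l : Fin n → ℝ) : Continuous (linForm l) := by
  unfold linForm
  fun_prop

theorem abs_linForm_le (l x : Fin n → ℝ) : |linForm l x| ≤ (∑ i, |l i|) * ‖x‖ := by
  rw [linForm, Finset.sum_mul]
  refine (Finset.abs_sum_le_sum_abs _ _).trans (Finset.sum_le_sum fun i _ => ?_)
  rw [abs_mul]
  exact mul_le_mul_of_nonneg_left (norm_le_pi_norm x i) (abs_nonneg _)

theorem pencil_smul_smul (c : ℝ) (M : Matrix (Fin m) (Fin m) ℝ) (x : Fin n → ℝ) :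
    pencil (c • M) A (c • x) = c • pencil M A x := by
  simp [pencil, Finset.smul_sum, smul_smul]

/-- A linear form that is positive on the nonzero recession directions is coercive. -/
theorem exists_coercive (M : Matrix (Fin m) (Fin m) ℝ)
    (hpos : ∀ d, IsPSD (pencil 0 A d) → d ≠ 0 → 0 < linForm l d) :
    ∃ c : ℝ, 0 < c ∧ ∃ C, ∀ x, IsPSD (pencil M A x) → c * ‖x‖ ≤ linForm l x + C := by
  by_contra hcon
  push Not at hcon
  choose x hx hlx using fun k : ℕ => hcon (1 / (k + 1)) (by positivity) k
  set L := ∑ i, |l i|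
  have hL : 0 ≤ L := Finset.sum_nonneg fun i _ => abs_nonneg _
  have hk : ∀ k : ℕ, (k : ℝ) < (1 + L) * ‖x k‖ := by
    intro k
    have h1 := (abs_le.1 (abs_linForm_le l (x k))).1
    have h2 : 1 / ((k : ℝ) + 1) * ‖x k‖ ≤ 1 * ‖x k‖ :=
      mul_le_mul_of_nonneg_right (by
        rw [div_le_one (by positivity)]
        linarith [Nat.cast_nonneg (α := ℝ) k]) (norm_nonneg _)
    have h3 := hlx k
    linarith
  have hx0 : ∀ k, 0 < ‖x k‖ := fun k => by
    have h1 := (Nat.cast_nonneg (α := ℝ) k).trans_lt (hk k)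
    exact pos_of_mul_pos_right h1 (by positivity)
  have hu : ∀ k, ‖x k‖⁻¹ • x k ∈ Metric.sphere (0 : Fin n → ℝ) 1 := fun k => by
    rw [mem_sphere_zero_iff_norm, norm_smul, norm_inv, norm_norm, inv_mul_cancel₀ (hx0 k).ne']
  obtain ⟨u, hu1, φ, hφ, hlim⟩ := (isCompact_sphere (0 : Fin n → ℝ) 1).tendsto_subseq hu
  have hr : Tendsto (fun k => ‖x k‖⁻¹) atTop (𝓝 0) := by
    have h1 : Tendsto (fun k : ℕ => (1 + L) * ‖x k‖) atTop atTop :=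
      tendsto_atTop_mono (fun k => (hk k).le) tendsto_natCast_atTop_atTop
    have h2 := (h1.inv_tendsto_atTop).const_mul (1 + L)
    rw [mul_zero] at h2
    refine h2.congr fun k => ?_
    have : (1 + L) ≠ 0 := by positivity
    simp only [Pi.inv_apply]
    field_simp
  have hD : IsPSD (pencil 0 A u) := by
    have h1 := ((continuous_pencil_smul M A).tendsto (0, u)).comp
      ((hr.comp hφ.tendsto_atTop).prodMk_nhds hlim)
    rw [zero_smul] at h1
    refine isClosed_setOf_isPSD.mem_of_tendsto h1 (Eventually.of_forall fun k => ?_)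
    change IsPSD (pencil (‖x (φ k)‖⁻¹ • M) A (‖x (φ k)‖⁻¹ • x (φ k)))
    rw [pencil_smul_smul]
    exact (hx _).smul (inv_nonneg.2 (norm_nonneg _))
  have hu0 : u ≠ 0 := by
    rintro rfl
    rw [mem_sphere_zero_iff_norm, norm_zero] at hu1
    exact zero_ne_one hu1
  have h1 : Tendsto (fun k => linForm l (‖x (φ k)‖⁻¹ • x (φ k))) atTop (𝓝 (linForm l u)) :=
    ((continuous_linForm l).tendsto u).comp hlim
  have h2 : Tendsto (fun k => 1 / ((φ k : ℝ) + 1)) atTop (𝓝 0) :=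
    tendsto_one_div_add_atTop_nhds_zero_nat.comp hφ.tendsto_atTop
  refine (hpos u hD hu0).not_ge (le_of_tendsto_of_tendsto' h1 h2 fun k => ?_)
  have h3 := hlx (φ k)
  rw [linForm_smul, inv_mul_le_iff₀ (hx0 _)]
  linarith [Nat.cast_nonneg (α := ℝ) (φ k)]

theorem exists_minimizer {M : Matrix (Fin m) (Fin m) ℝ}
    (hpos : ∀ d, IsPSD (pencil 0 A d) → d ≠ 0 → 0 < linForm l d)
    (hne : ∃ x, IsPSD (pencil M A x)) : ∃ x, IsPSD (pencil M A x) ∧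
      ∀ y, IsPSD (pencil M A y) → linForm l x ≤ linForm l y := by
  obtain ⟨c, hc, C, hC⟩ := exists_coercive M hpos
  obtain ⟨x₀, hx₀⟩ := hne
  have hcl : IsClosed {x | IsPSD (pencil M A x)} := by
    refine isClosed_setOf_isPSD.preimage (?_ : Continuous fun x => pencil M A x)
    unfold pencil
    fun_prop
  have hK : IsCompact ({x | IsPSD (pencil M A x)} ∩
      Metric.closedBall 0 ((linForm l x₀ + C) / c)) :=
    (isCompact_closedBall _ _).inter_left hcl
  have hball : ∀ y, IsPSD (pencil M A y) → linForm l y ≤ linForm l x₀ →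
      y ∈ Metric.closedBall (0 : Fin n → ℝ) ((linForm l x₀ + C) / c) := by
    intro y hy hle
    rw [mem_closedBall_zero_iff, le_div_iff₀ hc, mul_comm]
    exact (hC y hy).trans (by linarith)
  obtain ⟨x, hx, hmin⟩ := hK.exists_isMinOn ⟨x₀, hx₀, hball x₀ hx₀ le_rfl⟩
    (continuous_linForm l).continuousOn
  refine ⟨x, hx.1, fun y hy => ?_⟩
  rcases le_total (linForm l y) (linForm l x₀) with h | h
  · exact hmin ⟨hy, hball y hy h⟩
  · exact (hmin ⟨hx₀, hball x₀ hx₀ le_rfl⟩).trans h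

theorem IsPSD.pencil_add_smul (hB : IsPSD B) {s t : ℝ} (hst : s ≤ t) {x : Fin n → ℝ}
    (hx : IsPSD (pencil (A₀ + s • B) A x)) : IsPSD (pencil (A₀ + t • B) A x) := by
  have h := hx.add (hB.smul (sub_nonneg.2 hst))
  convert h using 1
  simp only [pencil]
  module

variable (A₀ A B l) in
/-- The coordinates of the minimizers of `l` over the spectrahedra of `A + tB` are algebraic
functions of `t`. -/
def HasAlgebraicMinimizers : Prop :=
  ∀ j, ∃ q : MvPolynomial (Fin 2) ℝ, q ≠ 0 ∧ ∀ (t : ℝ) (x : Fin n → ℝ),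
    0 < t → IsPSD (pencil (A₀ + t • B) A x) →
    (∀ y, IsPSD (pencil (A₀ + t • B) A y) → linForm l x ≤ linForm l y) →
    MvPolynomial.eval ![t, x j] q = 0

/-- A point of S(A + (t/2)B) makes the pencil of A + tB definite, hence invertible, so P = 1 is
allowed. -/
theorem isGeneric_hasAlgebraicMinimizers (hA₀ : A₀.transpose = A₀) (hB : B.PosDef)
    (hA : ∀ i, (A i).transpose = A i) (hne : ∀ t : ℝ, 0 < t → ∃ x, IsPSD (pencil (A₀ + t • B) A x)) :
    IsGeneric fun l => HasAlgebraicMinimizers A₀ B A l := by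
  have hBpsd := posSemidef_iff_isPSD.1 hB.posSemidef
  refine isGeneric_minimizer_algebraic (P := 1) hA₀ hBpsd.1 hA fun t ht x _ =>
    ⟨mul_one _, ?_⟩
  obtain ⟨x₀, hx₀⟩ := hne (t / 2) (by positivity)
  have hdef : (pencil (A₀ + t • B) A x₀).PosDef := by
    have h := Matrix.PosDef.posSemidef_add (posSemidef_iff_isPSD.2 hx₀)
      (hB.smul (show 0 < t / 2 by positivity))
    have heq : pencil (A₀ + t • B) A x₀ = pencil (A₀ + (t / 2) • B) A x₀ + (t / 2) • B := by
      simp only [pencil]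
      module
    rwa [heq]
  exact ⟨x₀, (pencil (A₀ + t • B) A x₀)⁻¹, posSemidef_iff_isPSD.1 hdef.posSemidef,
    Matrix.nonsing_inv_mul _ hdef.det_pos.ne'.isUnit⟩

/-- A minimizer is chosen arbitrarily for each t: the polynomial relation alone yields an expansion
along the ultrafilter, with no continuity in t. -/
theorem exists_expands_minimizer
    (hpos : ∀ d, IsPSD (pencil 0 A d) → d ≠ 0 → 0 < linForm l d)
    (hne : ∀ t : ℝ, 0 < t → ∃ x, IsPSD (pencil (A₀ + t • B) A x))
    (halg : HasAlgebraicMinimizers A₀ B A l) :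
    ∃ (x : ℝ → Fin n → ℝ) (y : Fin n → Puiseux),
      (∀ t, 0 < t → IsPSD (pencil (A₀ + t • B) A (x t)) ∧
        ∀ z, IsPSD (pencil (A₀ + t • B) A z) → linForm l (x t) ≤ linForm l z) ∧
      ∀ k, Expands (fun t => x t k) (y k) := by
  have h : ∀ t : ℝ, ∃ x, 0 < t → IsPSD (pencil (A₀ + t • B) A x) ∧
      ∀ z, IsPSD (pencil (A₀ + t • B) A z) → linForm l x ≤ linForm l z := by
    intro t
    by_cases ht : 0 < t
    · obtain ⟨x, hx⟩ := exists_minimizer hpos (hne t ht)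
      exact ⟨x, fun _ => hx⟩
    · exact ⟨0, fun h => absurd h ht⟩
  choose x hx using h
  have hy : ∀ k, ∃ z, Expands (fun t => x t k) z := by
    intro k
    obtain ⟨q, hq0, hq⟩ := halg k
    obtain ⟨f, hf, hfx⟩ := exists_asym_of_mvPolynomial hq0 (h := fun t => x t k) (by
      filter_upwards [eventually_nearZero_pos] with t ht
      exact hq t (x t) ht (hx t ht).1 (hx t ht).2)
    obtain ⟨z, rfl⟩ := exists_toHahn_eq hf
    exact ⟨z, hfx⟩
  choose y hy using hy
  exact ⟨x, y, hx, hy⟩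

theorem exists_isBigO_of_expands {x : ℝ → Fin n → ℝ} {y : Fin n → Puiseux}
    (h : ∀ k, Expands (fun t => x t k) (y k)) :
    ∃ c, ∀ k, (fun t => x t k) =O[nearZero] expPow c := by
  choose c hc using fun k => (h k).exists_isBigO
  refine ⟨-∑ k, |c k|, fun k => (hc k).trans (expPow_isBigO ?_)⟩
  have h1 := Finset.single_le_sum (f := fun k => |c k|) (fun i _ => abs_nonneg _)
    (Finset.mem_univ k)
  have h2 := neg_abs_le (c k)
  linarith

/-- If `S(A + εB)` is nonempty, then so are the spectrahedra of `A + tB`. -/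
theorem nonempty_of_perturbedSpectrahedron (hA₀ : A₀.transpose = A₀) (hB : B.PosDef)
    (hA : ∀ i, (A i).transpose = A i) (hne : (perturbedSpectrahedron A₀ A B).Nonempty)
    (t : ℝ) (ht : 0 < t) : ∃ x, IsPSD (pencil (A₀ + t • B) A x) := by
  obtain ⟨y, hy⟩ := hne
  choose x hx using fun k => exists_expands (y k)
  have h1 := eventually_isPSD_of_mem_perturbedSpectrahedron hA₀ hB hA
    (x := fun t k => x k t) hx hy 1
  have h2 : ∀ᶠ s : ℝ in nearZero, s < t / 2 :=
    nearZero_le (nhdsWithin_le_nhds (Iio_mem_nhds (by positivity)))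
  obtain ⟨s, hs, hst, hs0⟩ := (h1.and (h2.and eventually_nearZero_pos)).exists
  refine ⟨_, (posSemidef_iff_isPSD.1 hB.posSemidef).pencil_add_smul ?_ hs⟩
  rw [expPow_one hs0]
  linarith

end Minimizers

/-! ### Order-convex sets and their boundary -/

section Frontier

open Set Topology

theorem ordConnected_image_linForm {K : Type*} [Field K] [LinearOrder K] [IsStrictOrderedRing K]
    {n : ℕ} {S : Set (Fin n → K)} (l : Fin n → K)
    (hS : ∀ x ∈ S, ∀ y ∈ S, ∀ a b : K, 0 ≤ a → 0 ≤ b → a + b = 1 → a • x + b • y ∈ S) :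
    (linForm l '' S).OrdConnected := by
  refine ⟨?_⟩
  rintro _ ⟨x, hx, rfl⟩ _ ⟨y, hy, rfl⟩ c ⟨hc1, hc2⟩
  rcases (hc1.trans hc2).eq_or_lt with h | h
  · exact ⟨x, hx, le_antisymm hc1 (h ▸ hc2)⟩
  · have h0 : 0 < linForm l y - linForm l x := sub_pos.2 h
    refine ⟨_, hS x hx y hy ((linForm l y - c) / (linForm l y - linForm l x))
      ((c - linForm l x) / (linForm l y - linForm l x)) (div_nonneg (sub_nonneg.2 hc2) h0.le)
      (div_nonneg (sub_nonneg.2 hc1) h0.le) ?_, ?_⟩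
    · rw [← add_div, div_eq_one_iff_eq h0.ne']
      ring
    · rw [linForm_add, linForm_smul, linForm_smul, div_mul_eq_mul_div, div_mul_eq_mul_div,
        ← add_div, div_eq_iff h0.ne']
      ring

variable {K : Type*} [LinearOrder K] [TopologicalSpace K] [OrderTopology K] {I : Set K}

/-- ℝ⟨ε⟩ is not order complete, so a bounded convex set may have no supremum; closedness is derived
from attained ends instead. -/
theorem Set.OrdConnected.isClosed_of_attained (hI : I.OrdConnected)
    (h1 : (∀ a, ∃ b ∈ I, b ≤ a) ∨ ∃ a, IsLeast I a)
    (h2 : (∀ a, ∃ b ∈ I, a ≤ b) ∨ ∃ a, IsGreatest I a) : IsClosed I := by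
  have hI' : I = {x | ∃ b ∈ I, b ≤ x} ∩ {x | ∃ b ∈ I, x ≤ b} :=
    Subset.antisymm (fun x hx => ⟨⟨x, hx, le_rfl⟩, ⟨x, hx, le_rfl⟩⟩)
      fun x ⟨⟨a, ha, hax⟩, ⟨b, hb, hxb⟩⟩ => hI.out ha hb ⟨hax, hxb⟩
  rw [hI']
  refine IsClosed.inter ?_ ?_
  · rcases h1 with h | ⟨a, ha⟩
    · convert isClosed_univ
      exact eq_univ_of_forall h
    · convert isClosed_Ici (a := a)
      ext x
      exact ⟨fun ⟨b, hb, hbx⟩ => (ha.2 hb).trans hbx, fun h => ⟨a, ha.1, h⟩⟩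
  · rcases h2 with h | ⟨a, ha⟩
    · convert isClosed_univ
      exact eq_univ_of_forall h
    · convert isClosed_Iic (a := a)
      ext x
      exact ⟨fun ⟨b, hb, hbx⟩ => hbx.trans (ha.2 hb), fun h => ⟨a, ha.1, h⟩⟩

theorem Set.OrdConnected.isLeast_or_isGreatest (hI : I.OrdConnected) {a : K} (ha : a ∈ I)
    (hf : a ∈ frontier I) : IsLeast I a ∨ IsGreatest I a := by
  by_contra hcon
  rw [not_or] at hcon
  have h1 : ∃ b ∈ I, b < a := by
    by_contra h
    push Not at h
    exact hcon.1 ⟨ha, fun b hb => h b hb⟩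
  have h2 : ∃ b ∈ I, a < b := by
    by_contra h
    push Not at h
    exact hcon.2 ⟨ha, fun b hb => h b hb⟩
  obtain ⟨b, hb, hba⟩ := h1
  obtain ⟨c, hc, hac⟩ := h2
  exact hf.2 (mem_interior_iff_mem_nhds.2 (Filter.mem_of_superset (Icc_mem_nhds hba hac)
    (hI.out hb hc)))

theorem IsLeast.mem_frontier [DenselyOrdered K] [NoMinOrder K] {a : K} (ha : IsLeast I a) : a ∈ frontier I := by
  rw [frontier_eq_closure_inter_closure]
  refine ⟨subset_closure ha.1, closure_mono (s := Iio a) (t := Iᶜ) (fun b hb hbI => ?_) ?_⟩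
  · exact (ha.2 hbI).not_gt hb
  · rw [closure_Iio]
    exact mem_Iic.2 le_rfl

theorem IsGreatest.mem_frontier [DenselyOrdered K] [NoMaxOrder K] {a : K} (ha : IsGreatest I a) : a ∈ frontier I := by
  rw [frontier_eq_closure_inter_closure]
  refine ⟨subset_closure ha.1, closure_mono (s := Ioi a) (t := Iᶜ) (fun b hb hbI => ?_) ?_⟩
  · exact (ha.2 hbI).not_gt hb
  · rw [closure_Ioi]
    exact mem_Ici.2 le_rfl

end Frontier

/-! ### Regular linear forms and limits of minimizers -/

section Main

open Filter Topology Asymptotics Puiseux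

variable {m n : ℕ} {A₀ B : Matrix (Fin m) (Fin m) ℝ} {A : Fin n → Matrix (Fin m) (Fin m) ℝ}
  {l : Fin n → ℝ}

variable (A₀ B A l) in
/-- The genericity conditions on the linear form `l`. -/
structure IsRegularForm : Prop where
  unique : ∀ x y, IsPSD (pencil A₀ A x) → IsPSD (pencil A₀ A y) →
    (∀ z, IsPSD (pencil A₀ A z) → linForm l x ≤ linForm l z) →
    (∀ z, IsPSD (pencil A₀ A z) → linForm l y ≤ linForm l z) → x = y
  recession : (∃ d, IsPSD (pencil 0 A d) ∧ linForm l d < 0) ∨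
    ∀ d, IsPSD (pencil 0 A d) → d ≠ 0 → 0 < linForm l d
  algebraic : HasAlgebraicMinimizers A₀ B A l
  algebraic_half : HasAlgebraicMinimizers A₀ ((1 / 2 : ℝ) • B) A l

theorem isGeneric_isRegularForm (hA₀ : A₀.transpose = A₀) (hB : B.PosDef)
    (hA : ∀ i, (A i).transpose = A i) (hne : (perturbedSpectrahedron A₀ A B).Nonempty) :
    IsGeneric fun l => IsRegularForm A₀ B A l := by
  have hS := nonempty_of_perturbedSpectrahedron hA₀ hB hA hne
  refine ((isGeneric_minimizer_unique hA₀ hA).and ((isGeneric_recession hA).and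
    ((isGeneric_hasAlgebraicMinimizers hA₀ hB hA hS).and (isGeneric_hasAlgebraicMinimizers hA₀
      (hB.smul (show (0 : ℝ) < 1 / 2 by norm_num)) hA fun t ht => ?_)))).mono fun l hl =>
      ⟨hl.1, hl.2.1, hl.2.2.1, hl.2.2.2⟩
  rw [smul_smul]
  exact hS _ (by positivity)

/-- Points of `S(A + tB)` at which the pencil is definite, of moderate growth when `t → 0`. -/
theorem exists_strict_points (hpos : ∀ d, IsPSD (pencil 0 A d) → d ≠ 0 → 0 < linForm l d)
    (hne : ∀ t : ℝ, 0 < t → ∃ x, IsPSD (pencil (A₀ + t • B) A x))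
    (halg : HasAlgebraicMinimizers A₀ ((1 / 2 : ℝ) • B) A l) :
    ∃ (s : ℝ → Fin n → ℝ) (c : ℚ), (∀ k, (fun t => s t k) =O[nearZero] expPow c) ∧
      ∀ᶠ t : ℝ in nearZero, IsPSD (pencil (A₀ + (t / 2) • B) A (s t)) := by
  obtain ⟨s, y, hs, hsy⟩ := exists_expands_minimizer hpos (fun t ht => by
    rw [smul_smul]
    exact hne _ (by positivity)) halg
  obtain ⟨c, hc⟩ := exists_isBigO_of_expands hsy
  refine ⟨s, c, hc, ?_⟩
  filter_upwards [eventually_nearZero_pos] with t ht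
  have := (hs t ht).1
  rwa [smul_smul, mul_one_div] at this

namespace IsRegularForm

theorem exists_minimizer_perturbed (hA₀ : A₀.transpose = A₀) (hB : B.PosDef)
    (hA : ∀ i, (A i).transpose = A i) (hl : IsRegularForm A₀ B A l)
    (hpos : ∀ d, IsPSD (pencil 0 A d) → d ≠ 0 → 0 < linForm l d)
    (hne : (perturbedSpectrahedron A₀ A B).Nonempty) :
    ∃ y ∈ perturbedSpectrahedron A₀ A B, ∀ z ∈ perturbedSpectrahedron A₀ A B,
      linFormEps l y ≤ linFormEps l z := by
  have hS := nonempty_of_perturbedSpectrahedron hA₀ hB hA hne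
  obtain ⟨x, y, hx, hxy⟩ := exists_expands_minimizer hpos hS hl.algebraic
  obtain ⟨s, c, hs, hsB⟩ := exists_strict_points hpos hS hl.algebraic_half
  refine ⟨y, mem_perturbedSpectrahedron_of_expands hA₀ (posSemidef_iff_isPSD.1 hB.posSemidef).1 hA
    hxy ?_, fun z hz => le_linFormEps_of_forall_le hA₀ hB hA hs hsB (expands_linForm l hxy) ?_ hz⟩
  · filter_upwards [eventually_nearZero_pos] with t ht using (hx t ht).1
  · filter_upwards [eventually_nearZero_pos] with t ht using (hx t ht).2

theorem const_mem_perturbedSpectrahedron (hA₀ : A₀.transpose = A₀) (hB : B.PosDef)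
    (hA : ∀ i, (A i).transpose = A i) {x : Fin n → ℝ} (hx : IsPSD (pencil A₀ A x)) :
    (fun k => Puiseux.const (x k)) ∈ perturbedSpectrahedron A₀ A B := by
  have hBpsd := posSemidef_iff_isPSD.1 hB.posSemidef
  refine mem_perturbedSpectrahedron_of_expands hA₀ hBpsd.1 hA
    (x := fun _ => x) (fun k => Expands.const (x k)) ?_
  filter_upwards [eventually_nearZero_pos] with t ht
  refine hBpsd.pencil_add_smul ht.le ?_
  rwa [zero_smul, add_zero]

/-- The coercivity estimate a‖z‖ ≤ l(z) + C on S(A + B) holds on S(A + tB) for t < 1. Written as the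
linear bounds l(z) - aσz_k ≥ -C with σ = ±1, it transfers to ℝ⟨ε⟩, and l(y) is at most the real
number l(x) for any x in S(A). -/
theorem isBounded_of_minimizer (hA₀ : A₀.transpose = A₀) (hB : B.PosDef)
    (hA : ∀ i, (A i).transpose = A i) (hl : IsRegularForm A₀ B A l)
    (hpos : ∀ d, IsPSD (pencil 0 A d) → d ≠ 0 → 0 < linForm l d)
    (hne : ∃ x, IsPSD (pencil A₀ A x)) {y : Fin n → Puiseux}
    (hy : y ∈ perturbedSpectrahedron A₀ A B)
    (hmin : ∀ z ∈ perturbedSpectrahedron A₀ A B, linFormEps l y ≤ linFormEps l z) :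
    ∀ k, (y k).IsBounded := by
  have hBpsd := posSemidef_iff_isPSD.1 hB.posSemidef
  have hS := nonempty_of_perturbedSpectrahedron hA₀ hB hA ⟨y, hy⟩
  obtain ⟨s, c, hs, hsB⟩ := exists_strict_points hpos hS hl.algebraic_half
  obtain ⟨a, ha, C, hC⟩ := exists_coercive (A₀ + (1 : ℝ) • B) hpos
  obtain ⟨x, hx⟩ := hne
  have hle : linFormEps l y ≤ Puiseux.const (linForm l x) := by
    refine (hmin _ (const_mem_perturbedSpectrahedron hA₀ hB hA hx)).trans_eq ?_
    simp [linFormEps, linForm]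
  have key : ∀ (k : Fin n) (σ : ℝ), |σ| = 1 →
      Puiseux.const (a * σ) * y k ≤ Puiseux.const (linForm l x + C) := by
    intro k σ hσ
    have h1 := le_linFormEps_of_forall_le hA₀ hB hA hs hsB
      (l := l - Pi.single k (a * σ)) (Expands.const (-C)) ?_ hy
    · have h2 : linFormEps (l - Pi.single k (a * σ)) y
          = linFormEps l y - Puiseux.const (a * σ) * y k := by
        have h3 : (fun i => Puiseux.const ((l - Pi.single k (a * σ) : Fin n → ℝ) i))
            = (fun i => Puiseux.const (l i)) - Pi.single k (Puiseux.const (a * σ)) := by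
          funext i
          by_cases hi : i = k
          · subst hi
            simp
          · simp [hi]
        rw [linFormEps, h3]
        simp [linFormEps, linForm, sub_mul, Finset.sum_sub_distrib, Pi.single_apply]
      rw [h2, map_neg] at h1
      rw [map_add]
      linarith
    · have h1 : ∀ᶠ t : ℝ in nearZero, t < 1 :=
        nearZero_le (nhdsWithin_le_nhds (Iio_mem_nhds one_pos))
      filter_upwards [h1] with t ht z hz
      have h2 := hC z (hBpsd.pencil_add_smul ht.le hz)
      have h3 : linForm (l - Pi.single k (a * σ)) z = linForm l z - a * σ * z k := by
        simp [linForm, sub_mul, Finset.sum_sub_distrib, Pi.single_apply]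
      have h4 : σ * z k ≤ ‖z‖ := by
        refine (le_abs_self _).trans ?_
        rw [abs_mul, hσ, one_mul]
        exact norm_le_pi_norm z k
      have h5 := mul_le_mul_of_nonneg_left h4 ha.le
      rw [h3]
      linarith
  intro k
  have ha' : (0 : Puiseux) < Puiseux.const a := by
    rw [← map_zero Puiseux.const]
    exact const_lt_const ha
  have h1 := key k 1 (by norm_num)
  have h2 := key k (-1) (by norm_num)
  have hdiv : Puiseux.const (linForm l x + C)
      = Puiseux.const a * Puiseux.const ((linForm l x + C) / a) := by
    rw [← map_mul, mul_div_cancel₀ _ ha.ne']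
  rw [mul_one, hdiv] at h1
  rw [mul_neg_one, map_neg, hdiv] at h2
  refine isBounded_of_abs_le (C := (linForm l x + C) / a) (le_of_mul_le_mul_left h1 ha') ?_
  have h3 : Puiseux.const a * -y k
      ≤ Puiseux.const a * Puiseux.const ((linForm l x + C) / a) := by
    rw [mul_neg, ← neg_mul]
    exact h2
  exact neg_le.1 (le_of_mul_le_mul_left h3 ha')

theorem isPSD_limEps (hA₀ : A₀.transpose = A₀) (hB : B.PosDef)
    (hA : ∀ i, (A i).transpose = A i) {y : Fin n → Puiseux} (hy : y ∈ perturbedSpectrahedron A₀ A B)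
    (hb : ∀ k, (y k).IsBounded) : IsPSD (pencil A₀ A fun k => (y k).limEps) := by
  choose x hx using fun k => exists_expands (y k)
  have h1 := eventually_isPSD_of_mem_perturbedSpectrahedron hA₀ hB hA
    (x := fun t k => x k t) hx hy 1
  have hlim : Tendsto (fun t k => x k t) nearZero (𝓝 fun k => (y k).limEps) :=
    tendsto_pi_nhds.2 fun k => (hx k).tendsto_limEps (hb k)
  have ht : Tendsto (fun t : ℝ => t) nearZero (𝓝 0) :=
    (tendsto_id.mono_right nhdsWithin_le_nhds).mono_left nearZero_le
  have ht2 := ht.add (tendsto_expPow one_pos)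
  rw [add_zero] at ht2
  have hcont : Continuous fun p : ℝ × (Fin n → ℝ) => pencil (A₀ + p.1 • B) A p.2 := by
    unfold pencil
    fun_prop
  have h2 := (hcont.tendsto (0, fun k => (y k).limEps)).comp (ht2.prodMk_nhds hlim)
  rw [zero_smul, add_zero] at h2
  exact isClosed_setOf_isPSD.mem_of_tendsto h2 h1

/-- Points of S(A) are constant points of S(A + εB); the inequality l(y) ≤ l(x) is preserved in the
limit. -/
theorem limEps_minimizer (hA₀ : A₀.transpose = A₀) (hB : B.PosDef)
    (hA : ∀ i, (A i).transpose = A i) {y : Fin n → Puiseux} (hb : ∀ k, (y k).IsBounded)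
    (hmin : ∀ z ∈ perturbedSpectrahedron A₀ A B, linFormEps l y ≤ linFormEps l z)
    {x : Fin n → ℝ} (hx : IsPSD (pencil A₀ A x)) :
    (linForm l fun k => (y k).limEps) ≤ linForm l x := by
  have h1 := hmin _ (const_mem_perturbedSpectrahedron hA₀ hB hA hx)
  rw [← sub_nonneg] at h1
  choose w hw using fun k => exists_expands (y k)
  have h2 := (expands_linForm l (x := fun _ => x) fun k => Expands.const (x k)).sub
    (expands_linForm l (x := fun t k => w k t) hw)
  have hlim : Tendsto (fun t k => w k t) nearZero (𝓝 fun k => (y k).limEps) :=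
    tendsto_pi_nhds.2 fun k => (hw k).tendsto_limEps (hb k)
  have h3 := (tendsto_const_nhds (x := linForm l x)).sub
    (((continuous_linForm l).tendsto _).comp hlim)
  rcases h1.eq_or_lt with h0 | h0
  · rw [← h0] at h2
    have h4 := h2.tendsto_limEps fun _ _ => rfl
    exact (sub_eq_zero.1 (tendsto_nhds_unique h3 h4)).ge
  · exact sub_nonneg.1 (ge_of_tendsto h3 ((h2.eventually_pos h0).mono fun t ht => ht.le))

/-- Every minimizer of `l` on `S(A)` is the limit of a minimizer on `S(A + εB)`. -/
theorem exists_limEps_eq (hA₀ : A₀.transpose = A₀) (hB : B.PosDef)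
    (hA : ∀ i, (A i).transpose = A i) (hl : IsRegularForm A₀ B A l) {x : Fin n → ℝ}
    (hx : IsPSD (pencil A₀ A x)) (hmin : ∀ z, IsPSD (pencil A₀ A z) → linForm l x ≤ linForm l z) :
    ∃ y ∈ perturbedSpectrahedron A₀ A B,
      (∀ z ∈ perturbedSpectrahedron A₀ A B, linFormEps l y ≤ linFormEps l z) ∧
      (∀ k, (y k).IsBounded) ∧ ∀ k, (y k).limEps = x k := by
  have hpos := hl.recession.resolve_left (by
    rintro ⟨d, hd, hld⟩
    have h1 : IsPSD (pencil A₀ A (x + d)) := by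
      convert hx.add hd using 1
      simp only [pencil, Pi.add_apply, add_smul, Finset.sum_add_distrib]
      abel
    have h2 := hmin _ h1
    rw [linForm_add] at h2
    linarith)
  obtain ⟨y, hy, hymin⟩ := hl.exists_minimizer_perturbed hA₀ hB hA hpos
    ⟨_, const_mem_perturbedSpectrahedron hA₀ hB hA hx⟩
  have hb := hl.isBounded_of_minimizer hA₀ hB hA hpos ⟨x, hx⟩ hy hymin
  have hlim := isPSD_limEps hA₀ hB hA hy hb
  refine ⟨y, hy, hymin, hb, fun k => congrFun (hl.unique _ x hlim hx
    (fun z hz => limEps_minimizer hA₀ hB hA hb hymin hz) hmin) k⟩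

/-- If `l` is negative on a recession direction, it is unbounded below on `S(A + εB)`. -/
theorem exists_linFormEps_le {d : Fin n → ℝ} (hd : IsPSD (pencil 0 A d)) (hld : linForm l d < 0)
    {y : Fin n → Puiseux} (hy : y ∈ perturbedSpectrahedron A₀ A B) (a : Puiseux) :
    ∃ z ∈ perturbedSpectrahedron A₀ A B, linFormEps l z ≤ a := by
  have hD : IsPSD ((pencil 0 A d).map Puiseux.const) :=
    isPSD_of_expands (M := fun _ => pencil 0 A d) (fun i j => Expands.const _)
      (by rw [← Matrix.transpose_map, hd.1]) (Eventually.of_forall fun _ => hd)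
  have hneg : Puiseux.const (linForm l d) < 0 := by
    rw [← map_zero Puiseux.const]
    exact const_lt_const hld
  -- Moving by c along d lowers `l` by |l(y) - a|, enough to reach a.
  set c := |linFormEps l y - a| / -Puiseux.const (linForm l d) with hc
  have hc0 : 0 ≤ c := div_nonneg (abs_nonneg _) (neg_nonneg.2 hneg.le)
  refine ⟨y + c • fun k => Puiseux.const (d k), mem_perturbedSpectrahedron.2 ?_, ?_⟩
  · convert (mem_perturbedSpectrahedron.1 hy).add (hD.smul hc0) using 1
    ext i j
    simp [pencil, Matrix.sum_apply, add_mul, Finset.sum_add_distrib, Finset.mul_sum, mul_assoc,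
      add_assoc]
  · have h1 : linFormEps l (y + c • fun k => Puiseux.const (d k))
        = linFormEps l y + c * Puiseux.const (linForm l d) := by
      rw [linFormEps, linForm_add, linForm_smul]
      simp [linForm]
    have h2 : c * -Puiseux.const (linForm l d) = |linFormEps l y - a| :=
      div_mul_cancel₀ _ (neg_pos.2 hneg).ne'
    have h3 := le_abs_self (linFormEps l y - a)
    rw [h1]
    linarith

/-- Every minimizer of `l` on `S(A + εB)` has a limit, which is a minimizer on `S(A)`. -/
theorem limEps_mem (hA₀ : A₀.transpose = A₀) (hB : B.PosDef)
    (hA : ∀ i, (A i).transpose = A i) (hl : IsRegularForm A₀ B A l) (hne : ∃ x, IsPSD (pencil A₀ A x))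
    {y : Fin n → Puiseux} (hy : y ∈ perturbedSpectrahedron A₀ A B)
    (hmin : ∀ z ∈ perturbedSpectrahedron A₀ A B, linFormEps l y ≤ linFormEps l z) :
    (∀ k, (y k).IsBounded) ∧ IsPSD (pencil A₀ A fun k => (y k).limEps) ∧
      ∀ z, IsPSD (pencil A₀ A z) → (linForm l fun k => (y k).limEps) ≤ linForm l z := by
  have hpos := hl.recession.resolve_left (by
    rintro ⟨d, hd, hld⟩
    obtain ⟨z, hz, hzl⟩ := exists_linFormEps_le hd hld hy (linFormEps l y - 1)
    have := hmin z hz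
    linarith)
  have hb := hl.isBounded_of_minimizer hA₀ hB hA hpos hne hy hmin
  exact ⟨hb, isPSD_limEps hA₀ hB hA hy hb, fun z hz => limEps_minimizer hA₀ hB hA hb hmin hz⟩

theorem perturbed_attained (hA₀ : A₀.transpose = A₀) (hB : B.PosDef)
    (hA : ∀ i, (A i).transpose = A i) (hl : IsRegularForm A₀ B A l)
    (hne : (perturbedSpectrahedron A₀ A B).Nonempty) :
    (∀ a, ∃ z ∈ perturbedSpectrahedron A₀ A B, linFormEps l z ≤ a) ∨
      ∃ y ∈ perturbedSpectrahedron A₀ A B, ∀ z ∈ perturbedSpectrahedron A₀ A B,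
        linFormEps l y ≤ linFormEps l z := by
  rcases hl.recession with ⟨d, hd, hld⟩ | hpos
  · obtain ⟨y, hy⟩ := hne
    exact Or.inl (exists_linFormEps_le hd hld hy)
  · exact Or.inr (hl.exists_minimizer_perturbed hA₀ hB hA hpos hne)

theorem attained (hl : IsRegularForm A₀ B A l) (hne : ∃ x, IsPSD (pencil A₀ A x)) :
    (∀ a, ∃ z, IsPSD (pencil A₀ A z) ∧ linForm l z ≤ a) ∨
      ∃ y, IsPSD (pencil A₀ A y) ∧ ∀ z, IsPSD (pencil A₀ A z) → linForm l y ≤ linForm l z := by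
  rcases hl.recession with ⟨d, hd, hld⟩ | hpos
  · obtain ⟨x, hx⟩ := hne
    refine Or.inl fun a => ⟨x + (|linForm l x - a| / -linForm l d) • d, ?_, ?_⟩
    · convert hx.add (hd.smul (div_nonneg (abs_nonneg (linForm l x - a))
        (neg_nonneg.2 hld.le))) using 1
      simp only [pencil, Pi.add_apply, add_smul, Finset.sum_add_distrib, Pi.smul_apply, zero_add,
        Finset.smul_sum, smul_smul, smul_eq_mul]
      abel
    · rw [linForm_add, linForm_smul]
      have h2 := div_mul_cancel₀ |linForm l x - a| (neg_pos.2 hld).ne'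
      have h3 := le_abs_self (linForm l x - a)
      linarith
  · exact Or.inr (exists_minimizer hpos hne)

end IsRegularForm

theorem linFormEps_neg (l : Fin n → ℝ) (y : Fin n → Puiseux) :
    linFormEps (-l) y = -linFormEps l y := by
  simp [linFormEps, linForm]

end Main

/-! ### Extreme values of images -/

section Attained

variable {K X : Type*} {S : Set X}

theorem isLeast_image_iff [LinearOrder K] {f : X → K} {x : X} (hx : x ∈ S) :
    IsLeast (f '' S) (f x) ↔ ∀ z ∈ S, f x ≤ f z :=
  ⟨fun h z hz => h.2 ⟨z, hz, rfl⟩, fun h => ⟨⟨x, hx, rfl⟩, by rintro _ ⟨z, hz, rfl⟩; exact h z hz⟩⟩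

variable [Field K] [LinearOrder K] [IsStrictOrderedRing K]

theorem isGreatest_image_iff {f g : X → K} (hg : ∀ x, g x = -f x) {x : X} (hx : x ∈ S) :
    IsGreatest (f '' S) (f x) ↔ ∀ z ∈ S, g x ≤ g z := by
  simp only [hg, neg_le_neg_iff]
  exact ⟨fun h z hz => h.2 ⟨z, hz, rfl⟩,
    fun h => ⟨⟨x, hx, rfl⟩, by rintro _ ⟨z, hz, rfl⟩; exact h z hz⟩⟩

theorem isClosed_image_of_attained [TopologicalSpace K] [OrderTopology K] {f g : X → K}
    (hg : ∀ x, g x = -f x) (hconn : (f '' S).OrdConnected)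
    (h1 : (∀ a, ∃ z ∈ S, f z ≤ a) ∨ ∃ y ∈ S, ∀ z ∈ S, f y ≤ f z)
    (h2 : (∀ a, ∃ z ∈ S, g z ≤ a) ∨ ∃ y ∈ S, ∀ z ∈ S, g y ≤ g z) : IsClosed (f '' S) := by
  refine hconn.isClosed_of_attained ?_ ?_
  · refine h1.imp (fun h a => ?_) fun ⟨y, hy, h⟩ => ⟨f y, (isLeast_image_iff hy).2 h⟩
    obtain ⟨z, hz, hza⟩ := h a
    exact ⟨f z, ⟨z, hz, rfl⟩, hza⟩
  · refine h2.imp (fun h a => ?_) fun ⟨y, hy, h⟩ => ⟨f y, (isGreatest_image_iff hg hy).2 h⟩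
    obtain ⟨z, hz, hza⟩ := h (-a)
    rw [hg, neg_le_neg_iff] at hza
    exact ⟨f z, ⟨z, hz, rfl⟩, hza⟩

end Attained

end

theorem mainTheorem8 (m n : ℕ) (A₀ : Matrix (Fin m) (Fin m) ℝ)
    (A : Fin n → Matrix (Fin m) (Fin m) ℝ) (B : Matrix (Fin m) (Fin m) ℝ)
    (hA₀ : A₀.IsSymm) (hA : ∀ i, (A i).IsSymm) (hB : B.PosDef) :
    ∃ U : Set (Fin n → ℂ), IsZariskiOpen U ∧ U.Nonempty ∧
      ∀ l : Fin n → ℝ, (fun i => (l i : ℂ)) ∈ U →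
        IsClosed (linForm l '' spectrahedron A₀ A) ∧
        IsClosed (linFormEps l '' perturbedSpectrahedron A₀ A B) ∧
        (∀ x ∈ spectrahedron A₀ A,
          linForm l x ∈ frontier (linForm l '' spectrahedron A₀ A) →
          ∃ xe ∈ perturbedSpectrahedron A₀ A B,
            linFormEps l xe ∈ frontier (linFormEps l '' perturbedSpectrahedron A₀ A B) ∧
            (∀ i, (xe i).IsBounded) ∧ ∀ i, (xe i).limEps = x i) ∧
        ((spectrahedron A₀ A).Nonempty →
          ∀ xe ∈ perturbedSpectrahedron A₀ A B,
            linFormEps l xe ∈ frontier (linFormEps l '' perturbedSpectrahedron A₀ A B) →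
            (∀ i, (xe i).IsBounded) ∧
            (fun i => (xe i).limEps) ∈ spectrahedron A₀ A ∧
            linForm l (fun i => (xe i).limEps) ∈
              frontier (linForm l '' spectrahedron A₀ A)) := by
  have hS : spectrahedron A₀ A = {x | IsPSD (pencil A₀ A x)} :=
    Set.ext fun x => mem_spectrahedron_iff
  rw [hS]
  by_cases hne : (perturbedSpectrahedron A₀ A B).Nonempty
  swap
  -- If S(A + εB) is empty, so is S(A), and every assertion is trivial for any `l`.
  · obtain ⟨U, hU, hUne, -⟩ := IsGeneric.exists_isZariskiOpen (n := n) (P := fun _ => True)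
      ⟨1, one_ne_zero, fun _ _ => trivial⟩
    have h1 : perturbedSpectrahedron A₀ A B = ∅ := Set.not_nonempty_iff_eq_empty.1 hne
    have h2 : {x | IsPSD (pencil A₀ A x)} = ∅ := by
      exact Set.eq_empty_of_forall_notMem fun x hx =>
        hne ⟨_, IsRegularForm.const_mem_perturbedSpectrahedron hA₀ hB hA hx⟩
    refine ⟨U, hU, hUne, fun l _ => ?_⟩
    simp [h1, h2]
  have hgen := isGeneric_isRegularForm hA₀ hB hA hne
  -- Regularity is imposed on both `l` and `-l`, to treat the lower and upper ends of the images
  -- alike.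
  obtain ⟨U, hU, hUne, hUl⟩ := (hgen.and hgen.neg).exists_isZariskiOpen
  refine ⟨U, hU, hUne, fun l hlU => ?_⟩
  obtain ⟨hl, hl'⟩ := hUl l hlU
  have hconn : (linForm l '' {x | IsPSD (pencil A₀ A x)}).OrdConnected :=
    ordConnected_image_linForm l fun x hx y hy a b ha hb hab => isPSD_pencil_convex hx hy ha hb hab
  have hconnEps : (linFormEps l '' perturbedSpectrahedron A₀ A B).OrdConnected :=
    ordConnected_image_linForm (fun i => Puiseux.const (l i)) fun x hx y hy a b ha hb hab =>
      mem_perturbedSpectrahedron.2 (isPSD_pencil_convex (mem_perturbedSpectrahedron.1 hx)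
        (mem_perturbedSpectrahedron.1 hy) ha hb hab)
  have hneg : ∀ x, linForm (-l) x = -linForm l x := linForm_neg l
  have hnegEps := linFormEps_neg l
  refine ⟨?_, ?_, ?_, ?_⟩
  · rcases Set.eq_empty_or_nonempty {x | IsPSD (pencil A₀ A x)} with h | h
    · simp [h]
    · exact isClosed_image_of_attained hneg hconn (hl.attained h) (hl'.attained h)
  · exact isClosed_image_of_attained hnegEps hconnEps (hl.perturbed_attained hA₀ hB hA hne)
      (hl'.perturbed_attained hA₀ hB hA hne)
  · intro x hx hfr
    rcases hconn.isLeast_or_isGreatest ⟨x, hx, rfl⟩ hfr with h | h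
    · obtain ⟨y, hy, hmin, hb, hlim⟩ := hl.exists_limEps_eq hA₀ hB hA hx
        ((isLeast_image_iff hx).1 h)
      exact ⟨y, hy, ((isLeast_image_iff hy).2 hmin).mem_frontier, hb, hlim⟩
    · obtain ⟨y, hy, hmin, hb, hlim⟩ := hl'.exists_limEps_eq hA₀ hB hA hx
        ((isGreatest_image_iff hneg hx).1 h)
      exact ⟨y, hy, ((isGreatest_image_iff hnegEps hy).2 hmin).mem_frontier, hb, hlim⟩
  · intro hSne y hy hfr
    rcases hconnEps.isLeast_or_isGreatest ⟨y, hy, rfl⟩ hfr with h | h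
    · obtain ⟨hb, hmem, hmin⟩ := hl.limEps_mem hA₀ hB hA hSne hy ((isLeast_image_iff hy).1 h)
      exact ⟨hb, hmem, IsLeast.mem_frontier ((isLeast_image_iff (f := linForm l) hmem).2 hmin)⟩
    · obtain ⟨hb, hmem, hmin⟩ := hl'.limEps_mem hA₀ hB hA hSne hy
        ((isGreatest_image_iff hnegEps hy).1 h)
      exact ⟨hb, hmem, IsGreatest.mem_frontier ((isGreatest_image_iff hneg hmem).2 hmin)⟩
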